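/- **Setting.** Let $H$ be a Hermitian $d\times d$ matrix with a non-degenerate ground state $|\psi_0\rangle$ (a unit vector) and spectral gap $\Delta>0$: every eigenvalue of $H$ on $|\psi_0\rangle^\perp$ is at least $\Delta$ above the ground state energy. $\|\cdot\|$ is the operator norm and $\|\cdot\|_1$ the trace norm. Let $\mathcal A$ be a finite nonempty set of $d\times d$ matrices with $\|A\|\le 1$ for $A\in\mathcal A$, closed under $A\mapsto -A$ and $A\mapsto A^\dagger$, and let $g$ be any probability density on $\mathbb R$. Let $A_S$ be uniform on $\mathcal A$, and let $\omega$ be independent of it with density $g$. For $\sigma,T,\alpha>0$ put $f(t)=(2\pi)^{-1/4}\sigma^{-1/2}e^{-t^2/(4\sigma^2)}$ and, on the system and one ancilla qubit, $$H_\alpha(t)=H-\tfrac{\omega}{2}Z+\alpha f(t)\left(A_S\otimes|1\rangle\langle0|+A_S^\dagger\otimes|0\rangle\langle1|\right),\qquad U^\alpha(T)=\mathcal T\exp\Big(-i\int_{-T}^{T}H_\alpha(s)\,ds\Big),$$ $$\Phi_\alpha(\rho)=\mathbb E_{A_S,\omega}\operatorname{Tr}_E\left[U^\alpha(T)(\rho\otimes\rho_E)U^\alpha(T)^\dagger\right],$$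 where $\rho_E$ is the zero temperature ($\beta=\infty$) state of $-\tfrac{\omega}{2}Z$: $|0\rangle\langle0|$ if $\omega>0$, $|1\rangle\langle1|$ if $\omega<0$, $I/2$ if $\omega=0$. Assume that $\Phi_\alpha$ has a unique fixed point $\rho_{\rm fix}$ among the density matrices and, for the given $\epsilon>0$, a (finite) mixing time $\tau=\min\{t\in\mathbb N:\ \|\Phi_\alpha^t(\rho)-\rho_{\rm fix}\|_1\le\epsilon\text{ for all density matrices }\rho\}$. Put $t_{\rm mix}=\alpha^2\tau$. With $A(t)=e^{iHt}Ae^{-iHt}$ let $$\widetilde V_A(\omega)=\int_{\mathbb R}f(t)A(t)e^{-i\omega t}dt,\qquad \widetilde{\mathcal G}_A(\omega)=\int_{\mathbb R}\int_{-\infty}^{s_1}f(s_2)f(s_1)A^\dagger(s_2)A(s_1)e^{i\omega(s_2-s_1)}ds_2\,ds_1,$$ $\mathcal D_V(\rho)=V\rho V^\dagger-\frac12\{V^\dagger V,\rho\}$, $\gamma(\omega)=(g(\omega)+g(-\omega))\mathbf 1_{\omega<0}$, and, with $\psi=|\psi_0\rangle\langle\psi_0|$, $$M=\mathbb E_{A_S}\int\gamma(\omega)\left(\big\|[\psi,\widetilde{\mathcal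 G}_{A_S}(\omega)]\big\|_1+\big\|[\psi,\widetilde{\mathcal G}_{A_S}(\omega)^\dagger]\big\|_1+\big\|\mathcal D_{\widetilde V_{A_S}(\omega)}(\psi)\big\|_1\right)d\omega .$$ **(1) Fixed point bound.** For every $c>0$ there is a constant $C>0$, depending only on $c$, such that for all data as above $$\|\rho_{\rm fix}-\psi\|_1\le\Big(M+C\big(\sigma e^{-T^2/(4\sigma^2)}\,\mathbb E\|A_S\|^2+\alpha^2T^4\sigma^{-2}\,\mathbb E\|A_S\|^4\big)\Big)\alpha^2\tau+\epsilon,$$ and, if moreover $\sigma\|H\|\ge c$, then $$M\le C\,\|H\|^{1/2}\sigma^{3/2}e^{-\sigma^2\Delta^2/32}\,\mathbb E\|A_S\|^2$$ and $$\|\rho_{\rm fix}-\psi\|_1\le C\Big(\big(\|H\|^{1/2}\sigma^{3/2}e^{-\sigma^2\Delta^2/32}\,\mathbb E\|A_S\|^2+\sigma e^{-T^2/(4\sigma^2)}\,\mathbb E\|A_S\|^2+\alpha^2T^4\sigma^{-2}\,\mathbb E\|A_S\|^4\big)\alpha^2\tau+\epsilon\Big).$$ **(2) Choice of parameters.** For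 every $\epsilon_0\in(0,1)$ there is a constant $K>0$, depending only on $\epsilon_0$, such that for all data as above with $0<\epsilon\le\epsilon_0$: if $$\sigma\ge K\Delta^{-1}\log\Big(2+\frac{\|H\|\,t_{\rm mix}}{\Delta^2\epsilon}\Big),\qquad T\ge K\sigma\log\Big(2+\frac{\sigma\,t_{\rm mix}}{\epsilon}\Big),\qquad \alpha\,T^{2}\,t_{\rm mix}^{1/2}\le K^{-1}\sigma\,\epsilon^{1/2},$$ then $\big\|\rho_{\rm fix}-|\psi_0\rangle\langle\psi_0|\big\|_1<\epsilon$. -/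

import Mathlib

open scoped Kronecker Matrix ComplexOrder

namespace SystemBath

noncomputable section

/-! Matrix norms and quantum states -/

/-- Trace norm `Tr √(A† A)`, i.e. the sum of the singular values of `A`. -/
def traceNorm {m : Type} [Fintype m] [DecidableEq m] (A : Matrix m m ℂ) : ℝ :=
  ∑ i, Real.sqrt ((Matrix.isHermitian_conjTranspose_mul_self A).eigenvalues i)

/-- Operator norm of `A` with respect to the Euclidean norm. -/
def opNorm {m : Type} [Fintype m] [DecidableEq m] (A : Matrix m m ℂ) : ℝ :=
  ‖Matrix.toEuclideanCLM (n := m) (𝕜 := ℂ) A‖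

/-- Density matrices (quantum states). -/
def IsDensityMatrix {m : Type} [Fintype m] (ρ : Matrix m m ℂ) : Prop :=
  ρ.PosSemidef ∧ ρ.trace = 1

/-- The rank-one operator `|ψ⟩⟨ψ|`. -/
def ketbra {m : Type} (ψ : m → ℂ) : Matrix m m ℂ :=
  Matrix.vecMulVec ψ (star ψ)

/-- The commutator `[A, B]`. -/
def commutator {m : Type} [Fintype m] (A B : Matrix m m ℂ) : Matrix m m ℂ :=
  A * B - B * A

/-- The dissipator `D_V(ρ) = V ρ V† - {V† V, ρ} / 2`. -/
def dissipator {m : Type} [Fintype m] (V ρ : Matrix m m ℂ) : Matrix m m ℂ :=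
  V * ρ * Vᴴ - (1 / 2 : ℂ) • (Vᴴ * V * ρ + ρ * (Vᴴ * V))

/-- Partial trace over the second tensor factor. -/
def partialTrace {m k : Type} [Fintype k] (M : Matrix (m × k) (m × k) ℂ) : Matrix m m ℂ :=
  Matrix.of fun i j => ∑ a, M (i, a) (j, a)

/-- `ψ` is a normalized ground state of `H`, and all the other energies (the eigenvalues of `H` on
the orthogonal complement of `ψ`) lie at least `Δ` above the ground state energy. -/
def IsGappedGroundState {m : Type} [Fintype m] (H : Matrix m m ℂ) (ψ : m → ℂ) (Δ : ℝ) : Prop :=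
  star ψ ⬝ᵥ ψ = 1 ∧ ∃ E₀ : ℝ, H *ᵥ ψ = (E₀ : ℂ) • ψ ∧
    ∀ (E : ℝ) (φ : m → ℂ), φ ≠ 0 → star ψ ⬝ᵥ φ = 0 → H *ᵥ φ = (E : ℂ) • φ → E₀ + Δ ≤ E

/-! Time-ordered exponentials -/

/-- The `k`-th term `(-i)^k ∫_{t₀ ≤ s_k ≤ … ≤ s_1 ≤ t} K(s_1) ⋯ K(s_k)` of the Dyson series
(integrals of matrices are taken entrywise). -/
def dysonTerm {m : Type} [Fintype m] [DecidableEq m] (K : ℝ → Matrix m m ℂ) (t₀ : ℝ) :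
    ℕ → ℝ → Matrix m m ℂ
  | 0, _ => 1
  | k + 1, t => Matrix.of fun i j =>
      -Complex.I * ∫ s in t₀..t, (K s * dysonTerm K t₀ k s) i j

/-- The time-ordered exponential `𝒯 exp(-i ∫_{t₀}^t K(s) ds)`, as the sum of its Dyson series. -/
def timeOrderedExp {m : Type} [Fintype m] [DecidableEq m] (K : ℝ → Matrix m m ℂ) (t₀ t : ℝ) :
    Matrix m m ℂ :=
  ∑' k, dysonTerm K t₀ k t

/-! The system-bath model -/

/-- The Gaussian filter `f(t) = (2π)^(-1/4) σ^(-1/2) exp(-t² / (4σ²))`. -/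
def gaussianFilter (σ t : ℝ) : ℝ :=
  Real.exp (-t ^ 2 / (4 * σ ^ 2)) / ((2 * Real.pi) ^ (1 / 4 : ℝ) * σ ^ (1 / 2 : ℝ))

/-- The environment Hamiltonian `H_E = -ω Z / 2` on the ancilla qubit. -/
def bathHamiltonian (ω : ℝ) : Matrix (Fin 2) (Fin 2) ℂ :=
  (-(ω / 2) : ℂ) • !![1, 0; 0, -1]

/-- The bath coupling operator `B_E = |1⟩⟨0|`. -/
def bathCoupling : Matrix (Fin 2) (Fin 2) ℂ :=
  !![0, 0; 1, 0]

/-- The zero temperature state of the ancilla, i.e. the limit of `exp(-β H_E) / Tr exp(-β H_E)` as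
`β → ∞`: it is `|0⟩⟨0|` for `ω > 0`, `|1⟩⟨1|` for `ω < 0` and `1/2` for `ω = 0`. -/
def bathGroundState (ω : ℝ) : Matrix (Fin 2) (Fin 2) ℂ :=
  if 0 < ω then !![1, 0; 0, 0] else if ω < 0 then !![0, 0; 0, 1] else (1 / 2 : ℂ) • 1

/-- `H_α(t) = H + H_E + α f(t) (A ⊗ B_E + A† ⊗ B_E†)`. -/
def totalHamiltonian {d : ℕ} (H A : Matrix (Fin d) (Fin d) ℂ) (σ α ω t : ℝ) :
    Matrix (Fin d × Fin 2) (Fin d × Fin 2) ℂ :=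
  H ⊗ₖ (1 : Matrix (Fin 2) (Fin 2) ℂ) + (1 : Matrix (Fin d) (Fin d) ℂ) ⊗ₖ bathHamiltonian ω +
    ((α * gaussianFilter σ t : ℝ) : ℂ) • (A ⊗ₖ bathCoupling + Aᴴ ⊗ₖ bathCouplingᴴ)

/-- `U^α(T)`, the evolution generated by `H_α(t)` from time `-T` to time `T`. -/
def evolution {d : ℕ} (H A : Matrix (Fin d) (Fin d) ℂ) (σ T α ω : ℝ) :
    Matrix (Fin d × Fin 2) (Fin d × Fin 2) ℂ :=
  timeOrderedExp (totalHamiltonian H A σ α ω) (-T) T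

/-- One step for fixed coupling operator and frequency, `Tr_E [U (ρ ⊗ ρ_E) U†]`. -/
def singleStep {d : ℕ} (H A : Matrix (Fin d) (Fin d) ℂ) (σ T α ω : ℝ)
    (ρ : Matrix (Fin d) (Fin d) ℂ) : Matrix (Fin d) (Fin d) ℂ :=
  partialTrace
    (evolution H A σ T α ω * (ρ ⊗ₖ bathGroundState ω) * (evolution H A σ T α ω)ᴴ)

/-- Expectation of `F(A_S)` for `A_S` uniform on the finite set `𝒜`. -/
def couplingMean {d : ℕ} (𝒜 : Finset (Matrix (Fin d) (Fin d) ℂ))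
    (F : Matrix (Fin d) (Fin d) ℂ → ℝ) : ℝ :=
  (∑ A ∈ 𝒜, F A) / (𝒜.card : ℝ)

/-- The channel `Φ_α(ρ) = 𝔼_{A_S, ω} Tr_E [U^α(T) (ρ ⊗ ρ_E) U^α(T)†]` at zero temperature, where
`A_S` is uniform on `𝒜` and `ω` has the density `g`. -/
def channel {d : ℕ} (H : Matrix (Fin d) (Fin d) ℂ) (𝒜 : Finset (Matrix (Fin d) (Fin d) ℂ))
    (g : ℝ → ℝ) (σ T α : ℝ) (ρ : Matrix (Fin d) (Fin d) ℂ) : Matrix (Fin d) (Fin d) ℂ :=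
  Matrix.of fun i j =>
    (∑ A ∈ 𝒜, ∫ ω, (g ω : ℂ) * singleStep H A σ T α ω ρ i j) / (𝒜.card : ℂ)

/-- Admissible sets of coupling operators: nonempty, closed under `A ↦ -A` and `A ↦ A†`, and with
`‖A‖ ≤ 1`. -/
structure IsCouplingSet {d : ℕ} (𝒜 : Finset (Matrix (Fin d) (Fin d) ℂ)) : Prop where
  nonempty : 𝒜.Nonempty
  neg_mem : ∀ A ∈ 𝒜, -A ∈ 𝒜
  conjTranspose_mem : ∀ A ∈ 𝒜, Aᴴ ∈ 𝒜
  opNorm_le : ∀ A ∈ 𝒜, opNorm A ≤ 1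

/-- Probability densities on the real line. -/
structure IsProbabilityDensity (g : ℝ → ℝ) : Prop where
  nonneg : ∀ ω, 0 ≤ g ω
  integrable : MeasureTheory.Integrable g
  integral_eq_one : ∫ ω, g ω = 1

/-! Fixed points and mixing times -/

/-- `ρ` is the unique fixed point of `Φ` among the density matrices. -/
def IsUniqueFixedState {d : ℕ} (Φ : Matrix (Fin d) (Fin d) ℂ → Matrix (Fin d) (Fin d) ℂ)
    (ρ : Matrix (Fin d) (Fin d) ℂ) : Prop :=
  IsDensityMatrix ρ ∧ Φ ρ = ρ ∧ ∀ ρ', IsDensityMatrix ρ' → Φ ρ' = ρ' → ρ' = ρ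

/-- `τ` is the integer mixing time of `Φ` (with fixed point `ρfix`) to accuracy `ε`, i.e. the
least `t` with `‖Φ^t(ρ) - ρfix‖₁ ≤ ε` for all density matrices `ρ`. -/
def IsMixingTime {d : ℕ} (Φ : Matrix (Fin d) (Fin d) ℂ → Matrix (Fin d) (Fin d) ℂ)
    (ρfix : Matrix (Fin d) (Fin d) ℂ) (ε : ℝ) (τ : ℕ) : Prop :=
  IsLeast {t : ℕ | ∀ ρ, IsDensityMatrix ρ → traceNorm (Φ^[t] ρ - ρfix) ≤ ε} τ

/-! The limiting jump operators and Lamb shift -/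

/-- The Heisenberg evolution `A(t) = exp(iHt) A exp(-iHt)`. -/
def heisenberg {d : ℕ} (H A : Matrix (Fin d) (Fin d) ℂ) (t : ℝ) : Matrix (Fin d) (Fin d) ℂ :=
  NormedSpace.exp ((Complex.I * (t : ℂ)) • H) * A * NormedSpace.exp ((-Complex.I * (t : ℂ)) • H)

/-- `V_A(ω) = ∫ f(t) A(t) exp(-iωt) dt`, over the whole real line. -/
def jumpOperator {d : ℕ} (H A : Matrix (Fin d) (Fin d) ℂ) (σ ω : ℝ) :
    Matrix (Fin d) (Fin d) ℂ :=
  Matrix.of fun i j => ∫ t : ℝ,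
    (gaussianFilter σ t : ℂ) * Complex.exp (-Complex.I * ω * t) * heisenberg H A t i j

/-- `G_A(ω) = ∫ ds₁ ∫_{s₂ ≤ s₁} ds₂ f(s₂) f(s₁) A†(s₂) A(s₁) exp(iω(s₂ - s₁))`. -/
def lambShiftOperator {d : ℕ} (H A : Matrix (Fin d) (Fin d) ℂ) (σ ω : ℝ) :
    Matrix (Fin d) (Fin d) ℂ :=
  Matrix.of fun i j => ∫ s₁ : ℝ, ∫ s₂ in Set.Iic s₁,
    (gaussianFilter σ s₂ : ℂ) * (gaussianFilter σ s₁ : ℂ) *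
      Complex.exp (Complex.I * ω * (s₂ - s₁)) * (heisenberg H Aᴴ s₂ * heisenberg H A s₁) i j

/-- `γ(ω) = (g(ω) + g(-ω)) 1_{ω < 0}`, the zero temperature transition weight. -/
def transitionWeight (g : ℝ → ℝ) (ω : ℝ) : ℝ :=
  if ω < 0 then g ω + g (-ω) else 0

/-- `𝔼_{A_S} ∫ γ(ω) (‖[ρ, G(ω)]‖₁ + ‖[ρ, G(ω)†]‖₁ + ‖D_{V(ω)}(ρ)‖₁) dω`. -/
def generatorDefect {d : ℕ} (H : Matrix (Fin d) (Fin d) ℂ)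
    (𝒜 : Finset (Matrix (Fin d) (Fin d) ℂ)) (g : ℝ → ℝ) (σ : ℝ)
    (ρ : Matrix (Fin d) (Fin d) ℂ) : ℝ :=
  couplingMean 𝒜 fun A => ∫ ω, transitionWeight g ω *
    (traceNorm (commutator ρ (lambShiftOperator H A σ ω)) +
      traceNorm (commutator ρ (lambShiftOperator H A σ ω)ᴴ) +
      traceNorm (dissipator (jumpOperator H A σ ω) ρ))

end

end SystemBath

open SystemBath

/-! The ground state is almost fixed by one application of the channel, and the channel is a
trace-norm contraction, so the ground state stays almost fixed for `τ` steps. By the mixing time it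
is then within `ε` of the true fixed point (`traceNorm_sub_le_of_isMixingTime`). Part (1) therefore
reduces to a bound on `‖Φ(ψ) - ψ‖₁` (`traceNorm_channel_ketbra_sub_le`).

One step is analysed in the interaction picture. The coupling flips the ancilla, so the two ancilla
blocks satisfy `a' = -i L† b`, `b' = -i L a`: `a` has only even and `b` only odd orders in the
coupling, odd orders are absent from the reduced dynamics, and truncating after second order costs
only fourth order (`traceNorm_kraus_sub_second_order_le`). The second-order term involves a
time-ordered integral `W` with `W + W† = V† V`. Its Hermitian part thus completes the dissipator,
and its anti-Hermitian part is the Lamb-shift commutator. Replacing the window `[-T, T]` by the line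
costs Gaussian tails. Free evolution fixes the ground state, so leaving the interaction picture is
free. At zero temperature the ancilla can only absorb energy, so both signs of `ω` give a filtered
jump operator at frequency `-|ω|`. Negative `ω` involves `A†`, and closure of the coupling set under
adjoints symmetrises this into the weight `γ`.

The generator defect is Gaussian in `σΔ` (`pointwiseDefect_ketbra_le`) because every matrix element
leading out of the ground state is a Fourier transform of a Gaussian at a Bohr frequency at least
`Δ`. For the Lamb shift one integrates over the common time at fixed lag, which makes the estimate
uniform in `ν`. In the dissipator, `V` cannot excite the ground state when `ν ≤ 0`. The adjoint `V†`
may do so resonantly, but it occurs only next to the diagonal element of `V`, which is small exactly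
when `|ν|` is large. All relevant operators have rank one, so no dimension factor enters.

For part (2) an additive `ε` is too much. Since `Φ^τ` sends every state into the `ε`-ball around the
fixed point, it contracts traceless Hermitian matrices by `ε`; this gives `(1 - ε) ‖ρfix - ψ‖₁ ≤ τ
‖Φ(ψ) - ψ‖₁` (`one_sub_mul_traceNorm_sub_le_of_isMixingTime`). It remains to make the right-hand
side smaller than `(1 - ε₀) ε`, which is an elementary computation (`error_lt_of_parameters`). -/

namespace SystemBath

/-! ### Trace norm and its duality with the operator norm -/

section TraceNorm

open scoped Matrix.Norms.L2Operator
open Matrix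

variable {m : Type} [Fintype m] [DecidableEq m]

theorem opNorm_eq_norm (A : Matrix m m ℂ) : opNorm A = ‖A‖ := rfl

theorem norm_inner_mulVec_le (X : Matrix m m ℂ) (u v : EuclideanSpace ℂ m) :
    ‖star u.ofLp ⬝ᵥ (X *ᵥ v.ofLp)‖ ≤ ‖X‖ * (‖u‖ * ‖v‖) := by
  have h : star u.ofLp ⬝ᵥ (X *ᵥ v.ofLp) = inner ℂ u (WithLp.toLp 2 (X *ᵥ v.ofLp)) := by
    rw [EuclideanSpace.inner_eq_star_dotProduct, dotProduct_comm]
  rw [h]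
  calc _ ≤ ‖u‖ * ‖WithLp.toLp 2 (X *ᵥ v.ofLp)‖ := norm_inner_le_norm _ _
    _ ≤ ‖u‖ * (‖X‖ * ‖v‖) := by gcongr; exact l2_opNorm_mulVec X v
    _ = _ := by ring

theorem norm_le_of_inner_le (X : Matrix m m ℂ) {c : ℝ} (hc : 0 ≤ c)
    (h : ∀ u v : EuclideanSpace ℂ m, ‖star u.ofLp ⬝ᵥ (X *ᵥ v.ofLp)‖ ≤ c * (‖u‖ * ‖v‖)) :
    ‖X‖ ≤ c := by
  rw [cstar_norm_def]
  refine ContinuousLinearMap.opNorm_le_bound _ hc fun v => ?_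
  set w := (toEuclideanCLM (n := m) (𝕜 := ℂ) X) v with hw
  have h1 := h w v
  have h2 : star w.ofLp ⬝ᵥ (X *ᵥ v.ofLp) = inner ℂ w w := by
    rw [EuclideanSpace.inner_eq_star_dotProduct, dotProduct_comm, hw, ofLp_toEuclideanCLM]
  rw [h2, inner_self_eq_norm_sq_to_K] at h1
  simp only [Complex.coe_algebraMap, norm_pow, Complex.norm_real, norm_norm] at h1
  rcases (norm_nonneg w).eq_or_lt with h0 | h0
  · rw [← h0]; positivity
  · have : ‖w‖ * ‖w‖ ≤ ‖w‖ * (c * ‖v‖) := by nlinarith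
    exact le_of_mul_le_mul_left this h0

theorem norm_one_le : ‖(1 : Matrix m m ℂ)‖ ≤ 1 := by
  rw [← diagonal_one, l2_opNorm_diagonal, pi_norm_le_iff_of_nonneg zero_le_one]
  simp

theorem norm_le_one_of_conjTranspose_mul_self {A : Matrix m m ℂ} (h : Aᴴ * A = 1) : ‖A‖ ≤ 1 := by
  have h1 := l2_opNorm_conjTranspose_mul_self A
  rw [h] at h1
  nlinarith [norm_nonneg A, norm_one_le (m := m)]

theorem norm_unitaryConj_le (U : unitaryGroup m ℂ) (D : Matrix m m ℂ) :
    ‖(U : Matrix m m ℂ) * D * (U : Matrix m m ℂ)ᴴ‖ ≤ ‖D‖ := by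
  have hU : ‖(U : Matrix m m ℂ)‖ ≤ 1 := 
    norm_le_one_of_conjTranspose_mul_self (Unitary.coe_star_mul_self U)
  calc _ ≤ ‖(U : Matrix m m ℂ)‖ * ‖D‖ * ‖(U : Matrix m m ℂ)ᴴ‖ :=
        (norm_mul_le _ _).trans (by gcongr; exact norm_mul_le _ _)
    _ ≤ 1 * ‖D‖ * 1 := by rw [l2_opNorm_conjTranspose]; gcongr
    _ = _ := by ring

theorem isHermitian_eq_conj_diagonal {A : Matrix m m ℂ} (hA : A.IsHermitian) :
    A = (hA.eigenvectorUnitary : Matrix m m ℂ) *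
      diagonal (fun i => (hA.eigenvalues i : ℂ)) * (hA.eigenvectorUnitary : Matrix m m ℂ)ᴴ := by
  conv_lhs => rw [hA.spectral_theorem]
  rw [Unitary.conjStarAlgAut_apply]
  rfl

theorem eigenvalues_conjTranspose_mul_self_nonneg (A : Matrix m m ℂ) (i : m) :
    0 ≤ (isHermitian_conjTranspose_mul_self A).eigenvalues i :=
  (posSemidef_conjTranspose_mul_self A).eigenvalues_nonneg i

theorem traceNorm_nonneg (A : Matrix m m ℂ) : 0 ≤ traceNorm A :=
  Finset.sum_nonneg fun _ _ => Real.sqrt_nonneg _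

theorem trace_eq_sum_inner (b : OrthonormalBasis m ℂ (EuclideanSpace ℂ m)) (X : Matrix m m ℂ) :
    X.trace = ∑ i, star (b i).ofLp ⬝ᵥ (X *ᵥ (b i).ofLp) := by
  have h := LinearMap.trace_eq_sum_inner (toEuclideanLin X) b
  have h2 : LinearMap.trace ℂ (EuclideanSpace ℂ m) (toEuclideanLin X) = X.trace := by
    rw [LinearMap.trace_eq_matrix_trace ℂ (EuclideanSpace.basisFun m ℂ).toBasis]
    congr 1
    ext i j
    simp [LinearMap.toMatrix_apply, toLpLin_apply]
  rw [← h2, h]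
  refine Finset.sum_congr rfl fun i _ => ?_
  rw [EuclideanSpace.inner_eq_star_dotProduct, dotProduct_comm]
  rfl

/-- The trace is evaluated in an eigenbasis of `Aᴴ * A`, whose vectors `A` stretches by exactly the
singular values. -/
theorem norm_trace_mul_le (X A : Matrix m m ℂ) : ‖(X * A).trace‖ ≤ ‖X‖ * traceNorm A := by
  set hA := isHermitian_conjTranspose_mul_self A
  rw [trace_eq_sum_inner hA.eigenvectorBasis, traceNorm, Finset.mul_sum]
  refine (norm_sum_le _ _).trans (Finset.sum_le_sum fun i _ => ?_)
  set v := hA.eigenvectorBasis i with hv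
  have h1 := norm_inner_mulVec_le X v (WithLp.toLp 2 (A *ᵥ v.ofLp))
  have hvn : ‖v‖ = 1 := hA.eigenvectorBasis.orthonormal.1 i
  have h2 : ‖WithLp.toLp 2 (A *ᵥ v.ofLp)‖ ^ 2 = hA.eigenvalues i := by
    have h3 : (inner ℂ (WithLp.toLp 2 (A *ᵥ v.ofLp)) (WithLp.toLp 2 (A *ᵥ v.ofLp)) : ℂ)
        = hA.eigenvalues i := by
      rw [EuclideanSpace.inner_eq_star_dotProduct, dotProduct_comm, star_mulVec,
        ← dotProduct_mulVec, mulVec_mulVec, hv, hA.mulVec_eigenvectorBasis]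
      have h4 : (inner ℂ v v : ℂ) = 1 := by
        rw [inner_self_eq_norm_sq_to_K, hvn]; simp
      rw [EuclideanSpace.inner_eq_star_dotProduct, dotProduct_comm] at h4
      rw [dotProduct_smul, h4, Complex.real_smul, mul_one]
    rw [inner_self_eq_norm_sq_to_K] at h3
    apply Complex.ofReal_injective
    rw [← h3]
    simp
  rw [← mulVec_mulVec]
  calc _ ≤ ‖X‖ * (‖v‖ * ‖WithLp.toLp 2 (A *ᵥ v.ofLp)‖) := h1
    _ = _ := by rw [hvn, one_mul, ← h2, Real.sqrt_sq (norm_nonneg _)]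

theorem exists_trace_mul_eq_traceNorm (A : Matrix m m ℂ) :
    ∃ X : Matrix m m ℂ, ‖X‖ ≤ 1 ∧ (X * A).trace = traceNorm A := by
  set hA := isHermitian_conjTranspose_mul_self A
  set U : Matrix m m ℂ := (hA.eigenvectorUnitary : Matrix m m ℂ) with hU
  set s : m → ℝ := fun i => Real.sqrt (hA.eigenvalues i) with hs
  -- Since `0⁻¹ = 0`, this is the pseudo-inverse of `|A|` in its eigenbasis. The witness `|A|⁺ Aᴴ`
  -- is the adjoint of the partial isometry in the polar decomposition.
  set D : Matrix m m ℂ := diagonal fun i => ((s i)⁻¹ : ℂ) with hD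
  have hUU : Uᴴ * U = 1 := Unitary.coe_star_mul_self hA.eigenvectorUnitary
  have hss : ∀ i, s i * s i = hA.eigenvalues i := fun i =>
    Real.mul_self_sqrt (eigenvalues_conjTranspose_mul_self_nonneg A i)
  have hAA : Aᴴ * A = U * diagonal (fun i => ((s i : ℂ) * s i)) * Uᴴ := by
    rw [isHermitian_eq_conj_diagonal hA]
    congr 3
    ext i
    exact_mod_cast (hss i).symm
  have hDs : Dᴴ = D := by
    rw [hD, diagonal_conjTranspose]; congr 1; ext i; simp
  refine ⟨U * D * Uᴴ * Aᴴ, ?_, ?_⟩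
  · have h1 : ‖(U * D * Uᴴ * Aᴴ) * (U * D * Uᴴ * Aᴴ)ᴴ‖ ≤ 1 := by
      have h2 : (U * D * Uᴴ * Aᴴ) * (U * D * Uᴴ * Aᴴ)ᴴ
          = U * (diagonal fun i => ((s i)⁻¹ : ℂ) * ((s i : ℂ) * s i) * ((s i)⁻¹ : ℂ)) * Uᴴ := by
        calc _ = U * D * Uᴴ * (Aᴴ * A) * (U * D * Uᴴ) := by
              simp only [conjTranspose_mul, conjTranspose_conjTranspose, hDs, Matrix.mul_assoc]
          _ = U * (D * (Uᴴ * U) * diagonal (fun i => ((s i : ℂ) * s i)) * (Uᴴ * U) * D) * Uᴴ := by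
              rw [hAA]; simp only [Matrix.mul_assoc]
          _ = _ := by
              rw [hUU, Matrix.mul_one, Matrix.mul_one, hD, diagonal_mul_diagonal,
                diagonal_mul_diagonal]
      rw [h2]
      refine (norm_unitaryConj_le hA.eigenvectorUnitary _).trans ?_
      rw [l2_opNorm_diagonal, pi_norm_le_iff_of_nonneg zero_le_one]
      intro i
      by_cases h : (s i : ℂ) = 0
      · simp [h]
      · field_simp; simp
    have h3 := CStarRing.norm_star_mul_self (x := (U * D * Uᴴ * Aᴴ)ᴴ)
    rw [star_eq_conjTranspose, conjTranspose_conjTranspose, l2_opNorm_conjTranspose] at h3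
    rw [h3] at h1
    nlinarith [norm_nonneg (U * D * Uᴴ * Aᴴ)]
  · rw [Matrix.mul_assoc, hAA]
    calc _ = (U * (D * (Uᴴ * U) * diagonal (fun i => ((s i : ℂ) * s i))) * Uᴴ).trace := by
          simp only [Matrix.mul_assoc]
      _ = _ := by
          rw [hUU, Matrix.mul_one, trace_mul_comm, ← Matrix.mul_assoc, hUU, Matrix.one_mul, hD,
            diagonal_mul_diagonal, trace_diagonal, traceNorm]
          push_cast
          refine Finset.sum_congr rfl fun i _ => ?_
          by_cases h : (s i : ℂ) = 0
          · simp only [hs] at h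
            simp [h, hs]
          · field_simp
            rfl

/-- Duality reduces trace-norm estimates to scalar ones. The triangle inequality, the ideal
property, Kraus contractivity and the bound on integrals are all obtained by testing against
contractions `X`. -/
theorem traceNorm_le_of_forall {A : Matrix m m ℂ} {c : ℝ}
    (h : ∀ X : Matrix m m ℂ, ‖X‖ ≤ 1 → ‖(X * A).trace‖ ≤ c) : traceNorm A ≤ c := by
  obtain ⟨X, hX, hXA⟩ := exists_trace_mul_eq_traceNorm A
  have := h X hX
  rw [hXA, Complex.norm_real] at this
  exact (le_abs_self _).trans this

theorem norm_trace_mul_le_of_le_one {X : Matrix m m ℂ} (hX : ‖X‖ ≤ 1) (A : Matrix m m ℂ) :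
    ‖(X * A).trace‖ ≤ traceNorm A :=
  (norm_trace_mul_le X A).trans (mul_le_of_le_one_left (traceNorm_nonneg A) hX)

theorem traceNorm_add_le (A B : Matrix m m ℂ) :
    traceNorm (A + B) ≤ traceNorm A + traceNorm B := by
  refine traceNorm_le_of_forall fun X hX => ?_
  rw [Matrix.mul_add, trace_add]
  exact (norm_add_le _ _).trans
    (add_le_add (norm_trace_mul_le_of_le_one hX A) (norm_trace_mul_le_of_le_one hX B))

theorem traceNorm_smul_le (c : ℂ) (A : Matrix m m ℂ) :
    traceNorm (c • A) ≤ ‖c‖ * traceNorm A := by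
  refine traceNorm_le_of_forall fun X hX => ?_
  rw [Matrix.mul_smul, trace_smul, norm_smul]
  gcongr
  exact norm_trace_mul_le_of_le_one hX A

theorem traceNorm_neg (A : Matrix m m ℂ) : traceNorm (-A) = traceNorm A := by
  simp [traceNorm]

theorem traceNorm_zero : traceNorm (0 : Matrix m m ℂ) = 0 :=
  le_antisymm (traceNorm_le_of_forall fun X _ => by simp) (traceNorm_nonneg _)

theorem traceNorm_sub_le (A B : Matrix m m ℂ) :
    traceNorm (A - B) ≤ traceNorm A + traceNorm B := by
  rw [sub_eq_add_neg, ← traceNorm_neg B]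
  exact traceNorm_add_le A (-B)

theorem traceNorm_sub_comm (A B : Matrix m m ℂ) : traceNorm (A - B) = traceNorm (B - A) := by
  rw [← traceNorm_neg, neg_sub]

theorem traceNorm_conjTranspose_le (A : Matrix m m ℂ) : traceNorm Aᴴ ≤ traceNorm A := by
  refine traceNorm_le_of_forall fun X hX => ?_
  have : (X * Aᴴ).trace = star ((Xᴴ * A).trace) := by
    rw [← trace_conjTranspose, conjTranspose_mul, conjTranspose_conjTranspose, trace_mul_comm]
  rw [this, norm_star]
  exact norm_trace_mul_le_of_le_one (by rwa [l2_opNorm_conjTranspose]) A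

theorem traceNorm_conjTranspose (A : Matrix m m ℂ) : traceNorm Aᴴ = traceNorm A :=
  le_antisymm (traceNorm_conjTranspose_le A) (by
    simpa using traceNorm_conjTranspose_le Aᴴ)

theorem traceNorm_mul_mul_le (X A Y : Matrix m m ℂ) :
    traceNorm (X * A * Y) ≤ ‖X‖ * ‖Y‖ * traceNorm A := by
  refine traceNorm_le_of_forall fun Z hZ => ?_
  have : (Z * (X * A * Y)).trace = ((Y * Z * X) * A).trace := by
    rw [← Matrix.mul_assoc, trace_mul_comm]; simp only [Matrix.mul_assoc]
  rw [this]
  refine (norm_trace_mul_le _ _).trans ?_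
  gcongr
  · exact traceNorm_nonneg A
  calc _ ≤ ‖Y‖ * ‖Z‖ * ‖X‖ := (norm_mul_le _ _).trans (by gcongr; exact norm_mul_le _ _)
    _ ≤ ‖Y‖ * 1 * ‖X‖ := by gcongr
    _ = _ := by ring

theorem traceNorm_mul_left_le (X A : Matrix m m ℂ) : traceNorm (X * A) ≤ ‖X‖ * traceNorm A := by
  refine traceNorm_le_of_forall fun Z hZ => ?_
  rw [← Matrix.mul_assoc]
  refine (norm_trace_mul_le _ _).trans ?_
  gcongr
  · exact traceNorm_nonneg A
  calc _ ≤ ‖Z‖ * ‖X‖ := norm_mul_le _ _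
    _ ≤ 1 * ‖X‖ := by gcongr
    _ = _ := by ring

theorem traceNorm_mul_right_le (A Y : Matrix m m ℂ) : traceNorm (A * Y) ≤ ‖Y‖ * traceNorm A := by
  rw [← traceNorm_conjTranspose, conjTranspose_mul, ← traceNorm_conjTranspose A,
    ← l2_opNorm_conjTranspose Y]
  exact traceNorm_mul_left_le _ _

theorem norm_apply_le (X : Matrix m m ℂ) (i j : m) : ‖X i j‖ ≤ ‖X‖ := by
  have h := norm_inner_mulVec_le X (EuclideanSpace.single i 1) (EuclideanSpace.single j 1)
  have h2 : star (EuclideanSpace.single i (1 : ℂ)).ofLp ⬝ᵥ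
      (X *ᵥ (EuclideanSpace.single j (1 : ℂ)).ofLp) = X i j := by
    simp [dotProduct, Pi.single_apply]
  rw [h2] at h
  simpa using h

/-- The dimension factor is harmless: the estimate serves only to show that the trace norm is
continuous. -/
theorem traceNorm_le_card_mul (A : Matrix m m ℂ) : traceNorm A ≤ Fintype.card m * ‖A‖ := by
  refine traceNorm_le_of_forall fun X hX => ?_
  calc ‖(X * A).trace‖ ≤ ∑ _i : m, ‖A‖ := by
        refine (norm_sum_le _ _).trans (Finset.sum_le_sum fun i _ => ?_)
        refine (norm_apply_le _ _ _).trans ((norm_mul_le _ _).trans ?_)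
        exact mul_le_of_le_one_left (norm_nonneg _) hX
    _ = _ := by simp

theorem continuous_traceNorm : Continuous (traceNorm : Matrix m m ℂ → ℝ) := by
  refine (LipschitzWith.of_dist_le_mul (K := Fintype.card m) fun A B => ?_).continuous
  rw [Real.dist_eq, dist_eq_norm, NNReal.coe_natCast]
  have h1 := traceNorm_add_le (A - B) B
  have h2 := traceNorm_add_le (B - A) A
  rw [sub_add_cancel] at h1 h2
  rw [traceNorm_sub_comm] at h2
  exact (abs_sub_le_iff.2 ⟨by linarith, by linarith⟩).trans (traceNorm_le_card_mul (A - B))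

end TraceNorm

/-! ### Kraus maps, pure states and contraction of traceless matrices -/

section States

set_option linter.unusedSectionVars false

open scoped Matrix.Norms.L2Operator
open Matrix

variable {m : Type} [Fintype m] [DecidableEq m]

theorem norm_sq_toLp_mulVec (K : Matrix m m ℂ) (u : EuclideanSpace ℂ m) :
    ((‖WithLp.toLp 2 (K *ᵥ u.ofLp)‖ ^ 2 : ℝ) : ℂ) = star u.ofLp ⬝ᵥ ((Kᴴ * K) *ᵥ u.ofLp) := by
  have h := inner_self_eq_norm_sq_to_K (𝕜 := ℂ) (WithLp.toLp 2 (K *ᵥ u.ofLp))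
  rw [EuclideanSpace.inner_eq_star_dotProduct, dotProduct_comm, star_mulVec,
    ← dotProduct_mulVec, mulVec_mulVec] at h
  rw [h]; simp

theorem norm_sq_add_norm_sq_of_kraus {K₀ K₁ : Matrix m m ℂ} (hK : K₀ᴴ * K₀ + K₁ᴴ * K₁ = 1)
    (w : EuclideanSpace ℂ m) : ‖WithLp.toLp 2 (K₀ *ᵥ w.ofLp)‖ ^ 2 +
      ‖WithLp.toLp 2 (K₁ *ᵥ w.ofLp)‖ ^ 2 = ‖w‖ ^ 2 := by
  have h1 := norm_sq_toLp_mulVec 1 w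
  rw [one_mulVec, conjTranspose_one, Matrix.one_mul, ← hK, add_mulVec, dotProduct_add,
    ← norm_sq_toLp_mulVec, ← norm_sq_toLp_mulVec] at h1
  exact_mod_cast h1.symm

theorem norm_le_one_of_kraus {K₀ K₁ : Matrix m m ℂ} (hK : K₀ᴴ * K₀ + K₁ᴴ * K₁ = 1) :
    ‖K₀‖ ≤ 1 := by
  rw [cstar_norm_def]
  refine ContinuousLinearMap.opNorm_le_bound _ zero_le_one fun v => ?_
  have h : ‖WithLp.toLp 2 (K₀ *ᵥ v.ofLp)‖ ≤ ‖v‖ := by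
    refine (sq_le_sq₀ (norm_nonneg _) (norm_nonneg _)).1 ?_
    rw [← norm_sq_add_norm_sq_of_kraus hK v]
    exact le_add_of_nonneg_right (sq_nonneg _)
  rw [one_mul]
  exact h

/-- This is the dual (Heisenberg) form of trace-norm contractivity: `u ↦ (K₀ u, K₁ u)` is an
isometry, and Cauchy–Schwarz over the two components gives the bound. -/
theorem norm_sum_conj_le {K₀ K₁ X : Matrix m m ℂ} (hK : K₀ᴴ * K₀ + K₁ᴴ * K₁ = 1) :
    ‖K₀ᴴ * X * K₀ + K₁ᴴ * X * K₁‖ ≤ ‖X‖ := by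
  refine norm_le_of_inner_le _ (norm_nonneg _) fun u v => ?_
  have hconj : ∀ K : Matrix m m ℂ, star u.ofLp ⬝ᵥ ((Kᴴ * X * K) *ᵥ v.ofLp)
      = star (K *ᵥ u.ofLp) ⬝ᵥ (X *ᵥ (K *ᵥ v.ofLp)) := fun K => by
    rw [star_mulVec, ← dotProduct_mulVec, mulVec_mulVec, mulVec_mulVec, Matrix.mul_assoc]
  rw [add_mulVec, dotProduct_add, hconj, hconj]
  have hb := fun K : Matrix m m ℂ =>
    norm_inner_mulVec_le X (WithLp.toLp 2 (K *ᵥ u.ofLp)) (WithLp.toLp 2 (K *ᵥ v.ofLp))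
  refine (norm_add_le _ _).trans ((add_le_add (hb K₀) (hb K₁)).trans ?_)
  rw [← mul_add]
  gcongr
  have h1 := norm_sq_add_norm_sq_of_kraus hK u
  have h2 := norm_sq_add_norm_sq_of_kraus hK v
  set a := ‖WithLp.toLp 2 (K₀ *ᵥ u.ofLp)‖
  set b := ‖WithLp.toLp 2 (K₁ *ᵥ u.ofLp)‖
  set c := ‖WithLp.toLp 2 (K₀ *ᵥ v.ofLp)‖
  set e := ‖WithLp.toLp 2 (K₁ *ᵥ v.ofLp)‖
  refine abs_le_of_sq_le_sq' ?_ (by positivity) |>.2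
  calc (a * c + b * e) ^ 2 ≤ (a ^ 2 + b ^ 2) * (c ^ 2 + e ^ 2) := by
        nlinarith [sq_nonneg (a * e - b * c)]
    _ = _ := by rw [h1, h2]; ring

/-- A channel with two Kraus operators is a contraction for the trace norm. -/
theorem traceNorm_kraus_le {K₀ K₁ : Matrix m m ℂ} (hK : K₀ᴴ * K₀ + K₁ᴴ * K₁ = 1)
    (ρ : Matrix m m ℂ) : traceNorm (K₀ * ρ * K₀ᴴ + K₁ * ρ * K₁ᴴ) ≤ traceNorm ρ := by
  refine traceNorm_le_of_forall fun X hX => ?_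
  have h : (X * (K₀ * ρ * K₀ᴴ + K₁ * ρ * K₁ᴴ)).trace
      = ((K₀ᴴ * X * K₀ + K₁ᴴ * X * K₁) * ρ).trace := by
    rw [Matrix.mul_add, Matrix.add_mul, trace_add, trace_add]
    congr 1 <;>
    · rw [← Matrix.mul_assoc, trace_mul_comm]; simp only [Matrix.mul_assoc]
  rw [h]
  exact norm_trace_mul_le_of_le_one ((norm_sum_conj_le hK).trans hX) ρ

section Ketbra

variable {ψ : m → ℂ}

theorem ketbra_mul_mul_ketbra (X : Matrix m m ℂ) :
    ketbra ψ * X * ketbra ψ = (star ψ ⬝ᵥ (X *ᵥ ψ)) • ketbra ψ := by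
  rw [ketbra, vecMulVec_mul, vecMulVec_mul_vecMulVec, dotProduct_mulVec, vecMulVec_smul]

theorem conjTranspose_ketbra : (ketbra ψ)ᴴ = ketbra ψ := by
  rw [ketbra, conjTranspose_vecMulVec, star_star]

theorem ketbra_mul_self (h : star ψ ⬝ᵥ ψ = 1) : ketbra ψ * ketbra ψ = ketbra ψ := by
  have := ketbra_mul_mul_ketbra (ψ := ψ) 1
  rwa [Matrix.mul_one, one_mulVec, h, one_smul] at this

theorem isDensityMatrix_ketbra (h : star ψ ⬝ᵥ ψ = 1) : IsDensityMatrix (ketbra ψ) :=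
  ⟨posSemidef_vecMulVec_self_star ψ, by rw [ketbra, trace_vecMulVec, dotProduct_comm, h]⟩

theorem norm_le_one_of_projection {P : Matrix m m ℂ} (h1 : Pᴴ = P) (h2 : P * P = P) :
    ‖P‖ ≤ 1 := by
  have h := l2_opNorm_conjTranspose_mul_self P
  rw [h1, h2] at h
  nlinarith [norm_nonneg P]

theorem norm_ketbra_le (h : star ψ ⬝ᵥ ψ = 1) : ‖ketbra ψ‖ ≤ 1 :=
  norm_le_one_of_projection conjTranspose_ketbra (ketbra_mul_self h)

theorem norm_one_sub_ketbra_le (h : star ψ ⬝ᵥ ψ = 1) : ‖1 - ketbra ψ‖ ≤ 1 := by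
  refine norm_le_one_of_projection (by simp [conjTranspose_ketbra]) ?_
  rw [Matrix.sub_mul, Matrix.mul_sub, Matrix.mul_sub, ketbra_mul_self h]; simp

theorem traceNorm_ketbra_le (h : star ψ ⬝ᵥ ψ = 1) : traceNorm (ketbra ψ) ≤ 1 := by
  refine traceNorm_le_of_forall fun X hX => ?_
  have h1 : (X * ketbra ψ).trace = star ψ ⬝ᵥ (X *ᵥ ψ) := by
    rw [ketbra, mul_vecMulVec, trace_vecMulVec, dotProduct_comm]
  have h2 : ‖WithLp.toLp 2 ψ‖ = 1 := by
    have := inner_self_eq_norm_sq_to_K (𝕜 := ℂ) (WithLp.toLp 2 ψ)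
    rw [EuclideanSpace.inner_eq_star_dotProduct, dotProduct_comm, h] at this
    have h3 : ‖WithLp.toLp 2 ψ‖ ^ 2 = 1 := by
      apply Complex.ofReal_injective
      simpa using this.symm
    nlinarith [norm_nonneg (WithLp.toLp 2 ψ)]
  have h3 := norm_inner_mulVec_le X (WithLp.toLp 2 ψ) (WithLp.toLp 2 ψ)
  rw [h2, one_mul, mul_one] at h3
  rw [h1]
  exact h3.trans hX

/-- A matrix of rank one has a single singular value. This is what keeps the final estimates free of
the dimension. -/
theorem traceNorm_mul_ketbra_le (h : star ψ ⬝ᵥ ψ = 1) (X : Matrix m m ℂ) :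
    traceNorm (X * ketbra ψ) ≤ ‖X * ketbra ψ‖ := by
  have h1 := traceNorm_mul_left_le (X * ketbra ψ) (ketbra ψ)
  rw [Matrix.mul_assoc, ketbra_mul_self h] at h1
  exact h1.trans (mul_le_of_le_one_right (norm_nonneg _) (traceNorm_ketbra_le h))

end Ketbra

/-- Jordan decomposition from the positive and negative parts of the eigenvalues. The trace bound
comes from testing `X` against its sign. -/
theorem exists_posSemidef_sub_eq {X : Matrix m m ℂ} (hX : X.IsHermitian) :
    ∃ P N : Matrix m m ℂ, P.PosSemidef ∧ N.PosSemidef ∧ X = P - N ∧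
      (P.trace + N.trace).re ≤ traceNorm X := by
  set U : Matrix m m ℂ := (hX.eigenvectorUnitary : Matrix m m ℂ) with hU
  have hUU : Uᴴ * U = 1 := Unitary.coe_star_mul_self hX.eigenvectorUnitary
  set l := hX.eigenvalues with hl
  have hXe := isHermitian_eq_conj_diagonal hX
  rw [← hU, ← hl] at hXe
  have hpsd : ∀ v : m → ℝ, (∀ i, 0 ≤ v i) →
      (U * diagonal (fun i => (v i : ℂ)) * Uᴴ).PosSemidef := fun v hv =>
    PosSemidef.mul_mul_conjTranspose_same
      (posSemidef_diagonal_iff.2 fun i => by exact_mod_cast hv i) U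
  have htr : ∀ D : Matrix m m ℂ, (U * D * Uᴴ).trace = D.trace := fun D => by
    rw [trace_mul_comm, ← Matrix.mul_assoc, hUU, Matrix.one_mul]
  refine ⟨_, _, hpsd (fun i => max (l i) 0) fun i => le_max_right _ _,
    hpsd (fun i => max (-l i) 0) fun i => le_max_right _ _, ?_, ?_⟩
  · rw [← Matrix.sub_mul, ← Matrix.mul_sub, diagonal_sub]
    conv_lhs => rw [hXe]
    congr 3
    ext i
    rw [← Complex.ofReal_sub]
    congr 1
    rcases le_total 0 (l i) with h | h
    · rw [max_eq_left h, max_eq_right (by linarith)]; ring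
    · rw [max_eq_right h, max_eq_left (by linarith)]; ring
  · set S : Matrix m m ℂ := diagonal fun i => ((SignType.sign (l i) : ℝ) : ℂ) with hS
    have h1 : ‖U * S * Uᴴ‖ ≤ 1 := by
      refine (norm_unitaryConj_le hX.eigenvectorUnitary _).trans ?_
      rw [l2_opNorm_diagonal, pi_norm_le_iff_of_nonneg zero_le_one]
      intro i
      rcases lt_trichotomy (l i) 0 with h | h | h <;> simp [h]
    have h2 : ((U * S * Uᴴ) * X).trace = (∑ i, |l i| : ℝ) := by
      conv_lhs => rw [hXe]
      calc _ = (U * (S * (Uᴴ * U) * diagonal (fun i => (l i : ℂ))) * Uᴴ).trace := by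
            simp only [Matrix.mul_assoc]
        _ = _ := by
            rw [htr, hUU, Matrix.mul_one, hS, diagonal_mul_diagonal, trace_diagonal]
            push_cast
            refine Finset.sum_congr rfl fun i _ => ?_
            rw [← Complex.ofReal_mul, sign_mul_self]
    have h3 := norm_trace_mul_le_of_le_one h1 X
    rw [h2, Complex.norm_real] at h3
    refine le_trans (le_of_eq ?_) ((le_abs_self _).trans h3)
    rw [htr, htr, trace_diagonal, trace_diagonal, ← Finset.sum_add_distrib, Complex.re_sum]
    refine Finset.sum_congr rfl fun i _ => ?_
    rw [← Complex.ofReal_add, Complex.ofReal_re]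
    rcases le_total 0 (l i) with h | h
    · rw [max_eq_left h, max_eq_right (by linarith), abs_of_nonneg h]; ring
    · rw [max_eq_right h, max_eq_left (by linarith), abs_of_nonpos h]; ring

/-- A linear map sending all states into the `ε`-ball around a fixed matrix contracts traceless
Hermitian matrices by the factor `ε`. -/
theorem traceNorm_map_le_of_isHermitian_of_trace_eq_zero
    (F : Matrix m m ℂ →ₗ[ℂ] Matrix m m ℂ) (σ : Matrix m m ℂ) {ε : ℝ}
    (hF : ∀ ρ, IsDensityMatrix ρ → traceNorm (F ρ - σ) ≤ ε) {X : Matrix m m ℂ}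
    (hX : X.IsHermitian) (htr : X.trace = 0) (hε : 0 ≤ ε) :
    traceNorm (F X) ≤ ε * traceNorm X := by
  obtain ⟨P, N, hP, hN, rfl, hle⟩ := exists_posSemidef_sub_eq hX
  rw [trace_sub, sub_eq_zero] at htr
  rw [← htr] at hle
  have hp0 := hP.trace_nonneg
  obtain ⟨p, hp⟩ : ∃ p : ℝ, P.trace = p := ⟨P.trace.re, by
    rw [Complex.nonneg_iff] at hp0
    exact Complex.ext rfl hp0.2.symm⟩
  rw [hp] at hp0 htr hle
  have hp0' : 0 ≤ p := by exact_mod_cast hp0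
  rw [← Complex.ofReal_add, Complex.ofReal_re] at hle
  rcases hp0'.eq_or_lt with h0 | h0
  · rw [← h0, Complex.ofReal_zero] at hp htr
    rw [hP.trace_eq_zero_iff.1 hp, hN.trace_eq_zero_iff.1 htr.symm, sub_zero, map_zero,
      traceNorm_zero, mul_zero]
  · have hpc : (p : ℂ) ≠ 0 := by exact_mod_cast h0.ne'
    have hd : ∀ Q : Matrix m m ℂ, Q.PosSemidef → Q.trace = p →
        IsDensityMatrix ((p : ℂ)⁻¹ • Q) := fun Q hQ hQp =>
      ⟨hQ.smul (by rw [← Complex.ofReal_inv]; exact_mod_cast (inv_nonneg.2 hp0')),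
        by rw [trace_smul, hQp, smul_eq_mul, inv_mul_cancel₀ hpc]⟩
    have h1 := hF _ (hd P hP hp)
    have h2 := hF _ (hd N hN htr.symm)
    -- Both parts have the same trace `p`, so after rescaling to states the centre `σ` cancels. The
    -- resulting `2 p ε` is at most `ε` times the trace norm.
    have h3 : F (P - N) = (p : ℂ) • ((F ((p : ℂ)⁻¹ • P) - σ) - (F ((p : ℂ)⁻¹ • N) - σ)) := by
      rw [sub_sub_sub_cancel_right, map_smul, map_smul, ← smul_sub, smul_smul,
        mul_inv_cancel₀ hpc, one_smul, map_sub]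
    rw [h3]
    refine (traceNorm_smul_le _ _).trans ?_
    rw [Complex.norm_real, Real.norm_of_nonneg hp0']
    calc _ ≤ p * (ε + ε) := by
          gcongr; exact (traceNorm_sub_le _ _).trans (add_le_add h1 h2)
      _ = ε * (p + p) := by ring
      _ ≤ _ := by gcongr

end States

/-! ### Dyson series: convergence, evolution equation, unitarity -/

section Dyson

set_option linter.unusedSectionVars false

open scoped Matrix.Norms.L2Operator
open Matrix Filter Topology MeasureTheory

variable {m : Type} [Fintype m] [DecidableEq m]

/-- The entry `(i, j)` as a continuous linear functional. -/
noncomputable def entryCLM (i j : m) : Matrix m m ℂ →L[ℝ] ℂ :=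
  LinearMap.toContinuousLinearMap (Matrix.entryLinearMap ℝ ℂ i j)

theorem integral_apply_apply {X : Type*} [MeasurableSpace X] {μ : Measure X}
    {F : X → Matrix m m ℂ} (hF : Integrable F μ) (i j : m) :
    (∫ x, F x ∂μ) i j = ∫ x, F x i j ∂μ :=
  ((entryCLM i j).integral_comp_comm hF).symm

theorem intervalIntegral_apply_apply {F : ℝ → Matrix m m ℂ} {a b : ℝ}
    (hF : IntervalIntegrable F volume a b) (i j : m) :
    (∫ x in a..b, F x) i j = ∫ x in a..b, F x i j :=
  ((entryCLM i j).intervalIntegral_comp_comm hF).symm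

theorem dysonTerm_succ_of_continuous {K : ℝ → Matrix m m ℂ} {t₀ : ℝ} {k : ℕ}
    (h : Continuous fun s => K s * dysonTerm K t₀ k s) (t : ℝ) :
    dysonTerm K t₀ (k + 1) t = -Complex.I • ∫ s in t₀..t, K s * dysonTerm K t₀ k s := by
  ext i j
  rw [Matrix.smul_apply, intervalIntegral_apply_apply (h.intervalIntegrable _ _)]
  rfl

/-- The parameter will be the bath frequency; joint continuity is what later makes the channel
integrand measurable. -/
theorem continuous_dysonTerm {X : Type*} [TopologicalSpace X] [FirstCountableTopology X]
    {K : X → ℝ → Matrix m m ℂ} (hK : Continuous (Function.uncurry K)) (t₀ : ℝ) (k : ℕ) :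
    Continuous fun p : X × ℝ => dysonTerm (K p.1) t₀ k p.2 := by
  induction k with
  | zero => exact continuous_const
  | succ k ih =>
    have h : Continuous fun p : X × ℝ => K p.1 p.2 * dysonTerm (K p.1) t₀ k p.2 :=
      Continuous.mul hK ih
    have h1 : ∀ x, Continuous fun s => K x s * dysonTerm (K x) t₀ k s := fun x =>
      h.comp (Continuous.prodMk_right x)
    rw [show (fun p : X × ℝ => dysonTerm (K p.1) t₀ (k + 1) p.2) = fun p : X × ℝ =>
      -Complex.I • ∫ s in t₀..p.2, K p.1 s * dysonTerm (K p.1) t₀ k s from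
      funext fun p => dysonTerm_succ_of_continuous (h1 p.1) p.2]
    suffices hI : Continuous fun p : X × ℝ =>
        ∫ s in t₀..p.2, K p.1 s * dysonTerm (K p.1) t₀ k s from hI.const_smul (-Complex.I)
    refine intervalIntegral.continuous_parametric_intervalIntegral_of_continuous ?_ continuous_snd
    exact h.comp (f := fun q : (X × ℝ) × ℝ => (q.1.1, q.2))
      ((continuous_fst.comp continuous_fst).prodMk continuous_snd)

theorem continuous_dysonTerm_right {K : ℝ → Matrix m m ℂ} (hK : Continuous K) (t₀ : ℝ) (k : ℕ) :
    Continuous (dysonTerm K t₀ k) :=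
  (continuous_dysonTerm (X := Unit) (K := fun _ => K) (hK.comp continuous_snd) t₀ k).comp
    (Continuous.prodMk_right ())

theorem dysonTerm_succ {K : ℝ → Matrix m m ℂ} (hK : Continuous K) (t₀ : ℝ) (k : ℕ) (t : ℝ) :
    dysonTerm K t₀ (k + 1) t = -Complex.I • ∫ s in t₀..t, K s * dysonTerm K t₀ k s :=
  dysonTerm_succ_of_continuous (Continuous.mul hK (continuous_dysonTerm_right hK t₀ k)) t

theorem norm_dysonTerm_le {K : ℝ → Matrix m m ℂ} (hK : Continuous K) {κ : ℝ}
    (hκ : ∀ s, ‖K s‖ ≤ κ) (t₀ : ℝ) (k : ℕ) (t : ℝ) :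
    ‖dysonTerm K t₀ k t‖ ≤ (κ * |t - t₀|) ^ k / k.factorial := by
  have hκ0 : 0 ≤ κ := (norm_nonneg _).trans (hκ 0)
  induction k generalizing t with
  | zero => simpa [dysonTerm] using norm_one_le (m := m)
  | succ k ih =>
    rw [dysonTerm_succ hK, norm_smul, norm_neg, Complex.norm_I, one_mul,
      intervalIntegral.norm_intervalIntegral_eq]
    have hint : IntegrableOn (fun s : ℝ => κ ^ (k + 1) / k.factorial * |s - t₀| ^ k)
        (Set.uIoc t₀ t) volume := by
      rw [← intervalIntegrable_iff]
      exact Continuous.intervalIntegrable (by fun_prop) _ _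
    refine (norm_integral_le_of_norm_le hint (Eventually.of_forall fun s => ?_)).trans_eq ?_
    · calc ‖K s * dysonTerm K t₀ k s‖ ≤ κ * ((κ * |s - t₀|) ^ k / k.factorial) :=
          (norm_mul_le _ _).trans (mul_le_mul (hκ s) (ih s) (norm_nonneg _) hκ0)
        _ = _ := by rw [mul_pow]; ring
    · rw [integral_const_mul, integral_pow_abs_sub_uIoc, Nat.factorial_succ]
      push_cast
      rw [mul_pow]
      field_simp

theorem summable_dysonBound (κ r : ℝ) : Summable fun k : ℕ => (κ * r) ^ k / k.factorial :=
  Real.summable_pow_div_factorial (κ * r)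

theorem hasSum_dysonTerm {K : ℝ → Matrix m m ℂ} (hK : Continuous K) {κ : ℝ}
    (hκ : ∀ s, ‖K s‖ ≤ κ) (t₀ t : ℝ) :
    HasSum (fun k => dysonTerm K t₀ k t) (timeOrderedExp K t₀ t) :=
  (Summable.of_norm_bounded (summable_dysonBound κ |t - t₀|)
    fun k => norm_dysonTerm_le hK hκ t₀ k t).hasSum

theorem continuous_timeOrderedExp {X : Type*} [TopologicalSpace X] [FirstCountableTopology X]
    {K : X → ℝ → Matrix m m ℂ} (hK : Continuous (Function.uncurry K)) {κ : X → ℝ}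
    (hκc : Continuous κ) (hκ : ∀ x s, ‖K x s‖ ≤ κ x) (t₀ : ℝ) :
    Continuous fun p : X × ℝ => timeOrderedExp (K p.1) t₀ p.2 := by
  have hKx : ∀ x, Continuous (K x) := fun x => hK.comp (Continuous.prodMk_right x)
  rw [continuous_iff_continuousAt]
  intro p₀
  -- A neighbourhood on which both the norm bound and the elapsed time exceed their values at the
  -- base point by less than 1, so that one exponential series dominates all terms.
  set S : Set (X × ℝ) := {p | κ p.1 < κ p₀.1 + 1 ∧ |p.2 - t₀| < |p₀.2 - t₀| + 1} with hS
  have hSo : IsOpen S :=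
    (isOpen_lt (hκc.comp continuous_fst) continuous_const).inter
      (isOpen_lt (f := fun p : X × ℝ => |p.2 - t₀|) (by fun_prop) continuous_const)
  have hp : p₀ ∈ S := ⟨by simp, by simp⟩
  refine ContinuousOn.continuousAt (s := S) ?_ (hSo.mem_nhds hp)
  refine continuousOn_tsum (fun k => (continuous_dysonTerm hK t₀ k).continuousOn)
    (summable_dysonBound (κ p₀.1 + 1) (|p₀.2 - t₀| + 1)) fun k p hpS => ?_
  refine (norm_dysonTerm_le (hKx p.1) (hκ p.1) t₀ k p.2).trans ?_
  have h0 : 0 ≤ κ p.1 := (norm_nonneg _).trans (hκ p.1 0)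
  have h1 := hpS.1.le
  have h2 := hpS.2.le
  have h3 : 0 ≤ κ p₀.1 + 1 := h0.trans h1
  gcongr

theorem continuous_timeOrderedExp_right {K : ℝ → Matrix m m ℂ} (hK : Continuous K) {κ : ℝ}
    (hκ : ∀ s, ‖K s‖ ≤ κ) (t₀ : ℝ) : Continuous (timeOrderedExp K t₀) :=
  (continuous_timeOrderedExp (X := Unit) (K := fun _ => K) (hK.comp continuous_snd)
    continuous_const (fun _ => hκ) t₀).comp (Continuous.prodMk_right ())

theorem timeOrderedExp_eq {K : ℝ → Matrix m m ℂ} (hK : Continuous K) {κ : ℝ}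
    (hκ : ∀ s, ‖K s‖ ≤ κ) (t₀ t : ℝ) :
    timeOrderedExp K t₀ t = 1 + -Complex.I • ∫ s in t₀..t, K s * timeOrderedExp K t₀ s := by
  have hκ0 : 0 ≤ κ := (norm_nonneg _).trans (hκ 0)
  have h1 : HasSum (fun k => ∫ s in t₀..t, K s * dysonTerm K t₀ k s)
      (∫ s in t₀..t, K s * timeOrderedExp K t₀ s) := by
    refine intervalIntegral.hasSum_integral_of_dominated_convergence
      (fun k _ => κ * ((κ * |t - t₀|) ^ k / k.factorial)) (fun k => ?_) (fun k => ?_)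
      (Eventually.of_forall fun s _ => (summable_dysonBound κ |t - t₀|).mul_left κ)
      intervalIntegrable_const ?_
    · exact (Continuous.mul hK (continuous_dysonTerm_right hK t₀ k)).aestronglyMeasurable
    · refine Eventually.of_forall fun s hs => (norm_mul_le _ _).trans
        (mul_le_mul (hκ s) ((norm_dysonTerm_le hK hκ t₀ k s).trans ?_) (norm_nonneg _) hκ0)
      have : |s - t₀| ≤ |t - t₀| := by
        rcases Set.mem_uIoc.1 hs with h | h
        · rw [abs_of_nonneg (by linarith), abs_of_nonneg (by linarith)]; linarith
        · rw [abs_of_nonpos (by linarith), abs_of_nonpos (by linarith)]; linarith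
      gcongr
    · exact Eventually.of_forall fun s _ => (hasSum_dysonTerm hK hκ t₀ s).mul_left (K s)
  have h2 : HasSum (fun k => dysonTerm K t₀ (k + 1) t)
      (-Complex.I • ∫ s in t₀..t, K s * timeOrderedExp K t₀ s) := by
    simp_rw [dysonTerm_succ hK t₀ _ t]
    exact h1.const_smul (-Complex.I)
  exact (hasSum_dysonTerm hK hκ t₀ t).unique
    (HasSum.zero_add (f := fun k => dysonTerm K t₀ k t) h2)

theorem hasDerivAt_timeOrderedExp {K : ℝ → Matrix m m ℂ} (hK : Continuous K) {κ : ℝ}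
    (hκ : ∀ s, ‖K s‖ ≤ κ) (t₀ t : ℝ) :
    HasDerivAt (timeOrderedExp K t₀) (-Complex.I • (K t * timeOrderedExp K t₀ t)) t := by
  have hc : Continuous fun s => K s * timeOrderedExp K t₀ s :=
    Continuous.mul hK (continuous_timeOrderedExp_right hK hκ t₀)
  have h := (hc.integral_hasStrictDerivAt t₀ t).hasDerivAt
  refine ((h.const_smul (-Complex.I)).const_add 1).congr_of_eventuallyEq
    (Eventually.of_forall fun t => ?_)
  exact timeOrderedExp_eq hK hκ t₀ t

theorem timeOrderedExp_self {K : ℝ → Matrix m m ℂ} (hK : Continuous K) {κ : ℝ}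
    (hκ : ∀ s, ‖K s‖ ≤ κ) (t₀ : ℝ) : timeOrderedExp K t₀ t₀ = 1 := by
  rw [timeOrderedExp_eq hK hκ]; simp

/-- For a Hermitian generator the derivative of `Uᴴ * U` vanishes identically. -/
theorem conjTranspose_timeOrderedExp_mul_self {K : ℝ → Matrix m m ℂ} (hK : Continuous K) {κ : ℝ}
    (hκ : ∀ s, ‖K s‖ ≤ κ) (hH : ∀ s, (K s).IsHermitian) (t₀ t : ℝ) :
    (timeOrderedExp K t₀ t)ᴴ * timeOrderedExp K t₀ t = 1 := by
  have hd : ∀ s, HasDerivAt (fun s => star (timeOrderedExp K t₀ s) * timeOrderedExp K t₀ s) 0 s :=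
    fun s => by
      have h := hasDerivAt_timeOrderedExp hK hκ t₀ s
      refine (h.star.mul h).congr_deriv ?_
      rw [star_smul, star_mul, star_eq_conjTranspose (K s), (hH s).eq]
      simp [Matrix.mul_assoc]
  have h := is_const_of_deriv_eq_zero (fun s => (hd s).differentiableAt) (fun s => (hd s).deriv) t t₀
  rw [← star_eq_conjTranspose]
  refine h.trans ?_
  simp [timeOrderedExp_self hK hκ]

end Dyson

/-! ### Second-order expansion of a two-block system -/

section Interaction

open scoped Matrix.Norms.L2Operator
open Matrix Filter Topology MeasureTheory

variable {m : Type} [Fintype m] [DecidableEq m]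

theorem norm_sub_init_le {f f' : ℝ → Matrix m m ℂ} {t₀ t₁ c : ℝ}
    (hf : ∀ t, HasDerivAt f (f' t) t) (hb : ∀ t ∈ Set.Icc t₀ t₁, ‖f' t‖ ≤ c) {t : ℝ}
    (ht : t ∈ Set.Icc t₀ t₁) : ‖f t - f t₀‖ ≤ c * (t₁ - t₀) := by
  have hc : 0 ≤ c := (norm_nonneg _).trans (hb t ht)
  have h := norm_image_sub_le_of_norm_deriv_le_segment' (f := f) (f' := f') (a := t₀) (b := t₁)
    (fun x _ => (hf x).hasDerivWithinAt) (fun x hx => hb x ⟨hx.1, hx.2.le⟩) t ht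
  exact h.trans (by gcongr; exact ht.2)

/-- Fourth-order remainder of the reduced dynamics of the two-block system `a' = -i L† b`,
`b' = -i L a`. -/
theorem traceNorm_kraus_sub_second_order_le {a b L : ℝ → Matrix m m ℂ} {t₀ t₁ l : ℝ}
    (h01 : t₀ ≤ t₁) (hL : Continuous L) (hl : ∀ t, ‖L t‖ ≤ l)
    (ha : ∀ t, HasDerivAt a (-Complex.I • ((L t)ᴴ * b t)) t)
    (hb : ∀ t, HasDerivAt b (-Complex.I • (L t * a t)) t)
    (ha0 : a t₀ = 1) (hb0 : b t₀ = 0) (ha1 : ∀ t, ‖a t‖ ≤ 1) (ρ : Matrix m m ℂ) :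
    traceNorm (a t₁ * ρ * (a t₁)ᴴ + b t₁ * ρ * (b t₁)ᴴ - ρ -
      ((∫ s in t₀..t₁, L s) * ρ * (∫ s in t₀..t₁, L s)ᴴ -
        (∫ s in t₀..t₁, (L s)ᴴ * ∫ r in t₀..s, L r) * ρ -
        ρ * (∫ s in t₀..t₁, (L s)ᴴ * ∫ r in t₀..s, L r)ᴴ)) ≤
      5 * (l * (t₁ - t₀)) ^ 4 * traceNorm ρ := by
  have hl0 : 0 ≤ l := (norm_nonneg _).trans (hl t₀)
  set x := l * (t₁ - t₀) with hx
  have hx0 : 0 ≤ x := mul_nonneg hl0 (by linarith)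
  have h1m : t₁ ∈ Set.Icc t₀ t₁ := ⟨h01, le_rfl⟩
  have hnL : ∀ (t : ℝ) {Y : Matrix m m ℂ} {c : ℝ}, ‖Y‖ ≤ c → ‖-Complex.I • (L t * Y)‖ ≤ l * c :=
    fun t Y c h => by
      rw [norm_smul, norm_neg, Complex.norm_I, one_mul]
      exact (norm_mul_le _ _).trans (mul_le_mul (hl t) h (norm_nonneg _) hl0)
  have hnL' : ∀ (t : ℝ) {Y : Matrix m m ℂ} {c : ℝ}, ‖Y‖ ≤ c →
      ‖-Complex.I • ((L t)ᴴ * Y)‖ ≤ l * c := fun t Y c h => by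
    rw [norm_smul, norm_neg, Complex.norm_I, one_mul]
    refine (norm_mul_le _ _).trans (mul_le_mul ?_ h (norm_nonneg _) hl0)
    rw [l2_opNorm_conjTranspose]; exact hl t
  -- `w₁` and `1 + w₂` are the Dyson approximants of `b` and `a` of first and second order.
  set w₁ : ℝ → Matrix m m ℂ := fun t => -Complex.I • ∫ s in t₀..t, L s with hw₁
  have hdI : ∀ t, HasDerivAt (fun t => ∫ s in t₀..t, L s) (L t) t := fun t =>
    (hL.integral_hasStrictDerivAt t₀ t).hasDerivAt
  have hcI : Continuous fun t => ∫ s in t₀..t, L s :=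
    continuous_iff_continuousAt.2 fun t => (hdI t).continuousAt
  have hcL2 : Continuous fun s => (L s)ᴴ * ∫ r in t₀..s, L r := Continuous.mul hL.star hcI
  set w₂ : ℝ → Matrix m m ℂ := fun t => -∫ s in t₀..t, (L s)ᴴ * ∫ r in t₀..s, L r with hw₂
  have hd1 : ∀ t, HasDerivAt w₁ (-Complex.I • L t) t := fun t => (hdI t).const_smul (-Complex.I)
  have hd2 : ∀ t, HasDerivAt w₂ (-Complex.I • ((L t)ᴴ * w₁ t)) t := fun t => by
    refine ((hcL2.integral_hasStrictDerivAt t₀ t).hasDerivAt.neg).congr_deriv ?_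
    rw [hw₁, Matrix.mul_smul, smul_smul]
    simp
  have hw10 : w₁ t₀ = 0 := by simp [hw₁]
  have hw20 : w₂ t₀ = 0 := by simp [hw₂]
  -- A ladder in which each integration gains one factor `x`: `b = O(x)`, `a - 1 = O(x²)`, `b - w₁ =
  -- O(x³)`, and finally `a - 1 - w₂ = O(x⁴)`.
  have hbb : ∀ t ∈ Set.Icc t₀ t₁, ‖b t‖ ≤ x := fun t ht => by
    have := norm_sub_init_le hb (fun t _ => hnL t (ha1 t)) ht
    rwa [hb0, sub_zero, mul_one] at this
  have hwb : ∀ t ∈ Set.Icc t₀ t₁, ‖w₁ t‖ ≤ x := fun t ht => by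
    have := norm_sub_init_le hd1 (c := l) (fun t _ => by
      rw [norm_smul, norm_neg, Complex.norm_I, one_mul]; exact hl t) ht
    rwa [hw10, sub_zero] at this
  have hab : ∀ t ∈ Set.Icc t₀ t₁, ‖a t - 1‖ ≤ x ^ 2 := fun t ht => by
    have := norm_sub_init_le ha (fun t ht => hnL' t (hbb t ht)) ht
    rw [ha0] at this
    exact this.trans_eq (by rw [hx]; ring)
  have hbw : ∀ t ∈ Set.Icc t₀ t₁, ‖b t - w₁ t‖ ≤ x ^ 3 := fun t ht => by
    have hd : ∀ t, HasDerivAt (fun t => b t - w₁ t) (-Complex.I • (L t * (a t - 1))) t := fun t =>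
      ((hb t).sub (hd1 t)).congr_deriv (by rw [Matrix.mul_sub, Matrix.mul_one, smul_sub])
    have := norm_sub_init_le hd (fun t ht => hnL t (hab t ht)) ht
    rw [hb0, hw10, sub_zero, sub_zero] at this
    exact this.trans_eq (by rw [hx]; ring)
  have haw : ‖a t₁ - 1 - w₂ t₁‖ ≤ x ^ 4 := by
    have hd : ∀ t, HasDerivAt (fun t => a t - 1 - w₂ t)
        (-Complex.I • ((L t)ᴴ * (b t - w₁ t))) t := fun t =>
      (((ha t).sub_const 1).sub (hd2 t)).congr_deriv (by rw [Matrix.mul_sub, smul_sub])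
    have := norm_sub_init_le hd (fun t ht => hnL' t (hbw t ht)) h1m
    rw [ha0, hw20, sub_self, sub_zero, sub_zero] at this
    exact this.trans_eq (by rw [hx]; ring)
  have h3 := hbb t₁ h1m
  have h4 := hwb t₁ h1m
  have h5 := hab t₁ h1m
  have h6 := hbw t₁ h1m
  set R := a t₁ - 1 - w₂ t₁ with hR
  set S := b t₁ - w₁ t₁ with hS
  -- After the second-order term is removed, exactly five products remain, each of order `x⁴`; this
  -- is the constant 5.
  have hkey : a t₁ * ρ * (a t₁)ᴴ + b t₁ * ρ * (b t₁)ᴴ - ρ -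
      ((∫ s in t₀..t₁, L s) * ρ * (∫ s in t₀..t₁, L s)ᴴ -
        (∫ s in t₀..t₁, (L s)ᴴ * ∫ r in t₀..s, L r) * ρ -
        ρ * (∫ s in t₀..t₁, (L s)ᴴ * ∫ r in t₀..s, L r)ᴴ) =
      R * ρ + ρ * Rᴴ + (a t₁ - 1) * ρ * (a t₁ - 1)ᴴ + S * ρ * (b t₁)ᴴ + w₁ t₁ * ρ * Sᴴ := by
    have e1 : (∫ s in t₀..t₁, L s) * ρ * (∫ s in t₀..t₁, L s)ᴴ = w₁ t₁ * ρ * (w₁ t₁)ᴴ := by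
      simp [hw₁, smul_smul]
    have e2 : (∫ s in t₀..t₁, (L s)ᴴ * ∫ r in t₀..s, L r) = - w₂ t₁ := by simp [hw₂]
    rw [e1, e2, hR, hS]
    simp only [conjTranspose_sub, conjTranspose_neg, conjTranspose_one]
    noncomm_ring
  rw [hkey]
  have hρ := traceNorm_nonneg ρ
  have t1 : traceNorm (R * ρ) ≤ x ^ 4 * traceNorm ρ :=
    (traceNorm_mul_left_le _ _).trans (by gcongr)
  have t2 : traceNorm (ρ * Rᴴ) ≤ x ^ 4 * traceNorm ρ :=
    (traceNorm_mul_right_le _ _).trans (by rw [l2_opNorm_conjTranspose]; gcongr)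
  have t3 : traceNorm ((a t₁ - 1) * ρ * (a t₁ - 1)ᴴ) ≤ x ^ 2 * x ^ 2 * traceNorm ρ :=
    (traceNorm_mul_mul_le _ _ _).trans (by rw [l2_opNorm_conjTranspose]; gcongr)
  have t4 : traceNorm (S * ρ * (b t₁)ᴴ) ≤ x ^ 3 * x * traceNorm ρ :=
    (traceNorm_mul_mul_le _ _ _).trans (by rw [l2_opNorm_conjTranspose]; gcongr)
  have t5 : traceNorm (w₁ t₁ * ρ * Sᴴ) ≤ x * x ^ 3 * traceNorm ρ :=
    (traceNorm_mul_mul_le _ _ _).trans (by rw [l2_opNorm_conjTranspose]; gcongr)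
  have s1 := traceNorm_add_le (R * ρ + ρ * Rᴴ + (a t₁ - 1) * ρ * (a t₁ - 1)ᴴ + S * ρ * (b t₁)ᴴ)
    (w₁ t₁ * ρ * Sᴴ)
  have s2 := traceNorm_add_le (R * ρ + ρ * Rᴴ + (a t₁ - 1) * ρ * (a t₁ - 1)ᴴ)
    (S * ρ * (b t₁)ᴴ)
  have s3 := traceNorm_add_le (R * ρ + ρ * Rᴴ) ((a t₁ - 1) * ρ * (a t₁ - 1)ᴴ)
  have s4 := traceNorm_add_le (R * ρ) (ρ * Rᴴ)
  have : x ^ 2 * x ^ 2 = x ^ 4 ∧ x ^ 3 * x = x ^ 4 ∧ x * x ^ 3 = x ^ 4 := by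
    refine ⟨?_, ?_, ?_⟩ <;> ring
  rw [this.1] at t3
  rw [this.2.1] at t4
  rw [this.2.2] at t5
  linarith

end Interaction

/-! ### Free evolution and the Heisenberg picture -/

section FreeEvolution

open scoped Matrix.Norms.L2Operator
open Matrix Filter Topology MeasureTheory

variable {d : ℕ}

/-- The free evolution `exp(iHt)`. -/
noncomputable def freeEvolution (H : Matrix (Fin d) (Fin d) ℂ) (t : ℝ) : Matrix (Fin d) (Fin d) ℂ :=
  NormedSpace.exp ((Complex.I * (t : ℂ)) • H)

variable {H : Matrix (Fin d) (Fin d) ℂ}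

theorem heisenberg_eq (A : Matrix (Fin d) (Fin d) ℂ) (t : ℝ) :
    heisenberg H A t = freeEvolution H t * A * freeEvolution H (-t) := by
  simp [heisenberg, freeEvolution]

theorem freeEvolution_zero : freeEvolution H 0 = 1 := by
  simp [freeEvolution]

theorem freeEvolution_add (s t : ℝ) :
    freeEvolution H (s + t) = freeEvolution H s * freeEvolution H t := by
  rw [freeEvolution, freeEvolution, freeEvolution, Complex.ofReal_add, mul_add, add_smul]
  exact Matrix.exp_add_of_commute _ _ (((Commute.refl H).smul_left _).smul_right _)

theorem freeEvolution_neg_mul (t : ℝ) : freeEvolution H (-t) * freeEvolution H t = 1 := by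
  rw [← freeEvolution_add, neg_add_cancel, freeEvolution_zero]

theorem conjTranspose_freeEvolution (hH : H.IsHermitian) (t : ℝ) :
    (freeEvolution H t)ᴴ = freeEvolution H (-t) := by
  rw [freeEvolution, freeEvolution, ← Matrix.exp_conjTranspose, conjTranspose_smul, hH.eq]
  simp

theorem norm_freeEvolution_le (hH : H.IsHermitian) (t : ℝ) : ‖freeEvolution H t‖ ≤ 1 :=
  norm_le_one_of_conjTranspose_mul_self (by
    rw [conjTranspose_freeEvolution hH, freeEvolution_neg_mul])

theorem hasDerivAt_freeEvolution (t : ℝ) :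
    HasDerivAt (freeEvolution H) (freeEvolution H t * (Complex.I • H)) t := by
  have h2 : freeEvolution H = fun t : ℝ => NormedSpace.exp (t • (Complex.I • H)) := by
    funext t
    rw [freeEvolution, mul_comm, mul_smul]
    rfl
  rw [h2]
  exact hasDerivAt_exp_smul_const (𝕂 := ℝ) (Complex.I • H) t

theorem continuous_freeEvolution : Continuous (freeEvolution H) :=
  continuous_iff_continuousAt.2 fun t => (hasDerivAt_freeEvolution t).continuousAt

theorem continuous_heisenberg (A : Matrix (Fin d) (Fin d) ℂ) : Continuous (heisenberg H A) := by
  rw [funext (heisenberg_eq (H := H) A)]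
  exact (continuous_freeEvolution.mul continuous_const).mul
    (continuous_freeEvolution.comp continuous_neg)

theorem norm_heisenberg_le (hH : H.IsHermitian) (A : Matrix (Fin d) (Fin d) ℂ) (t : ℝ) :
    ‖heisenberg H A t‖ ≤ ‖A‖ := by
  rw [heisenberg_eq]
  calc _ ≤ ‖freeEvolution H t‖ * ‖A‖ * ‖freeEvolution H (-t)‖ :=
        (norm_mul_le _ _).trans (by gcongr; exact norm_mul_le _ _)
    _ ≤ 1 * ‖A‖ * 1 := by gcongr <;> exact norm_freeEvolution_le hH _
    _ = _ := by ring

theorem conjTranspose_heisenberg (hH : H.IsHermitian) (A : Matrix (Fin d) (Fin d) ℂ) (t : ℝ) :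
    (heisenberg H A t)ᴴ = heisenberg H Aᴴ t := by
  rw [heisenberg_eq, heisenberg_eq, conjTranspose_mul, conjTranspose_mul,
    conjTranspose_freeEvolution hH, conjTranspose_freeEvolution hH, neg_neg, Matrix.mul_assoc]

/-- Interaction picture for a two-level block system with Hamiltonians `H + e`, `H + e'` and
coupling `κ(t) B`. -/
theorem hasDerivAt_interaction {X Y B : ℝ → Matrix (Fin d) (Fin d) ℂ} {e : ℝ}
    {Z : Matrix (Fin d) (Fin d) ℂ} {t : ℝ}
    (hX : HasDerivAt X (-Complex.I • ((H + (e : ℂ) • 1) * X t + B t * Y t)) t) :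
    HasDerivAt (fun t : ℝ => Complex.exp (Complex.I * e * t) • (freeEvolution H t * X t * Z))
      (-Complex.I • (Complex.exp (Complex.I * e * t) • (freeEvolution H t * (B t * Y t) * Z))) t := by
  have h1 : HasDerivAt (fun t : ℝ => Complex.exp (Complex.I * e * t))
      (Complex.exp (Complex.I * e * t) * (Complex.I * e)) t := by
    have h0 : HasDerivAt (fun t : ℝ => Complex.I * e * (t : ℂ)) (Complex.I * e) t := by
      simpa using (Complex.ofRealCLM.hasDerivAt (x := t)).const_mul (Complex.I * e)
    exact h0.cexp
  have h2 := ((hasDerivAt_freeEvolution (H := H) t).mul hX).mul_const Z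
  refine (h1.smul h2).congr_deriv ?_
  simp only [Pi.mul_apply, Matrix.mul_smul, Matrix.smul_mul, Matrix.add_mul, Matrix.mul_add, smul_add,
    smul_smul, Matrix.one_mul, Matrix.mul_assoc]
  module

end FreeEvolution

/-! ### Ancilla blocks of operators on system and qubit -/

section Blocks

open scoped Matrix.Norms.L2Operator
open Matrix Filter Topology MeasureTheory

variable {d : ℕ}

/-- The block `⟨c| M |e⟩` of an operator on system and ancilla. -/
noncomputable def ancillaBlock (c e : Fin 2) :
    Matrix (Fin d × Fin 2) (Fin d × Fin 2) ℂ →L[ℝ] Matrix (Fin d) (Fin d) ℂ :=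
  LinearMap.toContinuousLinearMap
    { toFun := fun M => Matrix.of fun i j => M (i, c) (j, e)
      map_add' := fun _ _ => rfl
      map_smul' := fun _ _ => rfl }

theorem ancillaBlock_apply (c e : Fin 2) (M : Matrix (Fin d × Fin 2) (Fin d × Fin 2) ℂ)
    (i j : Fin d) : ancillaBlock c e M i j = M (i, c) (j, e) := rfl

theorem ancillaBlock_mul (c e : Fin 2) (M N : Matrix (Fin d × Fin 2) (Fin d × Fin 2) ℂ) :
    ancillaBlock c e (M * N) = ancillaBlock c 0 M * ancillaBlock 0 e N +
      ancillaBlock c 1 M * ancillaBlock 1 e N := by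
  ext i j
  simp [ancillaBlock_apply, Matrix.mul_apply, Fintype.sum_prod_type, Finset.sum_add_distrib]

theorem ancillaBlock_smul (c e : Fin 2) (z : ℂ) (M : Matrix (Fin d × Fin 2) (Fin d × Fin 2) ℂ) :
    ancillaBlock c e (z • M) = z • ancillaBlock c e M := rfl

theorem ancillaBlock_conjTranspose (c e : Fin 2)
    (M : Matrix (Fin d × Fin 2) (Fin d × Fin 2) ℂ) :
    ancillaBlock c e Mᴴ = (ancillaBlock e c M)ᴴ := rfl

theorem ancillaBlock_kronecker (c e : Fin 2) (A : Matrix (Fin d) (Fin d) ℂ)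
    (B : Matrix (Fin 2) (Fin 2) ℂ) : ancillaBlock c e (A ⊗ₖ B) = B c e • A := by
  ext i j
  simp [ancillaBlock_apply, mul_comm]

theorem ancillaBlock_one_self (c : Fin 2) :
    ancillaBlock c c (1 : Matrix (Fin d × Fin 2) (Fin d × Fin 2) ℂ) = 1 := by
  ext i j
  simp [ancillaBlock_apply, Matrix.one_apply]

theorem ancillaBlock_one_of_ne {c e : Fin 2} (h : c ≠ e) :
    ancillaBlock c e (1 : Matrix (Fin d × Fin 2) (Fin d × Fin 2) ℂ) = 0 := by
  ext i j
  simp [ancillaBlock_apply, h]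

theorem partialTrace_eq (M : Matrix (Fin d × Fin 2) (Fin d × Fin 2) ℂ) :
    partialTrace M = ancillaBlock 0 0 M + ancillaBlock 1 1 M := by
  ext i j
  simp [partialTrace, ancillaBlock_apply]

end Blocks

/-! ### The system-bath evolution and its Kraus operators -/

section Evolution

open scoped Matrix.Norms.L2Operator
open Matrix Filter Topology MeasureTheory

variable {d : ℕ} {H A : Matrix (Fin d) (Fin d) ℂ} {σ T α ω : ℝ}

theorem ancillaBlock_totalHamiltonian (t : ℝ) :
    ancillaBlock 0 0 (totalHamiltonian H A σ α ω t) = H + ((-(ω / 2) : ℝ) : ℂ) • 1 ∧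
    ancillaBlock 1 1 (totalHamiltonian H A σ α ω t) = H + ((ω / 2 : ℝ) : ℂ) • 1 ∧
    ancillaBlock 1 0 (totalHamiltonian H A σ α ω t) = ((α * gaussianFilter σ t : ℝ) : ℂ) • A ∧
    ancillaBlock 0 1 (totalHamiltonian H A σ α ω t) = ((α * gaussianFilter σ t : ℝ) : ℂ) • Aᴴ := by
  refine ⟨?_, ?_, ?_, ?_⟩ <;>
  · rw [totalHamiltonian, map_add, map_add, ancillaBlock_kronecker, ancillaBlock_kronecker,
      ancillaBlock_smul, map_add, ancillaBlock_kronecker, ancillaBlock_kronecker]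
    simp [bathHamiltonian, bathCoupling]

theorem continuous_gaussianFilter : Continuous (gaussianFilter σ) := by
  unfold gaussianFilter
  fun_prop

theorem gaussianFilter_nonneg (hσ : 0 < σ) (t : ℝ) : 0 ≤ gaussianFilter σ t := by
  unfold gaussianFilter; positivity

theorem gaussianFilter_le (hσ : 0 < σ) (t : ℝ) : gaussianFilter σ t ≤ gaussianFilter σ 0 := by
  unfold gaussianFilter
  have h : -t ^ 2 / (4 * σ ^ 2) ≤ -(0 : ℝ) ^ 2 / (4 * σ ^ 2) :=
    div_le_div_of_nonneg_right (by nlinarith [sq_nonneg t]) (by positivity)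
  exact div_le_div_of_nonneg_right (Real.exp_le_exp.2 h) (by positivity)

theorem continuous_totalHamiltonian :
    Continuous (Function.uncurry fun ω t : ℝ => totalHamiltonian H A σ α ω t) := by
  have h : Continuous fun p : ℝ × ℝ => gaussianFilter σ p.2 :=
    continuous_gaussianFilter.comp continuous_snd
  refine continuous_matrix fun p q => ?_
  simp only [Function.uncurry, totalHamiltonian, bathHamiltonian, Matrix.add_apply,
    Matrix.smul_apply, kroneckerMap_apply]
  fun_prop

/-- A bound on the norm of the total Hamiltonian that is continuous in the frequency. -/
theorem exists_norm_totalHamiltonian_le (hσ : 0 < σ) :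
    ∃ κ : ℝ → ℝ, Continuous κ ∧ ∀ ω t, ‖totalHamiltonian H A σ α ω t‖ ≤ κ ω := by
  refine ⟨fun ω => ‖H ⊗ₖ (1 : Matrix (Fin 2) (Fin 2) ℂ)‖ +
    ‖(-(ω / 2) : ℂ)‖ * ‖(1 : Matrix (Fin d) (Fin d) ℂ) ⊗ₖ
      (!![1, 0; 0, -1] : Matrix (Fin 2) (Fin 2) ℂ)‖ +
    |α| * gaussianFilter σ 0 * ‖A ⊗ₖ bathCoupling + Aᴴ ⊗ₖ bathCouplingᴴ‖, by fun_prop,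
    fun ω t => ?_⟩
  refine (norm_add_le _ _).trans (add_le_add ((norm_add_le _ _).trans (add_le_add le_rfl ?_)) ?_)
  · rw [bathHamiltonian, kronecker_smul, norm_smul]
  · rw [norm_smul, Complex.norm_real, Real.norm_eq_abs, abs_mul,
      abs_of_nonneg (gaussianFilter_nonneg hσ t)]
    gcongr
    exact gaussianFilter_le hσ t

theorem isHermitian_totalHamiltonian (hH : H.IsHermitian) (t : ℝ) :
    (totalHamiltonian H A σ α ω t).IsHermitian := by
  have hb : (bathHamiltonian ω)ᴴ = bathHamiltonian ω := by
    ext i j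
    fin_cases i <;> fin_cases j <;> simp [bathHamiltonian]
  rw [IsHermitian, totalHamiltonian, conjTranspose_add, conjTranspose_add, conjTranspose_smul,
    conjTranspose_add, conjTranspose_kronecker, conjTranspose_kronecker, conjTranspose_kronecker,
    conjTranspose_kronecker, hH.eq, hb, conjTranspose_one, conjTranspose_one,
    conjTranspose_conjTranspose, conjTranspose_conjTranspose, add_comm (Aᴴ ⊗ₖ bathCouplingᴴ)]
  simp

theorem continuous_evolution (hσ : 0 < σ) : Continuous fun ω => evolution H A σ T α ω := by
  obtain ⟨κ, hκ, hb⟩ := exists_norm_totalHamiltonian_le (H := H) (A := A) (α := α) hσ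
  have h := continuous_timeOrderedExp (K := fun ω t => totalHamiltonian H A σ α ω t)
    continuous_totalHamiltonian hκ hb (-T)
  exact h.comp (f := fun ω : ℝ => (ω, T)) (Continuous.prodMk_left T)

theorem conjTranspose_evolution_mul_self (hH : H.IsHermitian) (hσ : 0 < σ) :
    (evolution H A σ T α ω)ᴴ * evolution H A σ T α ω = 1 := by
  obtain ⟨κ, hκ, hb⟩ := exists_norm_totalHamiltonian_le (H := H) (A := A) (α := α) hσ
  exact conjTranspose_timeOrderedExp_mul_self
    (continuous_totalHamiltonian.comp (Continuous.prodMk_right ω)) (hb ω)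
    (isHermitian_totalHamiltonian hH) (-T) T

theorem kraus_of_conjTranspose_mul_self {U : Matrix (Fin d × Fin 2) (Fin d × Fin 2) ℂ}
    (hU : Uᴴ * U = 1) (c : Fin 2) :
    (ancillaBlock 0 c U)ᴴ * ancillaBlock 0 c U + (ancillaBlock 1 c U)ᴴ * ancillaBlock 1 c U = 1 := by
  rw [← ancillaBlock_conjTranspose, ← ancillaBlock_conjTranspose, ← ancillaBlock_mul, hU,
    ancillaBlock_one_self]

/-- The reduced one-step map for the ancilla starting in the basis state `c`. -/
noncomputable def basisStep (H A : Matrix (Fin d) (Fin d) ℂ) (σ T α ω : ℝ) (c : Fin 2)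
    (ρ : Matrix (Fin d) (Fin d) ℂ) : Matrix (Fin d) (Fin d) ℂ :=
  ancillaBlock 0 c (evolution H A σ T α ω) * ρ * (ancillaBlock 0 c (evolution H A σ T α ω))ᴴ +
    ancillaBlock 1 c (evolution H A σ T α ω) * ρ * (ancillaBlock 1 c (evolution H A σ T α ω))ᴴ

/-- For an ancilla state without coherences, the reduced map is the mixture of the maps started from
the two basis states. -/
theorem partialTrace_conj_kronecker (U : Matrix (Fin d × Fin 2) (Fin d × Fin 2) ℂ)
    (ρ : Matrix (Fin d) (Fin d) ℂ) (B : Matrix (Fin 2) (Fin 2) ℂ) (h01 : B 0 1 = 0)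
    (h10 : B 1 0 = 0) :
    partialTrace (U * (ρ ⊗ₖ B) * Uᴴ) = ∑ c, B c c •
      (ancillaBlock 0 c U * ρ * (ancillaBlock 0 c U)ᴴ +
        ancillaBlock 1 c U * ρ * (ancillaBlock 1 c U)ᴴ) := by
  simp only [partialTrace_eq, ancillaBlock_mul, ancillaBlock_conjTranspose,
    ancillaBlock_kronecker, h01, h10, Fin.sum_univ_two, zero_smul, Matrix.mul_zero, add_zero,
    zero_add, Matrix.mul_smul, Matrix.smul_mul, smul_add]
  abel

theorem singleStep_of_pos (hω : 0 < ω) (ρ : Matrix (Fin d) (Fin d) ℂ) :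
    singleStep H A σ T α ω ρ = basisStep H A σ T α ω 0 ρ := by
  rw [singleStep, partialTrace_conj_kronecker] <;>
  simp [bathGroundState, hω, basisStep, Fin.sum_univ_two]

theorem singleStep_of_neg (hω : ω < 0) (ρ : Matrix (Fin d) (Fin d) ℂ) :
    singleStep H A σ T α ω ρ = basisStep H A σ T α ω 1 ρ := by
  rw [singleStep, partialTrace_conj_kronecker] <;>
  simp [bathGroundState, hω, hω.not_gt, basisStep, Fin.sum_univ_two]

theorem traceNorm_basisStep_le (hH : H.IsHermitian) (hσ : 0 < σ) (c : Fin 2)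
    (ρ : Matrix (Fin d) (Fin d) ℂ) : traceNorm (basisStep H A σ T α ω c ρ) ≤ traceNorm ρ :=
  traceNorm_kraus_le (kraus_of_conjTranspose_mul_self (conjTranspose_evolution_mul_self hH hσ) c) ρ

theorem continuous_basisStep (hσ : 0 < σ) (c : Fin 2) (ρ : Matrix (Fin d) (Fin d) ℂ) :
    Continuous fun ω => basisStep H A σ T α ω c ρ := by
  have h : ∀ e, Continuous fun ω => ancillaBlock e c (evolution H A σ T α ω) := fun e =>
    (ancillaBlock e c).continuous.comp (continuous_evolution hσ)
  exact (((h 0).mul continuous_const).mul (h 0).star).add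
    (((h 1).mul continuous_const).mul (h 1).star)

end Evolution

/-! ### Time-ordered integrals and truncation of the time window -/

section Truncation

open scoped Matrix.Norms.L2Operator
open Matrix Filter Topology MeasureTheory

variable {m : Type} [Fintype m] [DecidableEq m] {L : ℝ → Matrix m m ℂ} {f : ℝ → ℝ}

theorem integral_conjTranspose {X : Type*} [MeasurableSpace X] {μ : Measure X}
    (F : X → Matrix m m ℂ) : ∫ x, (F x)ᴴ ∂μ = (∫ x, F x ∂μ)ᴴ :=
  (starL' ℝ : Matrix m m ℂ ≃L[ℝ] Matrix m m ℂ).integral_comp_comm F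

theorem integrable_of_norm_le (hL : Continuous L) (hf : Integrable f) (hb : ∀ t, ‖L t‖ ≤ f t) :
    Integrable L :=
  hf.mono' hL.aestronglyMeasurable (Eventually.of_forall hb)

theorem hasDerivAt_integral_Iic (hL : Continuous L) (hLi : Integrable L) (s : ℝ) :
    HasDerivAt (fun s => ∫ t in Set.Iic s, L t) (L s) s := by
  have h : ∀ s, ∫ t in Set.Iic s, L t = (∫ t in Set.Iic 0, L t) + ∫ t in (0 : ℝ)..s, L t :=
    fun s => by
      rw [← intervalIntegral.integral_Iic_sub_Iic hLi.integrableOn hLi.integrableOn]; abel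
  rw [funext h]
  exact (hL.integral_hasStrictDerivAt 0 s).hasDerivAt.const_add _

theorem continuous_integral_Iic (hL : Continuous L) (hLi : Integrable L) :
    Continuous fun s => ∫ t in Set.Iic s, L t :=
  continuous_iff_continuousAt.2 fun s => (hasDerivAt_integral_Iic hL hLi s).continuousAt

theorem norm_setIntegral_le (hf : Integrable f) (hb : ∀ t, ‖L t‖ ≤ f t) (S : Set ℝ) :
    ‖∫ t in S, L t‖ ≤ ∫ t in S, f t :=
  norm_integral_le_of_norm_le hf.integrableOn (Eventually.of_forall hb)

theorem setIntegral_le_integral_of_nonneg (hf : Integrable f) (h0 : ∀ t, 0 ≤ f t) (S : Set ℝ) :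
    ∫ t in S, f t ≤ ∫ t, f t :=
  setIntegral_le_integral hf (Eventually.of_forall h0)

theorem integrable_conjTranspose_mul_integral_Iic (hL : Continuous L) (hf : Integrable f)
    (hb : ∀ t, ‖L t‖ ≤ f t) : Integrable fun s => (L s)ᴴ * ∫ t in Set.Iic s, L t := by
  have hLi := integrable_of_norm_le hL hf hb
  refine (hf.mul_const (∫ t, f t)).mono'
    (hL.star.mul (continuous_integral_Iic hL hLi)).aestronglyMeasurable
    (Eventually.of_forall fun s => (norm_mul_le _ _).trans ?_)
  have h0 : ∀ t, 0 ≤ f t := fun t => (norm_nonneg _).trans (hb t)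
  rw [l2_opNorm_conjTranspose]
  exact mul_le_mul (hb s) ((norm_setIntegral_le hf hb _).trans
    (setIntegral_le_integral_of_nonneg hf h0 _)) (norm_nonneg _) (h0 s)

/-- The time-ordered double integral and its adjoint add up to the full double integral. -/
theorem timeOrdered_add_conjTranspose (hL : Continuous L) (hf : Integrable f)
    (hb : ∀ t, ‖L t‖ ≤ f t) :
    (∫ s, (L s)ᴴ * ∫ t in Set.Iic s, L t) + (∫ s, (L s)ᴴ * ∫ t in Set.Iic s, L t)ᴴ =
      (∫ t, L t)ᴴ * ∫ t, L t := by
  have hLi := integrable_of_norm_le hL hf hb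
  have hi := integrable_conjTranspose_mul_integral_Iic hL hf hb
  have hi' : Integrable fun s => ((L s)ᴴ * ∫ t in Set.Iic s, L t)ᴴ :=
    (starL' ℝ : Matrix m m ℂ ≃L[ℝ] Matrix m m ℂ).integrable_comp_iff.2 hi
  rw [← integral_conjTranspose, ← integral_add hi hi']
  -- The identity is the fundamental theorem of calculus on the whole line for `I(s)ᴴ I(s)`, where
  -- `I(s)` integrates `L` up to time `s` and runs from `0` to the full integral.
  have hd : ∀ s, HasDerivAt (fun s => star (∫ t in Set.Iic s, L t) * ∫ t in Set.Iic s, L t)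
      ((L s)ᴴ * (∫ t in Set.Iic s, L t) + ((L s)ᴴ * ∫ t in Set.Iic s, L t)ᴴ) s := fun s => by
    have h := hasDerivAt_integral_Iic hL hLi s
    refine (h.star.mul h).congr_deriv ?_
    rw [conjTranspose_mul, conjTranspose_conjTranspose]
    rfl
  have htop : Tendsto (fun s => ∫ t in Set.Iic s, L t) atTop (𝓝 (∫ t, L t)) :=
    (aecover_Iic tendsto_id).integral_tendsto_of_countably_generated hLi
  have hbot : Tendsto (fun s => ∫ t in Set.Iic s, L t) atBot (𝓝 0) := by
    have h1 : Tendsto (fun s => ∫ t in Set.Ioi s, L t) atBot (𝓝 (∫ t, L t)) :=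
      (aecover_Ioi tendsto_id).integral_tendsto_of_countably_generated hLi
    have h2 : ∀ s, ∫ t in Set.Iic s, L t = (∫ t, L t) - ∫ t in Set.Ioi s, L t := fun s => by
      rw [← intervalIntegral.integral_Iic_add_Ioi hLi.integrableOn hLi.integrableOn (b := s)]
      abel
    rw [funext h2]
    simpa using h1.const_sub (∫ t, L t)
  have h := integral_of_hasDerivAt_of_tendsto hd (hi.add hi') (hbot.star.mul hbot)
    (htop.star.mul htop)
  rw [star_zero, zero_mul, sub_zero] at h
  exact h

variable {T δ : ℝ}

theorem norm_integral_sub_truncated_le (hL : Continuous L) (hf : Integrable f)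
    (hb : ∀ t, ‖L t‖ ≤ f t) (h1 : ∫ t in Set.Iic (-T), f t ≤ δ)
    (h2 : ∫ t in Set.Ioi T, f t ≤ δ) :
    ‖(∫ t, L t) - ∫ t in (-T)..T, L t‖ ≤ 2 * δ := by
  have hLi := integrable_of_norm_le hL hf hb
  have h : (∫ t, L t) - ∫ t in (-T)..T, L t = (∫ t in Set.Iic (-T), L t) + ∫ t in Set.Ioi T, L t := by
    rw [← intervalIntegral.integral_Iic_add_Ioi hLi.integrableOn hLi.integrableOn (b := T),
      ← intervalIntegral.integral_Iic_sub_Iic hLi.integrableOn hLi.integrableOn]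
    abel
  rw [h]
  refine (norm_add_le _ _).trans ?_
  linarith [norm_setIntegral_le hf hb (Set.Iic (-T)), norm_setIntegral_le hf hb (Set.Ioi T)]

/-- Of the factor 3, two units are the tails of the outer time variable on either side, and one is
the lower limit of the inner variable. -/
theorem norm_timeOrdered_sub_truncated_le (hT : 0 ≤ T) (hL : Continuous L) (hf : Integrable f)
    (hb : ∀ t, ‖L t‖ ≤ f t) (h1 : ∫ t in Set.Iic (-T), f t ≤ δ)
    (h2 : ∫ t in Set.Ioi T, f t ≤ δ) :
    ‖(∫ s, (L s)ᴴ * ∫ t in Set.Iic s, L t) - ∫ s in (-T)..T, (L s)ᴴ * ∫ t in (-T)..s, L t‖ ≤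
      3 * δ * ∫ t, f t := by
  have hLi := integrable_of_norm_le hL hf hb
  have h0 : ∀ t, 0 ≤ f t := fun t => (norm_nonneg _).trans (hb t)
  have hi := integrable_conjTranspose_mul_integral_Iic hL hf hb
  have hF0 : 0 ≤ ∫ t, f t := integral_nonneg h0
  have hδ : 0 ≤ δ := (integral_nonneg h0).trans h1
  have hm : ∀ s, ‖(L s)ᴴ * ∫ t in Set.Iic s, L t‖ ≤ f s * ∫ t, f t := fun s => by
    refine (norm_mul_le _ _).trans ?_
    rw [l2_opNorm_conjTranspose]
    exact mul_le_mul (hb s) ((norm_setIntegral_le hf hb _).trans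
      (setIntegral_le_integral_of_nonneg hf h0 _)) (norm_nonneg _) (h0 s)
  have hA := norm_integral_sub_truncated_le (L := fun s => (L s)ᴴ * ∫ t in Set.Iic s, L t)
    (f := fun s => f s * ∫ t, f t) (T := T) (δ := δ * ∫ t, f t)
    (hL.star.mul (continuous_integral_Iic hL hLi)) (hf.mul_const _) hm
    (by rw [integral_mul_const]; gcongr) (by rw [integral_mul_const]; gcongr)
  have hQ : ∀ s, ∫ t in (-T)..s, L t = (∫ t in Set.Iic s, L t) - ∫ t in Set.Iic (-T), L t :=
    fun s => (intervalIntegral.integral_Iic_sub_Iic hLi.integrableOn hLi.integrableOn).symm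
  have hc1 : Continuous fun s => (L s)ᴴ * ∫ t in Set.Iic s, L t :=
    hL.star.mul (continuous_integral_Iic hL hLi)
  have hc2 : Continuous fun s => (L s)ᴴ * ∫ t in (-T)..s, L t :=
    hL.star.mul (continuous_iff_continuousAt.2 fun t =>
      (hL.integral_hasStrictDerivAt (-T) t).hasDerivAt.continuousAt)
  have hB : ‖(∫ s in (-T)..T, (L s)ᴴ * ∫ t in Set.Iic s, L t) -
      ∫ s in (-T)..T, (L s)ᴴ * ∫ t in (-T)..s, L t‖ ≤ δ * ∫ t, f t := by
    rw [← intervalIntegral.integral_sub (hc1.intervalIntegrable _ _)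
      (hc2.intervalIntegrable _ _), intervalIntegral.integral_of_le (by linarith)]
    refine (norm_setIntegral_le (f := fun s => δ * f s) (hf.const_mul _) (fun s => ?_) _).trans ?_
    · rw [← Matrix.mul_sub, hQ, sub_sub_cancel]
      refine (norm_mul_le _ _).trans ?_
      rw [l2_opNorm_conjTranspose, mul_comm δ]
      exact mul_le_mul (hb s) ((norm_setIntegral_le hf hb _).trans h1) (norm_nonneg _) (h0 s)
    · rw [integral_const_mul]
      exact mul_le_mul_of_nonneg_left (setIntegral_le_integral_of_nonneg hf h0 _) hδ
  refine (norm_sub_le_norm_sub_add_norm_sub _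
    (∫ s in (-T)..T, (L s)ᴴ * ∫ t in Set.Iic s, L t) _).trans ?_
  linarith

/-- Second-order term of the reduced dynamics, written with the full and with the truncated
integrals. -/
theorem traceNorm_second_order_truncated_le (hT : 0 ≤ T) (hL : Continuous L) (hf : Integrable f)
    (hb : ∀ t, ‖L t‖ ≤ f t) (h1 : ∫ t in Set.Iic (-T), f t ≤ δ)
    (h2 : ∫ t in Set.Ioi T, f t ≤ δ) (ρ : Matrix m m ℂ) :
    traceNorm ((∫ t in (-T)..T, L t) * ρ * (∫ t in (-T)..T, L t)ᴴ -
      (∫ s in (-T)..T, (L s)ᴴ * ∫ t in (-T)..s, L t) * ρ -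
      ρ * (∫ s in (-T)..T, (L s)ᴴ * ∫ t in (-T)..s, L t)ᴴ) ≤
    traceNorm (commutator ρ (∫ s, (L s)ᴴ * ∫ t in Set.Iic s, L t)ᴴ) +
      traceNorm (commutator ρ (∫ s, (L s)ᴴ * ∫ t in Set.Iic s, L t)) +
      traceNorm (dissipator (∫ t, L t) ρ) + 10 * δ * (∫ t, f t) * traceNorm ρ := by
  have h0 : ∀ t, 0 ≤ f t := fun t => (norm_nonneg _).trans (hb t)
  have hV := norm_integral_sub_truncated_le hL hf hb h1 h2
  have hW := norm_timeOrdered_sub_truncated_le hT hL hf hb h1 h2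
  have hadd := timeOrdered_add_conjTranspose hL hf hb
  have hF0 : 0 ≤ ∫ t, f t := integral_nonneg h0
  have hδ : 0 ≤ δ := (integral_nonneg h0).trans h1
  have hVn : ‖∫ t, L t‖ ≤ ∫ t, f t := norm_integral_le_of_norm_le hf (Eventually.of_forall hb)
  have hVTn : ‖∫ t in (-T)..T, L t‖ ≤ ∫ t, f t := by
    rw [intervalIntegral.integral_of_le (by linarith)]
    exact (norm_setIntegral_le hf hb _).trans (setIntegral_le_integral_of_nonneg hf h0 _)
  set V := ∫ t, L t
  set V' := ∫ t in (-T)..T, L t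
  set W := ∫ s, (L s)ᴴ * ∫ t in Set.Iic s, L t
  set W' := ∫ s in (-T)..T, (L s)ᴴ * ∫ t in (-T)..s, L t
  set F := ∫ t, f t
  -- Splitting `W` into its Hermitian part `VᴴV / 2` and its anti-Hermitian part turns the
  -- second-order term into the dissipator plus half the commutators. The four truncation errors
  -- contribute `2 + 2 + 3 + 3 = 10` units of `δ` times the mass of `f`.
  have key : V' * ρ * V'ᴴ - W' * ρ - ρ * W'ᴴ =
      dissipator V ρ + (1 / 2 : ℂ) • (commutator ρ W - commutator ρ Wᴴ) -
      (V - V') * ρ * Vᴴ - V' * ρ * (V - V')ᴴ + (W - W') * ρ + ρ * (W - W')ᴴ := by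
    rw [dissipator, commutator, commutator, ← hadd]
    simp only [conjTranspose_sub, Matrix.mul_sub, Matrix.sub_mul, Matrix.add_mul, Matrix.mul_add]
    module
  have hρ := traceNorm_nonneg ρ
  have b1 : traceNorm ((V - V') * ρ * Vᴴ) ≤ 2 * δ * F * traceNorm ρ :=
    (traceNorm_mul_mul_le _ _ _).trans (by rw [l2_opNorm_conjTranspose]; gcongr)
  have b2 : traceNorm (V' * ρ * (V - V')ᴴ) ≤ F * (2 * δ) * traceNorm ρ :=
    (traceNorm_mul_mul_le _ _ _).trans (by rw [l2_opNorm_conjTranspose]; gcongr)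
  have b3 : traceNorm ((W - W') * ρ) ≤ 3 * δ * F * traceNorm ρ :=
    (traceNorm_mul_left_le _ _).trans (by gcongr)
  have b4 : traceNorm (ρ * (W - W')ᴴ) ≤ 3 * δ * F * traceNorm ρ :=
    (traceNorm_mul_right_le _ _).trans (by rw [l2_opNorm_conjTranspose]; gcongr)
  have b5 : traceNorm ((1 / 2 : ℂ) • (commutator ρ W - commutator ρ Wᴴ)) ≤
      1 / 2 * (traceNorm (commutator ρ W) + traceNorm (commutator ρ Wᴴ)) := by
    refine (traceNorm_smul_le _ _).trans ?_
    rw [show ‖(1 / 2 : ℂ)‖ = 1 / 2 by norm_num]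
    gcongr
    exact traceNorm_sub_le _ _
  rw [key]
  have c1 := traceNorm_add_le (dissipator V ρ + (1 / 2 : ℂ) • (commutator ρ W - commutator ρ Wᴴ) -
      (V - V') * ρ * Vᴴ - V' * ρ * (V - V')ᴴ + (W - W') * ρ) (ρ * (W - W')ᴴ)
  have c2 := traceNorm_add_le (dissipator V ρ + (1 / 2 : ℂ) • (commutator ρ W - commutator ρ Wᴴ) -
      (V - V') * ρ * Vᴴ - V' * ρ * (V - V')ᴴ) ((W - W') * ρ)
  have c3 := traceNorm_sub_le (dissipator V ρ + (1 / 2 : ℂ) • (commutator ρ W - commutator ρ Wᴴ) -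
      (V - V') * ρ * Vᴴ) (V' * ρ * (V - V')ᴴ)
  have c4 := traceNorm_sub_le (dissipator V ρ + (1 / 2 : ℂ) • (commutator ρ W - commutator ρ Wᴴ))
    ((V - V') * ρ * Vᴴ)
  have c5 := traceNorm_add_le (dissipator V ρ) ((1 / 2 : ℂ) • (commutator ρ W - commutator ρ Wᴴ))
  have n1 := traceNorm_nonneg (commutator ρ W)
  have n2 := traceNorm_nonneg (commutator ρ Wᴴ)
  linarith

end Truncation

/-! ### Gaussian filter: mass, tails, Fourier transforms -/

section Gaussian

open MeasureTheory Filter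

variable {σ T : ℝ}

/-- The normalization of the Gaussian filter. -/
theorem gaussianFilter_eq (t : ℝ) :
    gaussianFilter σ t = gaussianFilter σ 0 * Real.exp (-(1 / (4 * σ ^ 2)) * t ^ 2) := by
  simp only [gaussianFilter]
  rw [show -t ^ 2 / (4 * σ ^ 2) = -(1 / (4 * σ ^ 2)) * t ^ 2 by ring]
  simp
  ring

theorem gaussianFilter_zero_sq (hσ : 0 < σ) :
    gaussianFilter σ 0 ^ 2 = 1 / (Real.sqrt (2 * Real.pi) * σ) := by
  have h1 : ((2 * Real.pi) ^ (1 / 4 : ℝ)) ^ 2 = Real.sqrt (2 * Real.pi) := by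
    rw [Real.sqrt_eq_rpow, ← Real.rpow_natCast, ← Real.rpow_mul (by positivity)]
    norm_num
  have h2 : (σ ^ (1 / 2 : ℝ)) ^ 2 = σ := by
    rw [← Real.sqrt_eq_rpow, Real.sq_sqrt hσ.le]
  simp only [gaussianFilter]
  rw [div_pow, mul_pow, h1, h2]
  simp

/-- The source of the factor `σ⁻²` in the fourth-order error, where the filter is bounded by its
maximum. -/
theorem gaussianFilter_zero_pow_four_le (hσ : 0 < σ) : gaussianFilter σ 0 ^ 4 ≤ σ⁻¹ ^ 2 := by
  rw [show gaussianFilter σ 0 ^ 4 = (gaussianFilter σ 0 ^ 2) ^ 2 by ring,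
    gaussianFilter_zero_sq hσ, one_div, mul_inv, mul_pow]
  have h1 : 1 ≤ Real.sqrt (2 * Real.pi) := by
    rw [Real.one_le_sqrt]; nlinarith [Real.pi_gt_three]
  have h2 : (Real.sqrt (2 * Real.pi))⁻¹ ≤ 1 := inv_le_one_of_one_le₀ h1
  have h3 : (Real.sqrt (2 * Real.pi))⁻¹ ^ 2 ≤ 1 := pow_le_one₀ (by positivity) h2
  exact mul_le_of_le_one_left (by positivity) h3

theorem integrable_gaussianFilter (hσ : 0 < σ) : Integrable (gaussianFilter σ) := by
  rw [funext (gaussianFilter_eq (σ := σ))]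
  exact (integrable_exp_neg_mul_sq (by positivity)).const_mul _

/-- The integral of the Gaussian filter. -/
noncomputable def filterMass (σ : ℝ) : ℝ := ∫ t, gaussianFilter σ t

theorem filterMass_nonneg (hσ : 0 < σ) : 0 ≤ filterMass σ :=
  integral_nonneg (gaussianFilter_nonneg hσ)

theorem filterMass_eq (hσ : 0 < σ) :
    filterMass σ = gaussianFilter σ 0 * (2 * σ * Real.sqrt Real.pi) := by
  rw [filterMass, show ∫ t, gaussianFilter σ t =
    ∫ t, gaussianFilter σ 0 * Real.exp (-(1 / (4 * σ ^ 2)) * t ^ 2) from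
    integral_congr_ae (Eventually.of_forall gaussianFilter_eq), integral_const_mul,
    integral_gaussian]
  congr 1
  rw [show Real.pi / (1 / (4 * σ ^ 2)) = (2 * σ) ^ 2 * Real.pi by field_simp; ring,
    Real.sqrt_mul (by positivity), Real.sqrt_sq (by positivity)]

theorem filterMass_sq_eq (hσ : 0 < σ) : filterMass σ ^ 2 = 2 * Real.sqrt (2 * Real.pi) * σ := by
  rw [filterMass_eq hσ, mul_pow, gaussianFilter_zero_sq hσ, mul_pow, Real.sq_sqrt Real.pi_pos.le]
  have h : Real.sqrt (2 * Real.pi) * Real.sqrt (2 * Real.pi) = 2 * Real.pi :=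
    Real.mul_self_sqrt (by positivity)
  have h0 : 0 < Real.sqrt (2 * Real.pi) := by positivity
  rw [one_div, inv_mul_eq_div, div_eq_iff (by positivity)]
  linear_combination (-2 * σ ^ 2) * h

theorem filterMass_sq_le (hσ : 0 < σ) : filterMass σ ^ 2 ≤ 6 * σ := by
  rw [filterMass_sq_eq hσ]
  have h : Real.sqrt (2 * Real.pi) ≤ 3 := Real.sqrt_le_iff.2 ⟨by norm_num, by
    nlinarith [Real.pi_lt_four]⟩
  nlinarith

theorem gaussianFilter_neg (t : ℝ) : gaussianFilter σ (-t) = gaussianFilter σ t := by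
  simp [gaussianFilter]

/-- For `t ≥ T ≥ 0` one has `t² ≥ T² + (t - T)²`, so the tail is dominated by a shifted copy of the
filter damped by its relative size at `T`. -/
theorem setIntegral_Ioi_gaussianFilter_le (hσ : 0 < σ) (hT : 0 ≤ T) :
    ∫ t in Set.Ioi T, gaussianFilter σ t ≤ Real.exp (-T ^ 2 / (4 * σ ^ 2)) * filterMass σ := by
  have hi := integrable_gaussianFilter hσ
  have hi2 : Integrable fun t => Real.exp (-T ^ 2 / (4 * σ ^ 2)) * gaussianFilter σ (t - T) :=
    (hi.comp_sub_right T).const_mul _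
  calc _ ≤ ∫ t in Set.Ioi T, Real.exp (-T ^ 2 / (4 * σ ^ 2)) * gaussianFilter σ (t - T) := by
        refine setIntegral_mono_on hi.integrableOn hi2.integrableOn measurableSet_Ioi
          fun t ht => ?_
        rw [gaussianFilter_eq t, gaussianFilter_eq (t - T), mul_left_comm, ← Real.exp_add]
        refine mul_le_mul_of_nonneg_left (Real.exp_le_exp.2 ?_) (gaussianFilter_nonneg hσ 0)
        have h : -T ^ 2 / (4 * σ ^ 2) = -(1 / (4 * σ ^ 2)) * T ^ 2 := by ring
        rw [h, ← mul_add, neg_mul, neg_mul, neg_le_neg_iff]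
        refine mul_le_mul_of_nonneg_left ?_ (by positivity)
        nlinarith [Set.mem_Ioi.1 ht]
    _ ≤ ∫ t, Real.exp (-T ^ 2 / (4 * σ ^ 2)) * gaussianFilter σ (t - T) :=
        setIntegral_le_integral hi2 (Eventually.of_forall fun t =>
          mul_nonneg (Real.exp_nonneg _) (gaussianFilter_nonneg hσ _))
    _ = _ := by
        rw [integral_const_mul, integral_sub_right_eq_self (gaussianFilter σ) T, filterMass]

theorem setIntegral_Iic_gaussianFilter_le (hσ : 0 < σ) (hT : 0 ≤ T) :
    ∫ t in Set.Iic (-T), gaussianFilter σ t ≤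
      Real.exp (-T ^ 2 / (4 * σ ^ 2)) * filterMass σ := by
  have h := integral_comp_neg_Iic (-T) (gaussianFilter σ)
  simp only [gaussianFilter_neg, neg_neg] at h
  rw [h]
  exact setIntegral_Ioi_gaussianFilter_le hσ hT

/-- The Fourier transform of the Gaussian filter. -/
theorem norm_fourier_gaussianFilter (hσ : 0 < σ) (x : ℝ) :
    ‖∫ t : ℝ, (gaussianFilter σ t : ℂ) * Complex.exp (Complex.I * x * t)‖ =
      filterMass σ * Real.exp (-(σ ^ 2 * x ^ 2)) := by
  have h := integral_cexp_quadratic (b := -(1 / (4 * σ ^ 2) : ℝ))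
    (by rw [Complex.neg_re, Complex.ofReal_re]; exact neg_neg_of_pos (by positivity))
    (Complex.I * x) 0
  have e : (fun t : ℝ => (gaussianFilter σ t : ℂ) * Complex.exp (Complex.I * x * t)) =
      fun t : ℝ => (gaussianFilter σ 0 : ℂ) *
        Complex.exp (-(1 / (4 * σ ^ 2) : ℝ) * t ^ 2 + Complex.I * x * t + 0) := by
    funext t
    rw [gaussianFilter_eq t, add_zero, Complex.exp_add]
    push_cast
    ring
  rw [e, integral_const_mul, h, neg_neg, norm_mul, norm_mul, Complex.norm_real,
    Real.norm_of_nonneg (gaussianFilter_nonneg hσ 0), filterMass_eq hσ, Complex.norm_exp,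
    mul_assoc]
  congr 2
  · rw [← Complex.ofReal_div, show (1 / 2 : ℂ) = ((1 / 2 : ℝ) : ℂ) by push_cast; rfl,
      ← Complex.ofReal_cpow (by positivity), Complex.norm_real, Real.norm_of_nonneg (by positivity),
      ← Real.sqrt_eq_rpow]
    rw [show Real.pi / (1 / (4 * σ ^ 2)) = (2 * σ) ^ 2 * Real.pi by field_simp; ring,
      Real.sqrt_mul (by positivity), Real.sqrt_sq (by positivity)]
  · rw [mul_pow, Complex.I_sq]
    have : (0 - -1 * (x : ℂ) ^ 2 / (4 * -((1 / (4 * σ ^ 2) : ℝ) : ℂ))) = ((-(σ ^ 2 * x ^ 2) : ℝ) : ℂ) := by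
      have hσ' : (σ : ℂ) ≠ 0 := by exact_mod_cast hσ.ne'
      push_cast
      field_simp
      ring
    rw [this, Complex.ofReal_re]

/-- The Fourier transform of the product of the filter with a translate of it. -/
theorem norm_fourier_gaussianFilter_mul (hσ : 0 < σ) (u x : ℝ) :
    ‖∫ t : ℝ, (gaussianFilter σ t : ℂ) * (gaussianFilter σ (t - u) : ℂ) *
        Complex.exp (Complex.I * x * t)‖ =
      Real.exp (-(1 / (8 * σ ^ 2)) * u ^ 2) * Real.exp (-(σ ^ 2 * x ^ 2 / 2)) := by
  have h := integral_cexp_quadratic (b := -(1 / (2 * σ ^ 2) : ℝ))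
    (by rw [Complex.neg_re, Complex.ofReal_re]; exact neg_neg_of_pos (by positivity))
    ((u / (2 * σ ^ 2) : ℝ) + Complex.I * x) (-(u ^ 2 / (4 * σ ^ 2) : ℝ))
  have e : (fun t : ℝ => (gaussianFilter σ t : ℂ) * (gaussianFilter σ (t - u) : ℂ) *
        Complex.exp (Complex.I * x * t)) =
      fun t : ℝ => ((gaussianFilter σ 0 ^ 2 : ℝ) : ℂ) *
        Complex.exp (-(1 / (2 * σ ^ 2) : ℝ) * t ^ 2 + ((u / (2 * σ ^ 2) : ℝ) + Complex.I * x) * t +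
          (-(u ^ 2 / (4 * σ ^ 2) : ℝ))) := by
    funext t
    rw [gaussianFilter_eq t, gaussianFilter_eq (t - u)]
    push_cast
    rw [mul_mul_mul_comm, ← Complex.exp_add, mul_assoc, ← Complex.exp_add, ← sq]
    congr 2
    ring
  rw [e, integral_const_mul, h, neg_neg, norm_mul, norm_mul, Complex.norm_real,
    Real.norm_of_nonneg (by positivity), Complex.norm_exp, gaussianFilter_zero_sq hσ]
  have h1 : ‖((Real.pi : ℂ) / ((1 / (2 * σ ^ 2) : ℝ) : ℂ)) ^ (1 / 2 : ℂ)‖ =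
      Real.sqrt (2 * Real.pi) * σ := by
    rw [← Complex.ofReal_div, show (1 / 2 : ℂ) = ((1 / 2 : ℝ) : ℂ) by push_cast; rfl,
      ← Complex.ofReal_cpow (by positivity), Complex.norm_real, Real.norm_of_nonneg (by positivity),
      ← Real.sqrt_eq_rpow]
    rw [show Real.pi / (1 / (2 * σ ^ 2)) = (2 * Real.pi) * σ ^ 2 by field_simp,
      Real.sqrt_mul (by positivity), Real.sqrt_sq (by positivity)]
  rw [h1, ← mul_assoc, one_div_mul_cancel (by positivity), one_mul, ← Real.exp_add]
  congr 1
  have hσ' : (σ : ℂ) ≠ 0 := by exact_mod_cast hσ.ne'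
  -- Completing the square leaves an imaginary part `u x / 2`: a pure phase, caused by the product
  -- being centred at `u / 2`, which the norm discards.
  have : (-((u ^ 2 / (4 * σ ^ 2) : ℝ) : ℂ) - (((u / (2 * σ ^ 2) : ℝ) : ℂ) + Complex.I * x) ^ 2 /
      (4 * -((1 / (2 * σ ^ 2) : ℝ) : ℂ))) =
      ((-(1 / (8 * σ ^ 2)) * u ^ 2 + -(σ ^ 2 * x ^ 2 / 2) : ℝ) : ℂ) + ((u * x / 2 : ℝ) : ℂ) * Complex.I := by
    push_cast
    field_simp
    ring_nf
    rw [Complex.I_sq]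
    ring
  rw [this, Complex.add_re, Complex.ofReal_re, Complex.re_ofReal_mul, Complex.I_re, mul_zero,
    add_zero]

theorem setIntegral_Ioi_exp_le (hσ : 0 < σ) :
    ∫ u in Set.Ioi (0 : ℝ), Real.exp (-(1 / (8 * σ ^ 2)) * u ^ 2) = filterMass σ ^ 2 / 2 := by
  rw [integral_gaussian_Ioi, filterMass_sq_eq hσ,
    show Real.pi / (1 / (8 * σ ^ 2)) = (2 * σ) ^ 2 * (2 * Real.pi) by field_simp; ring,
    Real.sqrt_mul (by positivity), Real.sqrt_sq (by positivity)]
  ring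

end Gaussian

/-! ### Jump operator and Lamb shift as matrix-valued integrals -/

section Filtered

open scoped Matrix.Norms.L2Operator
open Matrix Filter Topology MeasureTheory

variable {d : ℕ} {H A B : Matrix (Fin d) (Fin d) ℂ} {σ T α ω ν : ℝ}

/-- The integrand `f(t) exp(-iνt) B(t)` of the jump operator. -/
noncomputable def filteredOperator (H B : Matrix (Fin d) (Fin d) ℂ) (σ ν t : ℝ) :
    Matrix (Fin d) (Fin d) ℂ :=
  ((gaussianFilter σ t : ℂ) * Complex.exp (-Complex.I * ν * t)) • heisenberg H B t

theorem norm_exp_neg_I_mul (ν t : ℝ) : ‖Complex.exp (-Complex.I * ν * t)‖ = 1 := by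
  rw [Complex.norm_exp]; simp

theorem norm_exp_I_mul (ν t : ℝ) : ‖Complex.exp (Complex.I * ν * t)‖ = 1 := by
  rw [Complex.norm_exp]; simp

theorem continuous_filteredOperator : Continuous (filteredOperator H B σ ν) := by
  have h := continuous_gaussianFilter (σ := σ)
  have h2 : Continuous fun t : ℝ =>
      (gaussianFilter σ t : ℂ) * Complex.exp (-Complex.I * ν * t) := by fun_prop
  exact h2.smul (continuous_heisenberg B)

theorem norm_filteredOperator_le (hH : H.IsHermitian) (hσ : 0 < σ) (t : ℝ) :
    ‖filteredOperator H B σ ν t‖ ≤ gaussianFilter σ t * ‖B‖ := by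
  rw [filteredOperator, norm_smul, norm_mul, norm_exp_neg_I_mul, mul_one, Complex.norm_real,
    Real.norm_of_nonneg (gaussianFilter_nonneg hσ t)]
  exact mul_le_mul_of_nonneg_left (norm_heisenberg_le hH B t) (gaussianFilter_nonneg hσ t)

theorem integrable_filteredOperator (hH : H.IsHermitian) (hσ : 0 < σ) :
    Integrable (filteredOperator H B σ ν) :=
  integrable_of_norm_le continuous_filteredOperator
    ((integrable_gaussianFilter hσ).mul_const ‖B‖) (norm_filteredOperator_le hH hσ)

theorem conjTranspose_filteredOperator (hH : H.IsHermitian) (t : ℝ) :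
    (filteredOperator H B σ ν t)ᴴ =
      ((gaussianFilter σ t : ℂ) * Complex.exp (Complex.I * ν * t)) • heisenberg H Bᴴ t := by
  rw [filteredOperator, conjTranspose_smul, conjTranspose_heisenberg hH]
  congr 1
  rw [star_mul', Complex.star_def, Complex.conj_ofReal, ← Complex.exp_conj]
  simp

theorem jumpOperator_eq_integral (hH : H.IsHermitian) (hσ : 0 < σ) :
    jumpOperator H B σ ν = ∫ t, filteredOperator H B σ ν t := by
  ext i j
  rw [integral_apply_apply (integrable_filteredOperator hH hσ)]
  rfl

theorem lambShiftOperator_eq_integral (hH : H.IsHermitian) (hσ : 0 < σ) :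
    lambShiftOperator H B σ ν = ∫ s, ∫ t in Set.Iic s,
      (filteredOperator H B σ ν t)ᴴ * filteredOperator H B σ ν s := by
  have hLi := integrable_filteredOperator (B := B) (ν := ν) hH hσ
  have hLs : Integrable fun t => (filteredOperator H B σ ν t)ᴴ :=
    (starL' ℝ : Matrix (Fin d) (Fin d) ℂ ≃L[ℝ] _).integrable_comp_iff.2 hLi
  have hi : ∀ s, IntegrableOn (fun t => (filteredOperator H B σ ν t)ᴴ *
      filteredOperator H B σ ν s) (Set.Iic s) := fun s => (hLs.mul_const _).integrableOn
  have hi2 : Integrable fun s => ∫ t in Set.Iic s,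
      (filteredOperator H B σ ν t)ᴴ * filteredOperator H B σ ν s := by
    have h := integrable_conjTranspose_mul_integral_Iic (continuous_filteredOperator)
      ((integrable_gaussianFilter hσ).mul_const ‖B‖) (norm_filteredOperator_le (B := B) (ν := ν) hH hσ)
    have h2 := (starL' ℝ : Matrix (Fin d) (Fin d) ℂ ≃L[ℝ] _).integrable_comp_iff.2 h
    refine h2.congr (Eventually.of_forall fun s => ?_)
    simp only
    rw [integral_mul_const_of_integrable hLs.integrableOn, integral_conjTranspose]
    exact conjTranspose_mul _ _ |>.trans (by rw [conjTranspose_conjTranspose])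
  ext i j
  rw [integral_apply_apply hi2]
  simp_rw [integral_apply_apply (hi _)]
  refine integral_congr_ae (Eventually.of_forall fun s₁ => ?_)
  refine integral_congr_ae (Eventually.of_forall fun s₂ => ?_)
  simp only
  rw [conjTranspose_filteredOperator hH, filteredOperator, Matrix.smul_mul, Matrix.mul_smul,
    smul_smul, Matrix.smul_apply, smul_eq_mul,
    show Complex.I * ν * (s₂ - s₁) = Complex.I * ν * s₂ + -Complex.I * ν * s₁ by ring,
    Complex.exp_add]
  ring

/-- Taking the adjoint puts the later time on the left, which is the ordering produced by the
second-order Dyson term. -/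
theorem conjTranspose_lambShiftOperator (hH : H.IsHermitian) (hσ : 0 < σ) :
    (lambShiftOperator H B σ ν)ᴴ = ∫ s, (filteredOperator H B σ ν s)ᴴ *
      ∫ t in Set.Iic s, filteredOperator H B σ ν t := by
  have hLi := integrable_filteredOperator (B := B) (ν := ν) hH hσ
  have hLs : Integrable fun t => (filteredOperator H B σ ν t)ᴴ :=
    (starL' ℝ : Matrix (Fin d) (Fin d) ℂ ≃L[ℝ] _).integrable_comp_iff.2 hLi
  rw [lambShiftOperator_eq_integral hH hσ, ← integral_conjTranspose]
  refine integral_congr_ae (Eventually.of_forall fun s => ?_)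
  simp only
  rw [integral_mul_const_of_integrable hLs.integrableOn, integral_conjTranspose,
    conjTranspose_mul, conjTranspose_conjTranspose]

/-- The contribution of one coupling operator and one frequency to the generator defect. -/
noncomputable def pointwiseDefect (H B : Matrix (Fin d) (Fin d) ℂ) (σ ν : ℝ)
    (ρ : Matrix (Fin d) (Fin d) ℂ) : ℝ :=
  traceNorm (commutator ρ (lambShiftOperator H B σ ν)) +
    traceNorm (commutator ρ (lambShiftOperator H B σ ν)ᴴ) +
    traceNorm (dissipator (jumpOperator H B σ ν) ρ)

/-- The second-order expansion and the passage to infinite time windows are combined here. The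
first-block bound `ha1`, which comes from unitarity, keeps the remainder polynomial in the coupling
strength. -/
theorem traceNorm_interaction_sub_le (hH : H.IsHermitian) (hσ : 0 < σ) (hT : 0 < T) (hα : 0 < α)
    {a b : ℝ → Matrix (Fin d) (Fin d) ℂ}
    (ha : ∀ t, HasDerivAt a (-Complex.I • (((α : ℂ) • filteredOperator H B σ ν t)ᴴ * b t)) t)
    (hb : ∀ t, HasDerivAt b (-Complex.I • (((α : ℂ) • filteredOperator H B σ ν t) * a t)) t)
    (ha0 : a (-T) = 1) (hb0 : b (-T) = 0) (ha1 : ∀ t, ‖a t‖ ≤ 1)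
    {ρ : Matrix (Fin d) (Fin d) ℂ} (hρ : traceNorm ρ ≤ 1) :
    traceNorm (a T * ρ * (a T)ᴴ + b T * ρ * (b T)ᴴ - ρ) ≤
      α ^ 2 * (pointwiseDefect H B σ ν ρ +
        80 * (σ * Real.exp (-T ^ 2 / (4 * σ ^ 2)) * ‖B‖ ^ 2 +
          α ^ 2 * T ^ 4 * σ⁻¹ ^ 2 * ‖B‖ ^ 4)) := by
  set L := filteredOperator H B σ ν with hL
  have hLc : Continuous L := continuous_filteredOperator
  have hbd : ∀ t, ‖(α : ℂ) • L t‖ ≤ α * (gaussianFilter σ 0 * ‖B‖) := fun t => by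
    rw [norm_smul, Complex.norm_real, Real.norm_of_nonneg hα.le]
    refine mul_le_mul_of_nonneg_left ((norm_filteredOperator_le hH hσ t).trans ?_) hα.le
    exact mul_le_mul_of_nonneg_right (gaussianFilter_le hσ t) (norm_nonneg B)
  have h4 := traceNorm_kraus_sub_second_order_le (L := fun t => (α : ℂ) • L t)
    (by linarith : -T ≤ T) (hLc.const_smul (α : ℂ)) hbd ha hb ha0 hb0 ha1 ρ
  have hi1 : ∀ s, ∫ t in (-T)..s, (α : ℂ) • L t = (α : ℂ) • ∫ t in (-T)..s, L t := fun s =>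
    intervalIntegral.integral_smul _ _
  have hi2 : ∫ s in (-T)..T, ((α : ℂ) • L s)ᴴ * ∫ t in (-T)..s, (α : ℂ) • L t =
      ((α ^ 2 : ℝ) : ℂ) • ∫ s in (-T)..T, (L s)ᴴ * ∫ t in (-T)..s, L t := by
    rw [← intervalIntegral.integral_smul]
    refine intervalIntegral.integral_congr fun s _ => ?_
    rw [hi1, conjTranspose_smul, Matrix.smul_mul, Matrix.mul_smul, smul_smul]
    congr 1
    simp [sq]
  have hf := (integrable_gaussianFilter hσ).mul_const ‖B‖
  have hδ : ∀ {S : Set ℝ}, ∫ t in S, gaussianFilter σ t ≤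
      Real.exp (-T ^ 2 / (4 * σ ^ 2)) * filterMass σ → ∫ t in S, gaussianFilter σ t * ‖B‖ ≤
      Real.exp (-T ^ 2 / (4 * σ ^ 2)) * filterMass σ * ‖B‖ := fun h => by
    rw [integral_mul_const]
    exact mul_le_mul_of_nonneg_right h (norm_nonneg B)
  have h2 := traceNorm_second_order_truncated_le hT.le hLc hf (norm_filteredOperator_le hH hσ)
    (hδ (setIntegral_Iic_gaussianFilter_le hσ hT.le))
    (hδ (setIntegral_Ioi_gaussianFilter_le hσ hT.le)) ρ
  rw [← conjTranspose_lambShiftOperator hH hσ, ← jumpOperator_eq_integral hH hσ,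
    conjTranspose_conjTranspose, integral_mul_const, ← filterMass] at h2
  rw [hi1, hi2] at h4
  set V := ∫ t in (-T)..T, L t
  set W := ∫ s in (-T)..T, (L s)ᴴ * ∫ t in (-T)..s, L t
  have e : ((α : ℂ) • V) * ρ * ((α : ℂ) • V)ᴴ - (((α ^ 2 : ℝ) : ℂ) • W) * ρ -
      ρ * (((α ^ 2 : ℝ) : ℂ) • W)ᴴ = ((α ^ 2 : ℝ) : ℂ) • (V * ρ * Vᴴ - W * ρ - ρ * Wᴴ) := by
    simp only [conjTranspose_smul, Matrix.smul_mul, Matrix.mul_smul, smul_smul, smul_sub,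
      Complex.star_def, Complex.conj_ofReal]
    congr 3
    push_cast
    ring
  rw [e] at h4
  set X := a T * ρ * (a T)ᴴ + b T * ρ * (b T)ᴴ - ρ
  set Y := V * ρ * Vᴴ - W * ρ - ρ * Wᴴ
  have h5 : traceNorm X ≤ traceNorm (X - ((α ^ 2 : ℝ) : ℂ) • Y) + α ^ 2 * traceNorm Y := by
    have h := traceNorm_add_le (X - ((α ^ 2 : ℝ) : ℂ) • Y) (((α ^ 2 : ℝ) : ℂ) • Y)
    rw [sub_add_cancel] at h
    have h' := traceNorm_smul_le ((α ^ 2 : ℝ) : ℂ) Y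
    rw [Complex.norm_real, Real.norm_of_nonneg (sq_nonneg α)] at h'
    linarith
  -- The window has length `2T`, and `5 * 2⁴ = 80`.
  have h6 : 5 * (α * (gaussianFilter σ 0 * ‖B‖) * (T - -T)) ^ 4 * traceNorm ρ ≤
      80 * (α ^ 4 * T ^ 4 * σ⁻¹ ^ 2 * ‖B‖ ^ 4) := by
    calc _ ≤ 5 * (α * (gaussianFilter σ 0 * ‖B‖) * (T - -T)) ^ 4 * 1 := by gcongr
      _ = 80 * (α ^ 4 * T ^ 4 * gaussianFilter σ 0 ^ 4 * ‖B‖ ^ 4) := by ring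
      _ ≤ _ := by gcongr; exact gaussianFilter_zero_pow_four_le hσ
  -- The squared filter mass is at most `6σ`, giving 60, which is rounded up to the common constant
  -- 80.
  have h7 : 10 * (Real.exp (-T ^ 2 / (4 * σ ^ 2)) * filterMass σ * ‖B‖) *
      (filterMass σ * ‖B‖) * traceNorm ρ ≤
      80 * (σ * Real.exp (-T ^ 2 / (4 * σ ^ 2)) * ‖B‖ ^ 2) := by
    have := filterMass_nonneg hσ
    calc _ ≤ 10 * (Real.exp (-T ^ 2 / (4 * σ ^ 2)) * filterMass σ * ‖B‖) *
          (filterMass σ * ‖B‖) * 1 := by gcongr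
      _ = 10 * (filterMass σ ^ 2 * Real.exp (-T ^ 2 / (4 * σ ^ 2)) * ‖B‖ ^ 2) := by ring
      _ ≤ 10 * ((6 * σ) * Real.exp (-T ^ 2 / (4 * σ ^ 2)) * ‖B‖ ^ 2) := by
        gcongr; exact filterMass_sq_le hσ
      _ ≤ _ := by
        have : 0 ≤ σ * Real.exp (-T ^ 2 / (4 * σ ^ 2)) * ‖B‖ ^ 2 := by positivity
        linarith
  have h8 : traceNorm Y ≤ pointwiseDefect H B σ ν ρ +
      80 * (σ * Real.exp (-T ^ 2 / (4 * σ ^ 2)) * ‖B‖ ^ 2) := by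
    rw [pointwiseDefect]; linarith
  have h9 := mul_le_mul_of_nonneg_left h8 (sq_nonneg α)
  calc _ ≤ _ := h5
    _ ≤ 80 * (α ^ 4 * T ^ 4 * σ⁻¹ ^ 2 * ‖B‖ ^ 4) + α ^ 2 * (pointwiseDefect H B σ ν ρ +
      80 * (σ * Real.exp (-T ^ 2 / (4 * σ ^ 2)) * ‖B‖ ^ 2)) := add_le_add (h4.trans h6) h9
    _ = _ := by ring

end Filtered

/-! ### One step of the dynamics started from an eigenprojection -/

section Step

open scoped Matrix.Norms.L2Operator
open Matrix Filter Topology MeasureTheory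

variable {d : ℕ} {H A B P : Matrix (Fin d) (Fin d) ℂ} {σ T α ω ν E₀ : ℝ}

theorem hasDerivAt_cexp_I_mul (e t : ℝ) :
    HasDerivAt (fun t : ℝ => Complex.exp (Complex.I * e * t))
      (Complex.exp (Complex.I * e * t) * (Complex.I * e)) t := by
  have h0 : HasDerivAt (fun t : ℝ => Complex.I * e * (t : ℂ)) (Complex.I * e) t := by
    simpa using (Complex.ofRealCLM.hasDerivAt (x := t)).const_mul (Complex.I * e)
  exact h0.cexp

theorem freeEvolution_mul_of_eigen (hP : H * P = (E₀ : ℂ) • P) (t : ℝ) :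
    freeEvolution H t * P = Complex.exp (Complex.I * E₀ * t) • P := by
  have hd : ∀ s, HasDerivAt (fun s : ℝ => Complex.exp (Complex.I * (-E₀ : ℝ) * s) •
      (freeEvolution H s * P)) 0 s := fun s => by
    refine ((hasDerivAt_cexp_I_mul (-E₀) s).smul
      ((hasDerivAt_freeEvolution s).mul_const P)).congr_deriv ?_
    rw [Matrix.mul_assoc, Matrix.smul_mul, hP]
    simp only [Matrix.mul_smul, smul_smul, Complex.ofReal_neg]
    module
  have h := is_const_of_deriv_eq_zero (fun s => (hd s).differentiableAt) (fun s => (hd s).deriv) t 0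
  simp only [freeEvolution_zero, Matrix.one_mul, Complex.ofReal_zero, mul_zero, Complex.exp_zero,
    one_smul] at h
  conv_rhs => rw [← h]
  rw [smul_smul, ← Complex.exp_add]
  simp

theorem mul_freeEvolution_of_eigen (hH : H.IsHermitian) (hPP : Pᴴ = P)
    (hP : H * P = (E₀ : ℂ) • P) (t : ℝ) :
    P * freeEvolution H t = Complex.exp (Complex.I * E₀ * t) • P := by
  have h := congrArg conjTranspose (freeEvolution_mul_of_eigen hP (-t))
  rw [conjTranspose_mul, conjTranspose_freeEvolution hH, hPP, neg_neg, conjTranspose_smul, hPP] at h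
  rw [h, Complex.star_def, ← Complex.exp_conj]
  simp

theorem freeEvolution_conj_of_eigen (hH : H.IsHermitian) (hPP : Pᴴ = P)
    (hP : H * P = (E₀ : ℂ) • P) (t : ℝ) :
    freeEvolution H t * P * freeEvolution H (-t) = P := by
  rw [freeEvolution_mul_of_eigen hP, Matrix.smul_mul, mul_freeEvolution_of_eigen hH hPP hP,
    smul_smul, ← Complex.exp_add]
  simp

/-- One step starting from an eigenprojection, for a two-block system in the Schrödinger picture
whose blocks have energies `e = ν + e'` and `e'`. -/
theorem traceNorm_blocks_sub_le (hH : H.IsHermitian) (hσ : 0 < σ) (hT : 0 < T) (hα : 0 < α)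
    {X Y : ℝ → Matrix (Fin d) (Fin d) ℂ} {e e' : ℝ} (he : e = ν + e')
    (hX : ∀ t, HasDerivAt X (-Complex.I • ((H + (e : ℂ) • 1) * X t +
      (((α * gaussianFilter σ t : ℝ) : ℂ) • Bᴴ) * Y t)) t)
    (hY : ∀ t, HasDerivAt Y (-Complex.I • ((H + (e' : ℂ) • 1) * Y t +
      (((α * gaussianFilter σ t : ℝ) : ℂ) • B) * X t)) t)
    (hX0 : X (-T) = 1) (hY0 : Y (-T) = 0) (hK : ∀ t, (X t)ᴴ * X t + (Y t)ᴴ * Y t = 1)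
    (hPP : Pᴴ = P) (hP : H * P = (E₀ : ℂ) • P) (hP1 : traceNorm P ≤ 1) :
    traceNorm (X T * P * (X T)ᴴ + Y T * P * (Y T)ᴴ - P) ≤
      α ^ 2 * (pointwiseDefect H B σ ν P +
        80 * (σ * Real.exp (-T ^ 2 / (4 * σ ^ 2)) * ‖B‖ ^ 2 +
          α ^ 2 * T ^ 4 * σ⁻¹ ^ 2 * ‖B‖ ^ 4)) := by
  -- `Z` normalises the interaction picture to the identity at the initial time `-T`. It is unitary
  -- and commutes past `P` up to a phase, so it disappears from the conjugation of `P`.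
  set Z : Matrix (Fin d) (Fin d) ℂ := Complex.exp (Complex.I * e * T) • freeEvolution H T with hZ
  have hc : ∀ e t : ℝ, star (Complex.exp (Complex.I * e * t)) * Complex.exp (Complex.I * e * t) = 1 :=
    fun e t => by
      rw [Complex.star_def, ← Complex.exp_conj, ← Complex.exp_add]; simp
  have hZZ : Zᴴ * Z = 1 := by
    rw [hZ, conjTranspose_smul, Matrix.smul_mul, Matrix.mul_smul, smul_smul, hc, one_smul,
      conjTranspose_freeEvolution hH, freeEvolution_neg_mul]
  have hZP : Z * P * Zᴴ = P := by
    rw [hZ, conjTranspose_smul, Matrix.smul_mul, Matrix.smul_mul, Matrix.mul_smul, smul_smul,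
      mul_comm, hc, one_smul, conjTranspose_freeEvolution hH,
      freeEvolution_conj_of_eigen hH hPP hP]
  set a : ℝ → Matrix (Fin d) (Fin d) ℂ :=
    fun t => Complex.exp (Complex.I * e * t) • (freeEvolution H t * X t * Z) with ha
  set b : ℝ → Matrix (Fin d) (Fin d) ℂ :=
    fun t => Complex.exp (Complex.I * e' * t) • (freeEvolution H t * Y t * Z) with hb
  have hcan : ∀ (t : ℝ) (M N : Matrix (Fin d) (Fin d) ℂ),
      freeEvolution H t * M * freeEvolution H (-t) * (freeEvolution H t * N * Z) =
        freeEvolution H t * (M * N) * Z := fun t M N => by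
    calc _ = freeEvolution H t * M * (freeEvolution H (-t) * freeEvolution H t) * N * Z := by
          simp only [Matrix.mul_assoc]
      _ = _ := by rw [freeEvolution_neg_mul, Matrix.mul_one]; simp only [Matrix.mul_assoc]
  -- The block phases differ by `exp(iνt)` because `e - e' = ν`; this is the modulation in
  -- `filteredOperator`.
  have hda : ∀ t, HasDerivAt a
      (-Complex.I • (((α : ℂ) • filteredOperator H B σ ν t)ᴴ * b t)) t := fun t => by
    have h := hasDerivAt_interaction (B := fun t => ((α * gaussianFilter σ t : ℝ) : ℂ) • Bᴴ)
      (Z := Z) (hX t)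
    refine HasDerivAt.congr_deriv h ?_
    rw [conjTranspose_smul, conjTranspose_filteredOperator hH, heisenberg_eq]
    simp only [hb, Matrix.smul_mul, Matrix.mul_smul, smul_smul, hcan]
    congr 2
    rw [he, Complex.ofReal_add, mul_add, add_mul, Complex.exp_add, Complex.star_def,
      Complex.conj_ofReal]
    push_cast
    ring
  have hdb : ∀ t, HasDerivAt b
      (-Complex.I • (((α : ℂ) • filteredOperator H B σ ν t) * a t)) t := fun t => by
    have h := hasDerivAt_interaction (B := fun t => ((α * gaussianFilter σ t : ℝ) : ℂ) • B)
      (Z := Z) (hY t)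
    refine HasDerivAt.congr_deriv h ?_
    rw [filteredOperator, heisenberg_eq]
    simp only [ha, Matrix.smul_mul, Matrix.mul_smul, smul_smul, hcan]
    congr 2
    rw [he, Complex.ofReal_add, mul_add, add_mul, Complex.exp_add,
      show -Complex.I * (ν : ℂ) * t = -(Complex.I * ν * t) by ring, Complex.exp_neg]
    have := Complex.exp_ne_zero (Complex.I * ν * t)
    push_cast
    field_simp
  have ha0 : a (-T) = 1 := by
    rw [ha, hZ]
    simp only [hX0, Matrix.mul_one, Matrix.mul_smul, smul_smul, freeEvolution_neg_mul,
      ← Complex.exp_add]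
    simp
  have hb0 : b (-T) = 0 := by
    rw [hb]
    simp [hY0]
  have hE : ∀ t, (freeEvolution H t)ᴴ * freeEvolution H t = 1 := fun t => by
    rw [conjTranspose_freeEvolution hH, freeEvolution_neg_mul]
  have hsq : ∀ (e t : ℝ) (M : Matrix (Fin d) (Fin d) ℂ),
      (Complex.exp (Complex.I * e * t) • (freeEvolution H t * M * Z))ᴴ *
        (Complex.exp (Complex.I * e * t) • (freeEvolution H t * M * Z)) = Zᴴ * (Mᴴ * M) * Z :=
    fun e t M => by
      rw [conjTranspose_smul, Matrix.smul_mul, Matrix.mul_smul, smul_smul, hc, one_smul]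
      calc _ = Zᴴ * (Mᴴ * ((freeEvolution H t)ᴴ * freeEvolution H t) * M) * Z := by
            simp only [conjTranspose_mul, Matrix.mul_assoc]
        _ = _ := by rw [hE, Matrix.mul_one]
  have ha1 : ∀ t, ‖a t‖ ≤ 1 := fun t => by
    refine norm_le_one_of_kraus (K₁ := b t) ?_
    rw [ha, hb]
    simp only [hsq]
    rw [← Matrix.add_mul, ← Matrix.mul_add, hK, Matrix.mul_one, hZZ]
  have hmain := traceNorm_interaction_sub_le hH hσ hT hα hda hdb ha0 hb0 ha1 hP1
  have hconj : ∀ (e : ℝ) (M : Matrix (Fin d) (Fin d) ℂ),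
      freeEvolution H (-T) * ((Complex.exp (Complex.I * e * T) • (freeEvolution H T * M * Z)) * P *
        (Complex.exp (Complex.I * e * T) • (freeEvolution H T * M * Z))ᴴ) * freeEvolution H T =
        M * P * Mᴴ := fun e M => by
    rw [conjTranspose_smul, Matrix.smul_mul, Matrix.smul_mul, Matrix.mul_smul _ (star _), smul_smul,
      mul_comm, hc, one_smul, conjTranspose_mul, conjTranspose_mul, conjTranspose_freeEvolution hH]
    calc _ = (freeEvolution H (-T) * freeEvolution H T) * M * (Z * P * Zᴴ) * Mᴴ *
          (freeEvolution H (-T) * freeEvolution H T) := by simp only [Matrix.mul_assoc]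
      _ = _ := by rw [freeEvolution_neg_mul, hZP, Matrix.one_mul, Matrix.mul_one]
  have hPinv : freeEvolution H (-T) * P * freeEvolution H T = P := by
    have := freeEvolution_conj_of_eigen hH hPP hP (-T)
    rwa [neg_neg] at this
  -- Since `P` is stationary under the free evolution, the deviation from `P` is a unitary conjugate
  -- of the one in the interaction picture, and the trace norm does not grow.
  have heq : X T * P * (X T)ᴴ + Y T * P * (Y T)ᴴ - P = freeEvolution H (-T) *
      (a T * P * (a T)ᴴ + b T * P * (b T)ᴴ - P) * freeEvolution H T := by
    rw [Matrix.mul_sub, Matrix.sub_mul, Matrix.mul_add, Matrix.add_mul, hPinv, ha, hb, hconj, hconj]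
  rw [heq]
  refine (traceNorm_mul_mul_le _ _ _).trans (le_trans ?_ hmain)
  refine mul_le_of_le_one_left (traceNorm_nonneg _) ?_
  exact mul_le_one₀ (norm_freeEvolution_le hH _) (norm_nonneg _) (norm_freeEvolution_le hH _)

theorem hasDerivAt_ancillaBlock_timeOrderedExp (hσ : 0 < σ) (c e : Fin 2) (t₀ t : ℝ) :
    HasDerivAt (fun t => ancillaBlock c e (timeOrderedExp (totalHamiltonian H A σ α ω) t₀ t))
      (-Complex.I • (ancillaBlock c 0 (totalHamiltonian H A σ α ω t) *
          ancillaBlock 0 e (timeOrderedExp (totalHamiltonian H A σ α ω) t₀ t) +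
        ancillaBlock c 1 (totalHamiltonian H A σ α ω t) *
          ancillaBlock 1 e (timeOrderedExp (totalHamiltonian H A σ α ω) t₀ t))) t := by
  obtain ⟨κ, hκ, hb⟩ := exists_norm_totalHamiltonian_le (H := H) (A := A) (α := α) hσ
  have h := hasDerivAt_timeOrderedExp
    (continuous_totalHamiltonian.comp (Continuous.prodMk_right ω)) (hb ω) t₀ t
  have h2 := (ancillaBlock (d := d) c e).hasFDerivAt.comp_hasDerivAt t h
  rw [ancillaBlock_smul, ancillaBlock_mul] at h2
  exact h2

/-- Ancilla level 0 has energy `-ω/2` and level 1 has `ω/2`. The flip out of level 0 uses `A`, and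
the energy difference is `ν = -ω`, which is negative for the frequencies at which level 0 is the
bath ground state. -/
theorem traceNorm_basisStep_zero_sub_le (hH : H.IsHermitian) (hσ : 0 < σ) (hT : 0 < T)
    (hα : 0 < α) (hPP : Pᴴ = P) (hP : H * P = (E₀ : ℂ) • P) (hP1 : traceNorm P ≤ 1) :
    traceNorm (basisStep H A σ T α ω 0 P - P) ≤
      α ^ 2 * (pointwiseDefect H A σ (-ω) P +
        80 * (σ * Real.exp (-T ^ 2 / (4 * σ ^ 2)) * ‖A‖ ^ 2 +
          α ^ 2 * T ^ 4 * σ⁻¹ ^ 2 * ‖A‖ ^ 4)) := by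
  obtain ⟨κ, hκ, hb⟩ := exists_norm_totalHamiltonian_le (H := H) (A := A) (α := α) hσ
  have hc := continuous_totalHamiltonian (H := H) (A := A) (σ := σ) (α := α) |>.comp
    (Continuous.prodMk_right ω)
  have hU0 := timeOrderedExp_self hc (hb ω) (-T)
  refine traceNorm_blocks_sub_le (e := -(ω / 2)) (e' := ω / 2) hH hσ hT hα (by ring)
    (X := fun t => ancillaBlock 0 0 (timeOrderedExp (totalHamiltonian H A σ α ω) (-T) t))
    (Y := fun t => ancillaBlock 1 0 (timeOrderedExp (totalHamiltonian H A σ α ω) (-T) t))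
    (fun t => ?_) (fun t => ?_) ?_ ?_ (fun t => ?_) hPP hP hP1
  · have h := hasDerivAt_ancillaBlock_timeOrderedExp (H := H) (A := A) (α := α) (ω := ω) hσ 0 0 (-T) t
    obtain ⟨h00, h11, h10, h01⟩ :=
      ancillaBlock_totalHamiltonian (H := H) (A := A) (σ := σ) (α := α) (ω := ω) t
    rwa [h00, h01] at h
  · have h := hasDerivAt_ancillaBlock_timeOrderedExp (H := H) (A := A) (α := α) (ω := ω) hσ 1 0 (-T) t
    obtain ⟨h00, h11, h10, h01⟩ :=
      ancillaBlock_totalHamiltonian (H := H) (A := A) (σ := σ) (α := α) (ω := ω) t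
    rwa [h10, h11, add_comm (_ * _)] at h
  · exact (congrArg (ancillaBlock 0 0) hU0).trans (ancillaBlock_one_self 0)
  · exact (congrArg (ancillaBlock 1 0) hU0).trans (ancillaBlock_one_of_ne (by decide))
  · exact kraus_of_conjTranspose_mul_self (conjTranspose_timeOrderedExp_mul_self hc (hb ω)
      (isHermitian_totalHamiltonian hH) (-T) t) 0

/-- The roles of the levels are exchanged: the flip out of level 1 uses `Aᴴ`, and `ν = ω`, again
negative when level 1 is the bath ground state. -/
theorem traceNorm_basisStep_one_sub_le (hH : H.IsHermitian) (hσ : 0 < σ) (hT : 0 < T)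
    (hα : 0 < α) (hPP : Pᴴ = P) (hP : H * P = (E₀ : ℂ) • P) (hP1 : traceNorm P ≤ 1) :
    traceNorm (basisStep H A σ T α ω 1 P - P) ≤
      α ^ 2 * (pointwiseDefect H Aᴴ σ ω P +
        80 * (σ * Real.exp (-T ^ 2 / (4 * σ ^ 2)) * ‖A‖ ^ 2 +
          α ^ 2 * T ^ 4 * σ⁻¹ ^ 2 * ‖A‖ ^ 4)) := by
  obtain ⟨κ, hκ, hb⟩ := exists_norm_totalHamiltonian_le (H := H) (A := A) (α := α) hσ
  have hc := continuous_totalHamiltonian (H := H) (A := A) (σ := σ) (α := α) |>.comp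
    (Continuous.prodMk_right ω)
  have hU0 := timeOrderedExp_self hc (hb ω) (-T)
  rw [basisStep, add_comm (_ * _), ← l2_opNorm_conjTranspose A]
  refine traceNorm_blocks_sub_le (e := ω / 2) (e' := -(ω / 2)) hH hσ hT hα (by ring)
    (X := fun t => ancillaBlock 1 1 (timeOrderedExp (totalHamiltonian H A σ α ω) (-T) t))
    (Y := fun t => ancillaBlock 0 1 (timeOrderedExp (totalHamiltonian H A σ α ω) (-T) t))
    (fun t => ?_) (fun t => ?_) ?_ ?_ (fun t => ?_) hPP hP hP1
  · have h := hasDerivAt_ancillaBlock_timeOrderedExp (H := H) (A := A) (α := α) (ω := ω) hσ 1 1 (-T) t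
    obtain ⟨h00, h11, h10, h01⟩ :=
      ancillaBlock_totalHamiltonian (H := H) (A := A) (σ := σ) (α := α) (ω := ω) t
    rw [conjTranspose_conjTranspose]
    rwa [h10, h11, add_comm (_ * _)] at h
  · have h := hasDerivAt_ancillaBlock_timeOrderedExp (H := H) (A := A) (α := α) (ω := ω) hσ 0 1 (-T) t
    obtain ⟨h00, h11, h10, h01⟩ :=
      ancillaBlock_totalHamiltonian (H := H) (A := A) (σ := σ) (α := α) (ω := ω) t
    rwa [h00, h01] at h
  · exact (congrArg (ancillaBlock 1 1) hU0).trans (ancillaBlock_one_self 1)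
  · exact (congrArg (ancillaBlock 0 1) hU0).trans (ancillaBlock_one_of_ne (by decide))
  · rw [add_comm]
    exact kraus_of_conjTranspose_mul_self (conjTranspose_timeOrderedExp_mul_self hc (hb ω)
      (isHermitian_totalHamiltonian hH) (-T) t) 1

end Step

/-! ### Spectral filtering above the gap -/

section Spectral

open scoped Matrix.Norms.L2Operator
open Matrix Filter Topology MeasureTheory

variable {d : ℕ} {H P : Matrix (Fin d) (Fin d) ℂ} {ψ : Fin d → ℂ} {E₀ Δ : ℝ}

theorem freeEvolution_eq_conj_diagonal (hH : H.IsHermitian) (t : ℝ) :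
    freeEvolution H t = (hH.eigenvectorUnitary : Matrix (Fin d) (Fin d) ℂ) *
      diagonal (fun i => Complex.exp (Complex.I * hH.eigenvalues i * t)) *
      (hH.eigenvectorUnitary : Matrix (Fin d) (Fin d) ℂ)ᴴ := by
  set U := (hH.eigenvectorUnitary : Matrix (Fin d) (Fin d) ℂ) with hU
  have hUU : U * Uᴴ = 1 := Unitary.coe_mul_star_self hH.eigenvectorUnitary
  have hUi : U⁻¹ = Uᴴ := inv_eq_right_inv hUU
  have hUu : IsUnit U := IsUnit.of_mul_eq_one _ hUU
  have h : (Complex.I * (t : ℂ)) • H =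
      U * diagonal (fun i => Complex.I * hH.eigenvalues i * t) * U⁻¹ := by
    conv_lhs => rw [isHermitian_eq_conj_diagonal hH, ← hU]
    rw [hUi, ← Matrix.smul_mul, ← Matrix.mul_smul, ← diagonal_smul]
    congr 3
    ext i
    simp only [Pi.smul_apply, smul_eq_mul]
    ring
  rw [freeEvolution, h, Matrix.exp_conj _ _ hUu, Matrix.exp_diagonal, hUi]
  congr 3
  ext i
  rw [Pi.coe_exp, Complex.exp_eq_exp_ℂ]

theorem ketbra_mulVec (v : Fin d → ℂ) : ketbra ψ *ᵥ v = (star ψ ⬝ᵥ v) • ψ := by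
  ext i
  simp only [ketbra, mulVec, dotProduct, vecMulVec_apply, Pi.smul_apply, smul_eq_mul,
    Finset.sum_mul]
  exact Finset.sum_congr rfl fun j _ => by ring

theorem mul_ketbra_of_eigen (h : H *ᵥ ψ = (E₀ : ℂ) • ψ) :
    H * ketbra ψ = (E₀ : ℂ) • ketbra ψ := by
  rw [ketbra, mul_vecMulVec, h, smul_vecMulVec]

/-- Every vector of an eigenbasis is either the ground state up to a phase, or it is orthogonal to
the ground state and its energy lies above the gap. -/
theorem ketbra_mulVec_eigenvector (hH : H.IsHermitian) (hΔ : 0 < Δ) (hψ : star ψ ⬝ᵥ ψ = 1)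
    (hE : H *ᵥ ψ = (E₀ : ℂ) • ψ)
    (hgap : ∀ (E : ℝ) (φ : Fin d → ℂ), φ ≠ 0 → star ψ ⬝ᵥ φ = 0 → H *ᵥ φ = (E : ℂ) • φ →
      E₀ + Δ ≤ E) {v : Fin d → ℂ} {E : ℝ} (hv0 : v ≠ 0) (hv : H *ᵥ v = (E : ℂ) • v) :
    ketbra ψ *ᵥ v = v ∨ (ketbra ψ *ᵥ v = 0 ∧ E₀ + Δ ≤ E) := by
  by_cases hEE : E = E₀
  · left
    subst hEE
    by_contra hne
    -- If `v` were not proportional to `ψ`, its component orthogonal to `ψ` would be an eigenvector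
    -- with energy `E₀`, contradicting the gap.
    have h0 : v - (star ψ ⬝ᵥ v) • ψ ≠ 0 := fun h => hne (by
      rw [ketbra_mulVec]; exact (sub_eq_zero.1 h).symm)
    have h1 := hgap E _ h0 (by rw [dotProduct_sub, dotProduct_smul, hψ]; simp)
      (by rw [mulVec_sub, mulVec_smul, hv, hE, smul_sub, smul_comm])
    linarith
  · right
    have h1 : star ψ ⬝ᵥ (H *ᵥ v) = star (H *ᵥ ψ) ⬝ᵥ v := by
      rw [star_mulVec, hH.eq, dotProduct_mulVec]
    rw [hv, hE, star_smul, dotProduct_smul, smul_dotProduct, Complex.star_def, Complex.conj_ofReal,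
      smul_eq_mul, smul_eq_mul, ← sub_eq_zero, ← sub_mul] at h1
    have h2 : star ψ ⬝ᵥ v = 0 := by
      refine (mul_eq_zero.1 h1).resolve_left (sub_ne_zero.2 ?_)
      exact_mod_cast hEE
    exact ⟨by rw [ketbra_mulVec, h2, zero_smul], hgap E v hv0 h2 hv⟩

theorem mulVec_eigenvectorBasis_complex (hH : H.IsHermitian) (i : Fin d) :
    H *ᵥ (hH.eigenvectorBasis i).ofLp = (hH.eigenvalues i : ℂ) • (hH.eigenvectorBasis i).ofLp := by
  rw [hH.mulVec_eigenvectorBasis]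
  ext j
  simp

theorem eigenvectorBasis_ofLp_ne_zero (hH : H.IsHermitian) (i : Fin d) :
    (hH.eigenvectorBasis i).ofLp ≠ 0 := fun h =>
  hH.eigenvectorBasis.orthonormal.ne_zero i (by ext j; exact congrFun h j)

/-- Gaussian-type spectral filtering of operators whose range is orthogonal to the ground state. -/
theorem norm_integral_freeEvolution_mul_le (hH : H.IsHermitian) (hΔ : 0 < Δ)
    (hψ : star ψ ⬝ᵥ ψ = 1) (hE : H *ᵥ ψ = (E₀ : ℂ) • ψ)
    (hgap : ∀ (E : ℝ) (φ : Fin d → ℂ), φ ≠ 0 → star ψ ⬝ᵥ φ = 0 → H *ᵥ φ = (E : ℂ) • φ →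
      E₀ + Δ ≤ E) {w : ℝ → ℂ} (hw : Integrable w) {κ : ℝ}
    (hκ : ∀ x : ℝ, Δ ≤ x → ‖∫ s : ℝ, w s * Complex.exp (Complex.I * x * s)‖ ≤ κ)
    {Q : Matrix (Fin d) (Fin d) ℂ} (hQ : ketbra ψ * Q = 0) :
    ‖∫ s : ℝ, (w s * Complex.exp (Complex.I * (-E₀ : ℝ) * s)) • (freeEvolution H s * Q)‖ ≤
      κ * ‖Q‖ := by
  set U := (hH.eigenvectorUnitary : Matrix (Fin d) (Fin d) ℂ) with hU
  set l := hH.eigenvalues with hl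
  have hκ0 : 0 ≤ κ := (norm_nonneg _).trans (hκ Δ le_rfl)
  -- `χ` marks the eigenvectors orthogonal to `ψ`; nondegeneracy makes the projection diagonal in
  -- any eigenbasis of `H`.
  obtain ⟨χ, hχ, hPU⟩ : ∃ χ : Fin d → ℂ, (∀ i, χ i = 0 ∨ (χ i = 1 ∧ E₀ + Δ ≤ l i)) ∧
      ketbra ψ * U = U * diagonal (fun i => 1 - χ i) := by
    have h := fun i => ketbra_mulVec_eigenvector hH hΔ hψ hE hgap
      (eigenvectorBasis_ofLp_ne_zero hH i) (mulVec_eigenvectorBasis_complex hH i)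
    refine ⟨fun i => if ketbra ψ *ᵥ (hH.eigenvectorBasis i).ofLp = (hH.eigenvectorBasis i).ofLp
      then 0 else 1, fun i => ?_, ?_⟩
    · dsimp only
      split_ifs with h0
      · exact Or.inl rfl
      · exact Or.inr ⟨rfl, ((h i).resolve_left h0).2⟩
    · ext k i
      have hcol : (ketbra ψ * U) k i = (ketbra ψ *ᵥ (hH.eigenvectorBasis i).ofLp) k := by
        rw [Matrix.mul_apply, mulVec, dotProduct]
        rfl
      rw [hcol, mul_diagonal]
      dsimp only
      split_ifs with h0
      · rw [h0, sub_zero, mul_one]; rfl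
      · rw [((h i).resolve_left h0).1, sub_self, mul_zero]; rfl
  -- The columns of `Q` are orthogonal to `ψ`, so the cut-off `χ` can be inserted at no cost.
  have hUQ : Uᴴ * Q = diagonal χ * (Uᴴ * Q) := by
    have h1 : Uᴴ * ketbra ψ = diagonal (fun i => 1 - χ i) * Uᴴ := by
      have h := congrArg conjTranspose hPU
      rw [conjTranspose_mul, conjTranspose_ketbra, conjTranspose_mul, diagonal_conjTranspose] at h
      rw [h]
      congr 2
      ext i
      rcases hχ i with h0 | ⟨h0, -⟩ <;> simp [h0]
    have h2 : diagonal (fun i => 1 - χ i) * (Uᴴ * Q) = 0 := by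
      rw [← Matrix.mul_assoc, ← h1, Matrix.mul_assoc, hQ, Matrix.mul_zero]
    have h3 : (1 : Matrix (Fin d) (Fin d) ℂ) = diagonal (fun i => 1 - χ i) + diagonal χ := by
      rw [diagonal_add, ← diagonal_one]; congr 1; ext i; simp
    calc Uᴴ * Q = (diagonal (fun i => 1 - χ i) + diagonal χ) * (Uᴴ * Q) := by
          rw [← h3, Matrix.one_mul]
      _ = _ := by rw [Matrix.add_mul, h2, zero_add]
  set v : ℝ → Fin d → ℂ := fun s i => w s * Complex.exp (Complex.I * ((l i - E₀ : ℝ) : ℂ) * s) * χ i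
    with hv
  have hint : ∀ s : ℝ, (w s * Complex.exp (Complex.I * (-E₀ : ℝ) * s)) • (freeEvolution H s * Q) =
      U * diagonal (v s) * (Uᴴ * Q) := fun s => by
    rw [freeEvolution_eq_conj_diagonal hH, ← hU, Matrix.mul_assoc _ Uᴴ, hUQ, Matrix.mul_assoc U,
      ← Matrix.mul_assoc (diagonal _) (diagonal χ), diagonal_mul_diagonal, ← Matrix.mul_smul,
      ← Matrix.smul_mul, ← diagonal_smul, Matrix.mul_assoc U, ← Matrix.mul_assoc (diagonal (v s)),
      diagonal_mul_diagonal]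
    congr 3
    ext i
    simp only [hv, Pi.smul_apply, smul_eq_mul]
    have hχχ : χ i * χ i = χ i := by rcases hχ i with h0 | ⟨h0, -⟩ <;> simp [h0]
    rw [mul_assoc (_ * _) (χ i), hχχ, Complex.ofReal_sub, mul_sub, sub_mul, Complex.exp_sub,
      Complex.ofReal_neg, show Complex.I * -(E₀ : ℂ) * s = -(Complex.I * E₀ * s) by ring,
      Complex.exp_neg]
    ring
  have hvi : ∀ i, Integrable fun s => v s i := fun i => by
    refine Integrable.mul_const ?_ _
    refine hw.mul_bdd (c := 1) ?_ (Eventually.of_forall fun s => (norm_exp_I_mul _ _).le)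
    exact (by fun_prop : Continuous fun s : ℝ =>
      Complex.exp (Complex.I * ((l i - E₀ : ℝ) : ℂ) * s)).aestronglyMeasurable
  -- In the eigenbasis the time integral acts entrywise on a diagonal, giving Fourier transforms of
  -- `w` at the excitation energies. The norm of a diagonal matrix is the largest entry, so no
  -- dimension factor appears.
  have hI : ∫ s, U * diagonal (v s) * (Uᴴ * Q) =
      U * diagonal (fun i => ∫ s, v s i) * (Uᴴ * Q) := by
    have hterm : ∀ a b i, Integrable fun s => U a i * v s i * (Uᴴ * Q) i b := fun a b i =>
      ((hvi i).const_mul _).mul_const _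
    have happ : ∀ (u : Fin d → ℂ) a b, (U * diagonal u * (Uᴴ * Q)) a b =
        ∑ i, U a i * u i * (Uᴴ * Q) i b := fun u a b => by
      rw [Matrix.mul_apply]
      exact Finset.sum_congr rfl fun i _ => by rw [mul_diagonal]
    have hint' : Integrable fun s => U * diagonal (v s) * (Uᴴ * Q) := by
      have hd : Integrable fun s => diagonal (v s) := by
        have : (fun s => diagonal (v s)) =
            fun s => ∑ i, v s i • diagonal (Pi.single i (1 : ℂ)) := by
          funext s
          ext a b
          simp only [diagonal_apply, Matrix.sum_apply, Matrix.smul_apply, smul_eq_mul]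
          split_ifs with hab
          · simp [Pi.single_apply]
          · simp
        rw [this]
        exact integrable_finsetSum _ fun i _ => (hvi i).smul_const _
      exact (hd.const_mul U).mul_const _
    ext a b
    rw [integral_apply_apply hint', happ]
    simp_rw [happ]
    rw [integral_finsetSum _ fun i _ => hterm a b i]
    refine Finset.sum_congr rfl fun i _ => ?_
    rw [integral_mul_const, integral_const_mul]
  rw [integral_congr_ae (Eventually.of_forall hint), hI, ← Matrix.mul_assoc]
  refine (norm_mul_le _ _).trans (mul_le_mul_of_nonneg_right ?_ (norm_nonneg _))
  refine (norm_unitaryConj_le hH.eigenvectorUnitary _).trans ?_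
  rw [l2_opNorm_diagonal, pi_norm_le_iff_of_nonneg hκ0]
  intro i
  rcases hχ i with h0 | ⟨h0, h1⟩
  · simp [hv, h0, hκ0]
  · simp only [hv, h0, mul_one]
    exact hκ (l i - E₀) (by linarith)

/-- The gap is at most twice the norm of the Hamiltonian, except in dimension one. -/
theorem gap_le_two_mul_norm (hH : H.IsHermitian) (hΔ : 0 < Δ) (hg : IsGappedGroundState H ψ Δ)
    (hd : d ≠ 1) : Δ ≤ 2 * ‖H‖ := by
  obtain ⟨hψ, E₀, hE, hgap⟩ := hg
  have hev : ∀ {E : ℝ} {v : Fin d → ℂ}, v ≠ 0 → H *ᵥ v = (E : ℂ) • v → |E| ≤ ‖H‖ := by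
    intro E v hv0 hv
    have h := l2_opNorm_mulVec H (WithLp.toLp 2 v)
    have h2 : WithLp.toLp 2 (H *ᵥ v) = (E : ℂ) • WithLp.toLp 2 v := by rw [hv]; rfl
    have h3 : ‖(E : ℂ) • WithLp.toLp 2 v‖ ≤ ‖H‖ * ‖WithLp.toLp 2 v‖ := by
      rw [← h2]; exact h
    rw [norm_smul, Complex.norm_real, Real.norm_eq_abs] at h3
    refine le_of_mul_le_mul_right h3 (norm_pos_iff.2 fun h0 => hv0 ?_)
    simpa using congrArg WithLp.ofLp h0
  have hψ0 : ψ ≠ 0 := fun h => by simp [h] at hψ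
  have hd2 : ∃ i j : Fin d, i ≠ j := by
    rcases Nat.lt_or_gt_of_ne hd with h | h
    · have : d = 0 := by omega
      subst this
      exact (hψ0 (Subsingleton.elim _ _)).elim
    · exact ⟨⟨0, by omega⟩, ⟨1, by omega⟩, by simp⟩
  obtain ⟨i, j, hij⟩ := hd2
  have h := fun i => ketbra_mulVec_eigenvector hH hΔ hψ hE hgap
    (eigenvectorBasis_ofLp_ne_zero hH i) (mulVec_eigenvectorBasis_complex hH i)
  have hex : ∃ k, E₀ + Δ ≤ hH.eigenvalues k := by
    by_contra hcon
    push Not at hcon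
    -- Without an excited level, two distinct vectors of the orthonormal basis would both lie on the
    -- line of `ψ`.
    have hk : ∀ k, ketbra ψ *ᵥ (hH.eigenvectorBasis k).ofLp = (hH.eigenvectorBasis k).ofLp :=
      fun k => (h k).resolve_right fun hk => absurd hk.2 (hcon k).not_ge
    have horth : (inner ℂ (hH.eigenvectorBasis i) (hH.eigenvectorBasis j) : ℂ) = 0 :=
      hH.eigenvectorBasis.orthonormal.2 hij
    rw [EuclideanSpace.inner_eq_star_dotProduct, dotProduct_comm] at horth
    have hi := hk i
    have hj := hk j
    have hi0 := eigenvectorBasis_ofLp_ne_zero hH i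
    have hj0 := eigenvectorBasis_ofLp_ne_zero hH j
    rw [ketbra_mulVec] at hi hj
    rw [← hi, ← hj, star_smul, smul_dotProduct, dotProduct_smul, hψ, smul_eq_mul, smul_eq_mul,
      mul_one, mul_eq_zero, star_eq_zero] at horth
    rcases horth with h0 | h0
    · exact hi0 (by rw [← hi, h0, zero_smul])
    · exact hj0 (by rw [← hj, h0, zero_smul])
  obtain ⟨k, hk⟩ := hex
  have h1 := abs_le.1 (hev (eigenvectorBasis_ofLp_ne_zero hH k) (mulVec_eigenvectorBasis_complex hH k))
  have h2 := abs_le.1 (hev hψ0 hE)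
  linarith [h1.2, h2.1]

end Spectral

/-! ### Ground state blocks of the jump operator; dissipator and commutator -/

section Defect

open scoped Matrix.Norms.L2Operator
open Matrix Filter Topology MeasureTheory

variable {d : ℕ} {H B : Matrix (Fin d) (Fin d) ℂ} {ψ : Fin d → ℂ} {E₀ Δ σ ν : ℝ}

theorem one_sub_mul_freeEvolution (hH : H.IsHermitian) (hE : H *ᵥ ψ = (E₀ : ℂ) • ψ) (t : ℝ) :
    (1 - ketbra ψ) * freeEvolution H t = freeEvolution H t * (1 - ketbra ψ) := by
  rw [Matrix.sub_mul, Matrix.mul_sub, freeEvolution_mul_of_eigen (mul_ketbra_of_eigen hE),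
    mul_freeEvolution_of_eigen hH conjTranspose_ketbra (mul_ketbra_of_eigen hE), Matrix.one_mul,
    Matrix.mul_one]

/-- Off-diagonal part of a time-evolved operator with respect to the ground state. -/
theorem offDiagonal_conj (hH : H.IsHermitian) (hE : H *ᵥ ψ = (E₀ : ℂ) • ψ)
    (C : Matrix (Fin d) (Fin d) ℂ) (t : ℝ) :
    (1 - ketbra ψ) * (freeEvolution H t * C * freeEvolution H (-t)) * ketbra ψ =
      Complex.exp (Complex.I * (-E₀ : ℝ) * t) •
        (freeEvolution H t * ((1 - ketbra ψ) * C * ketbra ψ)) := by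
  calc _ = (1 - ketbra ψ) * freeEvolution H t * C * (freeEvolution H (-t) * ketbra ψ) := by
        simp only [Matrix.mul_assoc]
    _ = _ := by
        rw [one_sub_mul_freeEvolution hH hE, freeEvolution_mul_of_eigen (mul_ketbra_of_eigen hE),
          Matrix.mul_smul]
        congr 1
        · congr 1; push_cast; ring
        · simp only [Matrix.mul_assoc]

theorem ketbra_mul_offDiagonal (hψ : star ψ ⬝ᵥ ψ = 1) (C : Matrix (Fin d) (Fin d) ℂ) :
    ketbra ψ * ((1 - ketbra ψ) * C * ketbra ψ) = 0 := by
  rw [← Matrix.mul_assoc, ← Matrix.mul_assoc, Matrix.mul_sub, Matrix.mul_one, ketbra_mul_self hψ]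
  simp

theorem norm_offDiagonal_le (hψ : star ψ ⬝ᵥ ψ = 1) (C : Matrix (Fin d) (Fin d) ℂ) :
    ‖(1 - ketbra ψ) * C * ketbra ψ‖ ≤ ‖C‖ := by
  calc _ ≤ ‖1 - ketbra ψ‖ * ‖C‖ * ‖ketbra ψ‖ :=
        (norm_mul_le _ _).trans (by gcongr; exact norm_mul_le _ _)
    _ ≤ 1 * ‖C‖ * 1 := by
        gcongr
        · exact norm_one_sub_ketbra_le hψ
        · exact norm_ketbra_le hψ
    _ = _ := by ring

theorem norm_diagonal_le (hψ : star ψ ⬝ᵥ ψ = 1) (C : Matrix (Fin d) (Fin d) ℂ) :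
    ‖ketbra ψ * C * ketbra ψ‖ ≤ ‖C‖ := by
  calc _ ≤ ‖ketbra ψ‖ * ‖C‖ * ‖ketbra ψ‖ :=
        (norm_mul_le _ _).trans (by gcongr; exact norm_mul_le _ _)
    _ ≤ 1 * ‖C‖ * 1 := by gcongr <;> exact norm_ketbra_le hψ
    _ = _ := by ring

theorem mul_integral_mul {X : Type*} [MeasurableSpace X] {μ : Measure X}
    {F : X → Matrix (Fin d) (Fin d) ℂ} (hF : Integrable F μ) (M N : Matrix (Fin d) (Fin d) ℂ) :
    M * (∫ x, F x ∂μ) * N = ∫ x, M * F x * N ∂μ := by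
  have h := (ContinuousLinearMap.mulLeftRight ℝ (Matrix (Fin d) (Fin d) ℂ) M N).integral_comp_comm hF
  simpa using h.symm

/-- This makes the excitation amplitudes of `V†` another instance of the estimate for `V`, with the
frequency reversed. -/
theorem conjTranspose_jumpOperator (hH : H.IsHermitian) (hσ : 0 < σ) :
    (jumpOperator H B σ ν)ᴴ = jumpOperator H Bᴴ σ (-ν) := by
  rw [jumpOperator_eq_integral hH hσ, jumpOperator_eq_integral hH hσ, ← integral_conjTranspose]
  refine integral_congr_ae (Eventually.of_forall fun t => ?_)
  simp only
  rw [conjTranspose_filteredOperator hH, filteredOperator]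
  simp

/-- The amplitude from the ground state to excitation energy `x` is the Fourier transform of the
filter at `x - ν`. The bound `κ` is left open because it is needed for both signs of the frequency,
only one of which is off resonance. -/
theorem norm_offDiagonal_jumpOperator_le (hH : H.IsHermitian) (hσ : 0 < σ) (hΔ : 0 < Δ)
    (hψ : star ψ ⬝ᵥ ψ = 1) (hE : H *ᵥ ψ = (E₀ : ℂ) • ψ)
    (hgap : ∀ (E : ℝ) (φ : Fin d → ℂ), φ ≠ 0 → star ψ ⬝ᵥ φ = 0 → H *ᵥ φ = (E : ℂ) • φ →
      E₀ + Δ ≤ E) {κ : ℝ}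
    (hκ : ∀ x : ℝ, Δ ≤ x → filterMass σ * Real.exp (-(σ ^ 2 * (x - ν) ^ 2)) ≤ κ) :
    ‖(1 - ketbra ψ) * jumpOperator H B σ ν * ketbra ψ‖ ≤ κ * ‖B‖ := by
  rw [jumpOperator_eq_integral hH hσ, mul_integral_mul (integrable_filteredOperator hH hσ)]
  have h1 : ∀ t, (1 - ketbra ψ) * filteredOperator H B σ ν t * ketbra ψ =
      (((gaussianFilter σ t : ℂ) * Complex.exp (-Complex.I * ν * t)) *
        Complex.exp (Complex.I * (-E₀ : ℝ) * t)) •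
        (freeEvolution H t * ((1 - ketbra ψ) * B * ketbra ψ)) := fun t => by
    rw [filteredOperator, Matrix.mul_smul, Matrix.smul_mul, heisenberg_eq,
      offDiagonal_conj hH hE, smul_smul]
  rw [integral_congr_ae (Eventually.of_forall h1)]
  have hκ0 : 0 ≤ κ := (mul_nonneg (filterMass_nonneg hσ) (Real.exp_nonneg _)).trans (hκ Δ le_rfl)
  have hw : Integrable fun t : ℝ => (gaussianFilter σ t : ℂ) * Complex.exp (-Complex.I * ν * t) := by
    refine (integrable_gaussianFilter hσ).ofReal.mul_bdd (c := 1) ?_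
      (Eventually.of_forall fun t => (norm_exp_neg_I_mul ν t).le)
    exact (by fun_prop : Continuous fun t : ℝ =>
      Complex.exp (-Complex.I * ν * t)).aestronglyMeasurable
  refine (norm_integral_freeEvolution_mul_le hH hΔ hψ hE hgap hw (κ := κ) (fun x hx => ?_)
    (ketbra_mul_offDiagonal hψ B)).trans (by gcongr; exact norm_offDiagonal_le hψ B)
  refine le_trans (le_of_eq ?_) (hκ x hx)
  rw [← norm_fourier_gaussianFilter hσ]
  congr 1
  refine integral_congr_ae (Eventually.of_forall fun t => ?_)
  simp only
  rw [mul_assoc, ← Complex.exp_add]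
  congr 2
  push_cast
  ring

/-- The ground state expectation has Bohr frequency zero, so only the filter's transform at `ν`
remains. -/
theorem norm_diagonal_jumpOperator_le (hH : H.IsHermitian) (hσ : 0 < σ)
    (hψ : star ψ ⬝ᵥ ψ = 1) (hE : H *ᵥ ψ = (E₀ : ℂ) • ψ) :
    ‖ketbra ψ * jumpOperator H B σ ν * ketbra ψ‖ ≤
      filterMass σ * Real.exp (-(σ ^ 2 * ν ^ 2)) * ‖B‖ := by
  rw [jumpOperator_eq_integral hH hσ, mul_integral_mul (integrable_filteredOperator hH hσ)]
  have h1 : ∀ t, ketbra ψ * filteredOperator H B σ ν t * ketbra ψ =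
      ((gaussianFilter σ t : ℂ) * Complex.exp (Complex.I * (-ν : ℝ) * t)) •
        (ketbra ψ * B * ketbra ψ) := fun t => by
    rw [filteredOperator, Matrix.mul_smul, Matrix.smul_mul, heisenberg_eq]
    have h2 : ketbra ψ * (freeEvolution H t * B * freeEvolution H (-t)) * ketbra ψ =
        ketbra ψ * B * ketbra ψ := by
      calc _ = (ketbra ψ * freeEvolution H t) * B * (freeEvolution H (-t) * ketbra ψ) := by
            simp only [Matrix.mul_assoc]
        _ = _ := by
            rw [mul_freeEvolution_of_eigen hH conjTranspose_ketbra (mul_ketbra_of_eigen hE),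
              freeEvolution_mul_of_eigen (mul_ketbra_of_eigen hE), Matrix.smul_mul,
              Matrix.smul_mul, Matrix.mul_smul, smul_smul, ← Complex.exp_add]
            simp
    rw [h2]
    congr 3
    push_cast
    ring
  rw [integral_congr_ae (Eventually.of_forall h1), integral_smul_const, norm_smul,
    norm_fourier_gaussianFilter hσ, neg_sq]
  refine mul_le_mul_of_nonneg_left ?_ (mul_nonneg (filterMass_nonneg hσ) (Real.exp_nonneg _))
  exact norm_diagonal_le hψ B

theorem norm_jumpOperator_le (hH : H.IsHermitian) (hσ : 0 < σ) :
    ‖jumpOperator H B σ ν‖ ≤ filterMass σ * ‖B‖ := by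
  rw [jumpOperator_eq_integral hH hσ, filterMass, ← integral_mul_const]
  exact norm_integral_le_of_norm_le ((integrable_gaussianFilter hσ).mul_const _)
    (Eventually.of_forall (norm_filteredOperator_le hH hσ))

/-- Expansion of the dissipator on a projection `P` in terms of the blocks `p = P V P`,
`R = (1 - P) V P` and `R' = (1 - P) V† P`. -/
theorem dissipator_eq_of_blocks {P V R R' p : Matrix (Fin d) (Fin d) ℂ} (hPP : P * P = P)
    (hPh : Pᴴ = P) (e1 : V * P = p + R) (e2 : Vᴴ * P = pᴴ + R') (hPp : P * p = p)
    (hpp : p * pᴴ = pᴴ * p) :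
    dissipator V P = R * pᴴ + p * Rᴴ + R * Rᴴ +
      -((1 / 2 : ℂ) • (R' * p + Vᴴ * R + pᴴ * R'ᴴ + Rᴴ * V)) := by
  have e1' : P * Vᴴ = pᴴ + Rᴴ := by
    rw [← conjTranspose_add, ← e1, conjTranspose_mul, hPh]
  have f1 : V * P * Vᴴ = p * pᴴ + R * pᴴ + p * Rᴴ + R * Rᴴ := by
    calc _ = (V * P) * (P * Vᴴ) := by
          rw [← Matrix.mul_assoc (V * P), Matrix.mul_assoc V P P, hPP]
      _ = _ := by rw [e1, e1', Matrix.add_mul, Matrix.mul_add, Matrix.mul_add]; abel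
  have f2 : Vᴴ * V * P = pᴴ * p + R' * p + Vᴴ * R := by
    calc _ = Vᴴ * (P * p) + Vᴴ * R := by
          rw [hPp, ← Matrix.mul_add, ← e1, Matrix.mul_assoc]
      _ = _ := by rw [← Matrix.mul_assoc, e2, Matrix.add_mul]
  have f3 : P * (Vᴴ * V) = pᴴ * p + pᴴ * R'ᴴ + Rᴴ * V := by
    have h := congrArg conjTranspose f2
    rwa [conjTranspose_mul, conjTranspose_mul, conjTranspose_add, conjTranspose_add,
      conjTranspose_mul, conjTranspose_mul, conjTranspose_mul, conjTranspose_conjTranspose,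
      conjTranspose_conjTranspose, hPh] at h
  rw [dissipator, f1, f2, f3, hpp]
  module

/-- The dissipator on a pure state in terms of the off-diagonal parts of the jump operator. -/
theorem traceNorm_dissipator_ketbra_le (hψ : star ψ ⬝ᵥ ψ = 1) (V : Matrix (Fin d) (Fin d) ℂ) :
    traceNorm (dissipator V (ketbra ψ)) ≤
      4 * ‖V‖ * ‖(1 - ketbra ψ) * V * ketbra ψ‖ +
        ‖ketbra ψ * V * ketbra ψ‖ * ‖(1 - ketbra ψ) * Vᴴ * ketbra ψ‖ := by
  have hPP : ketbra ψ * ketbra ψ = ketbra ψ := ketbra_mul_self hψ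
  have hPh : (ketbra ψ)ᴴ = ketbra ψ := conjTranspose_ketbra
  have tR := traceNorm_mul_ketbra_le hψ ((1 - ketbra ψ) * V)
  have tR' := traceNorm_mul_ketbra_le hψ ((1 - ketbra ψ) * Vᴴ)
  have hRV := norm_offDiagonal_le hψ V
  have hpV := norm_diagonal_le hψ V
  -- The diagonal block is a scalar multiple of the projection, hence normal; the purely diagonal
  -- contributions to the dissipator cancel.
  have hpp : (ketbra ψ * V * ketbra ψ) * (ketbra ψ * V * ketbra ψ)ᴴ =
      (ketbra ψ * V * ketbra ψ)ᴴ * (ketbra ψ * V * ketbra ψ) := by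
    rw [ketbra_mul_mul_ketbra, conjTranspose_smul, Matrix.smul_mul, Matrix.mul_smul,
      Matrix.smul_mul, Matrix.mul_smul, smul_comm, conjTranspose_ketbra]
  have e1 : V * ketbra ψ = ketbra ψ * V * ketbra ψ + (1 - ketbra ψ) * V * ketbra ψ := by
    rw [← Matrix.add_mul, ← Matrix.add_mul, add_sub_cancel, Matrix.one_mul]
  have e2 : Vᴴ * ketbra ψ = (ketbra ψ * V * ketbra ψ)ᴴ + (1 - ketbra ψ) * Vᴴ * ketbra ψ := by
    rw [conjTranspose_mul, conjTranspose_mul, hPh, ← Matrix.mul_assoc, ← Matrix.add_mul,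
      ← Matrix.add_mul, add_sub_cancel, Matrix.one_mul]
  have hPp : ketbra ψ * (ketbra ψ * V * ketbra ψ) = ketbra ψ * V * ketbra ψ := by
    rw [← Matrix.mul_assoc, ← Matrix.mul_assoc, hPP]
  rw [dissipator_eq_of_blocks hPP hPh e1 e2 hPp hpp]
  generalize (1 - ketbra ψ) * V * ketbra ψ = R at *
  generalize (1 - ketbra ψ) * Vᴴ * ketbra ψ = R' at *
  generalize ketbra ψ * V * ketbra ψ = p at *
  have tRh : traceNorm Rᴴ ≤ ‖R‖ := by rwa [traceNorm_conjTranspose]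
  have tRh' : traceNorm R'ᴴ ≤ ‖R'‖ := by rwa [traceNorm_conjTranspose]
  have nR := traceNorm_nonneg R
  have g1 : traceNorm (R * pᴴ) ≤ ‖V‖ * ‖R‖ := by
    refine (traceNorm_mul_right_le _ _).trans ?_
    rw [l2_opNorm_conjTranspose]
    exact mul_le_mul hpV tR nR (norm_nonneg V)
  have g2 : traceNorm (p * Rᴴ) ≤ ‖V‖ * ‖R‖ :=
    (traceNorm_mul_left_le _ _).trans (mul_le_mul hpV tRh (traceNorm_nonneg _) (norm_nonneg V))
  have g3 : traceNorm (R * Rᴴ) ≤ ‖V‖ * ‖R‖ :=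
    (traceNorm_mul_left_le _ _).trans (mul_le_mul hRV tRh (traceNorm_nonneg _) (norm_nonneg V))
  -- `R'` need not be small, so the factor `p` beside it is kept instead of being bounded by `‖V‖`.
  have g4 : traceNorm (R' * p) ≤ ‖p‖ * ‖R'‖ :=
    (traceNorm_mul_right_le _ _).trans (mul_le_mul_of_nonneg_left tR' (norm_nonneg p))
  have g5 : traceNorm (Vᴴ * R) ≤ ‖V‖ * ‖R‖ := by
    refine (traceNorm_mul_left_le _ _).trans ?_
    rw [l2_opNorm_conjTranspose]
    exact mul_le_mul_of_nonneg_left tR (norm_nonneg V)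
  have g6 : traceNorm (pᴴ * R'ᴴ) ≤ ‖p‖ * ‖R'‖ := by
    refine (traceNorm_mul_left_le _ _).trans ?_
    rw [l2_opNorm_conjTranspose]
    exact mul_le_mul_of_nonneg_left tRh' (norm_nonneg p)
  have g7 : traceNorm (Rᴴ * V) ≤ ‖V‖ * ‖R‖ :=
    (traceNorm_mul_right_le _ _).trans (mul_le_mul_of_nonneg_left tRh (norm_nonneg V))
  have g8 := traceNorm_smul_le (1 / 2 : ℂ) (R' * p + Vᴴ * R + pᴴ * R'ᴴ + Rᴴ * V)
  rw [show ‖(1 / 2 : ℂ)‖ = 1 / 2 by norm_num] at g8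
  have c1 := traceNorm_add_le (R * pᴴ + p * Rᴴ + R * Rᴴ)
    (-((1 / 2 : ℂ) • (R' * p + Vᴴ * R + pᴴ * R'ᴴ + Rᴴ * V)))
  have c2 := traceNorm_add_le (R * pᴴ + p * Rᴴ) (R * Rᴴ)
  have c3 := traceNorm_add_le (R * pᴴ) (p * Rᴴ)
  have c4 := traceNorm_add_le (R' * p + Vᴴ * R + pᴴ * R'ᴴ) (Rᴴ * V)
  have c5 := traceNorm_add_le (R' * p + Vᴴ * R) (pᴴ * R'ᴴ)
  have c6 := traceNorm_add_le (R' * p) (Vᴴ * R)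
  rw [traceNorm_neg] at c1
  linarith

/-- The diagonal blocks of `G` commute with the projection, so only the two rank-one off-diagonal
blocks remain. -/
theorem traceNorm_commutator_ketbra_le (hψ : star ψ ⬝ᵥ ψ = 1) (G : Matrix (Fin d) (Fin d) ℂ) :
    traceNorm (commutator (ketbra ψ) G) ≤
      ‖(1 - ketbra ψ) * G * ketbra ψ‖ + ‖(1 - ketbra ψ) * Gᴴ * ketbra ψ‖ := by
  have h : commutator (ketbra ψ) G = ((1 - ketbra ψ) * Gᴴ * ketbra ψ)ᴴ -
      (1 - ketbra ψ) * G * ketbra ψ := by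
    rw [commutator, conjTranspose_mul, conjTranspose_mul, conjTranspose_conjTranspose,
      conjTranspose_sub, conjTranspose_ketbra, conjTranspose_one]
    noncomm_ring
  rw [h]
  refine (traceNorm_sub_le _ _).trans ?_
  rw [traceNorm_conjTranspose, add_comm]
  exact add_le_add (traceNorm_mul_ketbra_le hψ _) (traceNorm_mul_ketbra_le hψ _)

end Defect

/-! ### Off-diagonal bounds for the Lamb shift, and the pointwise defect -/

section LambShift

open scoped Matrix.Norms.L2Operator
open Matrix Filter Topology MeasureTheory

variable {d : ℕ} {H B : Matrix (Fin d) (Fin d) ℂ} {ψ : Fin d → ℂ} {E₀ Δ σ ν : ℝ}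

theorem setIntegral_Iic_eq_setIntegral_Ici {E : Type*} [NormedAddCommGroup E] [NormedSpace ℝ E]
    (g : ℝ → E) (s : ℝ) : ∫ t in Set.Iic s, g t = ∫ u in Set.Ici (0 : ℝ), g (s - u) := by
  rw [← integral_indicator measurableSet_Iic, ← integral_indicator measurableSet_Ici,
    ← integral_sub_left_eq_self _ _ s]
  refine integral_congr_ae (Eventually.of_forall fun u => ?_)
  by_cases hu : 0 ≤ u
  · simp [Set.indicator, hu]
  · simp [Set.indicator, hu]

/-- The domination for the Fubini exchange of time and lag below. -/
theorem integrable_gaussianFilter_mul_prod (hσ : 0 < σ) :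
    Integrable (fun p : ℝ × ℝ => gaussianFilter σ p.2 * gaussianFilter σ (p.2 - p.1))
      ((volume.restrict (Set.Ici (0 : ℝ))).prod volume) := by
  have h := (integrable_gaussianFilter hσ).convolution_integrand (ContinuousLinearMap.mul ℝ ℝ)
    (integrable_gaussianFilter hσ)
  have h2 : Integrable (fun p : ℝ × ℝ => gaussianFilter σ p.2 * gaussianFilter σ (p.2 - p.1))
      (volume.prod volume) := by
    refine h.congr (Eventually.of_forall fun p => ?_)
    simp only [ContinuousLinearMap.mul_apply']
    rw [← neg_sub p.2 p.1, gaussianFilter_neg]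
  refine h2.mono_measure ?_
  rw [show ((volume.restrict (Set.Ici (0 : ℝ))).prod (volume : Measure ℝ)) =
    (volume.prod volume).restrict (Set.Ici (0 : ℝ) ×ˢ Set.univ) by
      rw [← Measure.prod_restrict, Measure.restrict_univ]]
  exact Measure.restrict_le_self

/-- Off-diagonal part, with respect to the ground state, of a time-ordered double integral. -/
theorem norm_offDiagonal_doubleIntegral_le (hH : H.IsHermitian) (hσ : 0 < σ) (hΔ : 0 < Δ)
    (hψ : star ψ ⬝ᵥ ψ = 1) (hE : H *ᵥ ψ = (E₀ : ℂ) • ψ)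
    (hgap : ∀ (E : ℝ) (φ : Fin d → ℂ), φ ≠ 0 → star ψ ⬝ᵥ φ = 0 → H *ᵥ φ = (E : ℂ) • φ →
      E₀ + Δ ≤ E) {C : ℝ → Matrix (Fin d) (Fin d) ℂ} (hC : Continuous C) {β : ℝ}
    (hβ : ∀ u, ‖C u‖ ≤ β) :
    ‖(1 - ketbra ψ) * (∫ s, ∫ u in Set.Ici (0 : ℝ),
        ((gaussianFilter σ s : ℂ) * (gaussianFilter σ (s - u) : ℂ)) •
          (freeEvolution H s * C u * freeEvolution H (-s))) * ketbra ψ‖ ≤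
      filterMass σ ^ 2 / 2 * Real.exp (-(σ ^ 2 * Δ ^ 2 / 2)) * β := by
  set K : ℝ → ℝ → Matrix (Fin d) (Fin d) ℂ := fun u s =>
    ((gaussianFilter σ s : ℂ) * (gaussianFilter σ (s - u) : ℂ)) •
      (freeEvolution H s * C u * freeEvolution H (-s)) with hK
  have hβ0 : 0 ≤ β := (norm_nonneg _).trans (hβ 0)
  have hfc := continuous_gaussianFilter (σ := σ)
  have hKc : Continuous (Function.uncurry K) := by
    have h1 : Continuous fun p : ℝ × ℝ =>
        (gaussianFilter σ p.2 : ℂ) * (gaussianFilter σ (p.2 - p.1) : ℂ) := by fun_prop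
    exact h1.smul (((continuous_freeEvolution.comp continuous_snd).mul
      (hC.comp continuous_fst)).mul (continuous_freeEvolution.comp continuous_snd.neg))
  have hKn : ∀ u s, ‖K u s‖ ≤ gaussianFilter σ s * gaussianFilter σ (s - u) * β := fun u s => by
    have h0 : ‖freeEvolution H s * C u * freeEvolution H (-s)‖ ≤ β := by
      have h := norm_heisenberg_le hH (C u) s
      rw [heisenberg_eq] at h
      exact h.trans (hβ u)
    simp only [hK]
    rw [norm_smul, norm_mul, Complex.norm_real, Complex.norm_real,
      Real.norm_of_nonneg (gaussianFilter_nonneg hσ _),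
      Real.norm_of_nonneg (gaussianFilter_nonneg hσ _)]
    exact mul_le_mul_of_nonneg_left h0
      (mul_nonneg (gaussianFilter_nonneg hσ _) (gaussianFilter_nonneg hσ _))
  have hKi : Integrable (Function.uncurry K) ((volume.restrict (Set.Ici (0 : ℝ))).prod volume) :=
    ((integrable_gaussianFilter_mul_prod hσ).mul_const β).mono' hKc.aestronglyMeasurable
      (Eventually.of_forall fun p => hKn p.1 p.2)
  have hKu : ∀ u, Integrable (K u) := fun u =>
    ((integrable_gaussianFilter hσ).mul_const (gaussianFilter σ 0 * β)).mono'
      (hKc.comp (Continuous.prodMk_right u)).aestronglyMeasurable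
      (Eventually.of_forall fun s => (hKn u s).trans (by
        rw [mul_assoc]
        exact mul_le_mul_of_nonneg_left (mul_le_mul_of_nonneg_right (gaussianFilter_le hσ _) hβ0)
          (gaussianFilter_nonneg hσ s)))
  -- With the lag `u` fixed, the common time `s` is integrated first. The cut-off that defines the
  -- time ordering then involves only `u`, so its sharp edge does not spoil the Gaussian decay in
  -- energy.
  have hswap : ∫ s, ∫ u in Set.Ici (0 : ℝ), K u s = ∫ u in Set.Ici (0 : ℝ), ∫ s, K u s :=
    (integral_integral_swap hKi).symm
  -- The Fourier transform of `f(s) f(s - u)` gives decay in the gap and, separately, in `u`; the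
  -- latter makes the lag integral converge.
  have hinner : ∀ u, ‖(1 - ketbra ψ) * (∫ s, K u s) * ketbra ψ‖ ≤
      Real.exp (-(1 / (8 * σ ^ 2)) * u ^ 2) * (Real.exp (-(σ ^ 2 * Δ ^ 2 / 2)) * β) := fun u => by
    rw [mul_integral_mul (hKu u)]
    have h1 : ∀ s, (1 - ketbra ψ) * K u s * ketbra ψ =
        (((gaussianFilter σ s : ℂ) * (gaussianFilter σ (s - u) : ℂ)) *
          Complex.exp (Complex.I * (-E₀ : ℝ) * s)) •
          (freeEvolution H s * ((1 - ketbra ψ) * C u * ketbra ψ)) := fun s => by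
      simp only [hK]
      rw [Matrix.mul_smul, Matrix.smul_mul, offDiagonal_conj hH hE, smul_smul]
    rw [integral_congr_ae (Eventually.of_forall h1)]
    have hw : Integrable fun s : ℝ => (gaussianFilter σ s : ℂ) * (gaussianFilter σ (s - u) : ℂ) := by
      refine (integrable_gaussianFilter hσ).ofReal.mul_bdd (c := gaussianFilter σ 0) ?_
        (Eventually.of_forall fun t => ?_)
      · exact (by fun_prop : Continuous fun s : ℝ =>
          (gaussianFilter σ (s - u) : ℂ)).aestronglyMeasurable
      · rw [Complex.norm_real, Real.norm_of_nonneg (gaussianFilter_nonneg hσ _)]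
        exact gaussianFilter_le hσ _
    refine (norm_integral_freeEvolution_mul_le hH hΔ hψ hE hgap hw
      (κ := Real.exp (-(1 / (8 * σ ^ 2)) * u ^ 2) * Real.exp (-(σ ^ 2 * Δ ^ 2 / 2)))
      (fun x hx => ?_) (ketbra_mul_offDiagonal hψ (C u))).trans ?_
    · rw [norm_fourier_gaussianFilter_mul hσ]
      refine mul_le_mul_of_nonneg_left (Real.exp_le_exp.2 (neg_le_neg ?_)) (Real.exp_nonneg _)
      have : Δ ^ 2 ≤ x ^ 2 := pow_le_pow_left₀ hΔ.le hx 2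
      have := mul_le_mul_of_nonneg_left this (sq_nonneg σ)
      linarith
    · rw [mul_assoc]
      exact mul_le_mul_of_nonneg_left (mul_le_mul_of_nonneg_left
        ((norm_offDiagonal_le hψ (C u)).trans (hβ u)) (Real.exp_nonneg _)) (Real.exp_nonneg _)
  have hKl : Integrable (fun u => ∫ s, K u s) (volume.restrict (Set.Ici (0 : ℝ))) :=
    hKi.integral_prod_left
  rw [hswap, mul_integral_mul hKl]
  have hgi : Integrable (fun u : ℝ => Real.exp (-(1 / (8 * σ ^ 2)) * u ^ 2) *
      (Real.exp (-(σ ^ 2 * Δ ^ 2 / 2)) * β)) (volume.restrict (Set.Ici (0 : ℝ))) :=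
    ((integrable_exp_neg_mul_sq (by positivity)).mul_const _).integrableOn
  refine (norm_integral_le_of_norm_le hgi (Eventually.of_forall hinner)).trans_eq ?_
  rw [integral_mul_const, integral_Ici_eq_integral_Ioi, setIntegral_Ioi_exp_le hσ, mul_assoc]

theorem continuous_exp_smul_heisenberg (c : ℂ) :
    Continuous fun u : ℝ => Complex.exp (c * u) • heisenberg H B (-u) := by
  have h : Continuous fun u : ℝ => Complex.exp (c * u) := by fun_prop
  exact h.smul ((continuous_heisenberg B).comp continuous_neg)

theorem heisenberg_sub_eq (s u : ℝ) :
    heisenberg H B (s - u) = freeEvolution H s * heisenberg H B (-u) * freeEvolution H (-s) := by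
  rw [heisenberg_eq, heisenberg_eq, sub_eq_add_neg, freeEvolution_add, neg_add, neg_neg,
    add_comm (-s) u, freeEvolution_add]
  simp only [Matrix.mul_assoc]

theorem conj_mul_conj (s : ℝ) (M N : Matrix (Fin d) (Fin d) ℂ) :
    (freeEvolution H s * M * freeEvolution H (-s)) * (freeEvolution H s * N * freeEvolution H (-s)) =
      freeEvolution H s * (M * N) * freeEvolution H (-s) := by
  calc _ = freeEvolution H s * M * (freeEvolution H (-s) * freeEvolution H s) * N *
        freeEvolution H (-s) := by simp only [Matrix.mul_assoc]
    _ = _ := by rw [freeEvolution_neg_mul, Matrix.mul_one]; simp only [Matrix.mul_assoc]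

/-- The frequency enters only through the lag, as a phase that is absorbed into `C u`; hence the
bound holds for every `ν`. -/
theorem norm_offDiagonal_lambShiftOperator_le (hH : H.IsHermitian) (hσ : 0 < σ) (hΔ : 0 < Δ)
    (hψ : star ψ ⬝ᵥ ψ = 1) (hE : H *ᵥ ψ = (E₀ : ℂ) • ψ)
    (hgap : ∀ (E : ℝ) (φ : Fin d → ℂ), φ ≠ 0 → star ψ ⬝ᵥ φ = 0 → H *ᵥ φ = (E : ℂ) • φ →
      E₀ + Δ ≤ E) :
    ‖(1 - ketbra ψ) * lambShiftOperator H B σ ν * ketbra ψ‖ ≤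
      filterMass σ ^ 2 / 2 * Real.exp (-(σ ^ 2 * Δ ^ 2 / 2)) * ‖B‖ ^ 2 := by
  have h := norm_offDiagonal_doubleIntegral_le hH hσ hΔ hψ hE hgap (β := ‖B‖ ^ 2)
    (C := fun u => (Complex.exp (-Complex.I * ν * u) • heisenberg H Bᴴ (-u)) * B)
    ((continuous_exp_smul_heisenberg _).mul continuous_const) (fun u => ?_)
  · convert h using 4
    rw [lambShiftOperator_eq_integral hH hσ]
    refine integral_congr_ae (Eventually.of_forall fun s => ?_)
    simp only
    rw [setIntegral_Iic_eq_setIntegral_Ici]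
    refine integral_congr_ae (Eventually.of_forall fun u => ?_)
    simp only
    rw [conjTranspose_filteredOperator hH, filteredOperator, heisenberg_sub_eq, heisenberg_eq B s,
      Matrix.smul_mul, Matrix.mul_smul, conj_mul_conj, Matrix.smul_mul, Matrix.mul_smul,
      Matrix.smul_mul, smul_smul, smul_smul]
    congr 1
    rw [mul_mul_mul_comm, ← Complex.exp_add, mul_comm (gaussianFilter σ (s - u) : ℂ)]
    congr 2
    push_cast
    ring
  · refine (norm_mul_le _ _).trans ?_
    rw [norm_smul, norm_exp_neg_I_mul, one_mul, sq]
    refine mul_le_mul_of_nonneg_right ((norm_heisenberg_le hH _ _).trans_eq ?_) (norm_nonneg _)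
    exact l2_opNorm_conjTranspose B

theorem norm_offDiagonal_conjTranspose_lambShiftOperator_le (hH : H.IsHermitian) (hσ : 0 < σ)
    (hΔ : 0 < Δ) (hψ : star ψ ⬝ᵥ ψ = 1) (hE : H *ᵥ ψ = (E₀ : ℂ) • ψ)
    (hgap : ∀ (E : ℝ) (φ : Fin d → ℂ), φ ≠ 0 → star ψ ⬝ᵥ φ = 0 → H *ᵥ φ = (E : ℂ) • φ →
      E₀ + Δ ≤ E) :
    ‖(1 - ketbra ψ) * (lambShiftOperator H B σ ν)ᴴ * ketbra ψ‖ ≤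
      filterMass σ ^ 2 / 2 * Real.exp (-(σ ^ 2 * Δ ^ 2 / 2)) * ‖B‖ ^ 2 := by
  have h := norm_offDiagonal_doubleIntegral_le hH hσ hΔ hψ hE hgap (β := ‖B‖ ^ 2)
    (C := fun u => Bᴴ * (Complex.exp (Complex.I * ν * u) • heisenberg H B (-u)))
    (continuous_const.mul (continuous_exp_smul_heisenberg _)) (fun u => ?_)
  · convert h using 4
    rw [conjTranspose_lambShiftOperator hH hσ]
    refine integral_congr_ae (Eventually.of_forall fun s => ?_)
    simp only
    rw [setIntegral_Iic_eq_setIntegral_Ici, ← integral_const_mul_of_integrable]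
    swap
    · exact ((integrable_filteredOperator hH hσ).comp_sub_left s).integrableOn
    refine integral_congr_ae (Eventually.of_forall fun u => ?_)
    simp only
    rw [conjTranspose_filteredOperator hH, filteredOperator, heisenberg_sub_eq, heisenberg_eq Bᴴ s,
      Matrix.smul_mul, Matrix.mul_smul, conj_mul_conj, Matrix.mul_smul, Matrix.mul_smul,
      Matrix.smul_mul, smul_smul, smul_smul]
    congr 1
    rw [mul_mul_mul_comm, ← Complex.exp_add]
    congr 2
    push_cast
    ring
  · refine (norm_mul_le _ _).trans ?_
    rw [norm_smul, norm_exp_I_mul, one_mul, sq, l2_opNorm_conjTranspose]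
    exact mul_le_mul_of_nonneg_left (norm_heisenberg_le hH _ _) (norm_nonneg _)

/-- The defect of a pure ground state at a single nonpositive frequency is Gaussian in the gap. -/
theorem pointwiseDefect_ketbra_le (hH : H.IsHermitian) (hσ : 0 < σ) (hΔ : 0 < Δ)
    (hg : IsGappedGroundState H ψ Δ) (hν : ν ≤ 0) :
    pointwiseDefect H B σ ν (ketbra ψ) ≤
      42 * (σ * Real.exp (-(σ ^ 2 * Δ ^ 2 / 2)) * ‖B‖ ^ 2) := by
  obtain ⟨hψ, E₀, hE, hgap⟩ := hg
  set b := ‖B‖ with hb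
  have hb0 : 0 ≤ b := norm_nonneg B
  set F := filterMass σ with hF
  have hF0 : 0 ≤ F := filterMass_nonneg hσ
  set q := Real.exp (-(σ ^ 2 * Δ ^ 2 / 2)) with hq
  have hq0 : 0 ≤ q := Real.exp_nonneg _
  have g1 := norm_offDiagonal_lambShiftOperator_le (B := B) (ν := ν) hH hσ hΔ hψ hE hgap
  have g2 := norm_offDiagonal_conjTranspose_lambShiftOperator_le (B := B) (ν := ν)
    hH hσ hΔ hψ hE hgap
  have c1 := traceNorm_commutator_ketbra_le hψ (lambShiftOperator H B σ ν)
  have c2 := traceNorm_commutator_ketbra_le hψ (lambShiftOperator H B σ ν)ᴴ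
  rw [conjTranspose_conjTranspose] at c2
  -- The sign `ν ≤ 0` matters here: the jump is detuned by `x - ν ≥ Δ` from every excitation.
  have j1 : ‖(1 - ketbra ψ) * jumpOperator H B σ ν * ketbra ψ‖ ≤ F * q * b := by
    refine norm_offDiagonal_jumpOperator_le hH hσ hΔ hψ hE hgap fun x hx => ?_
    refine mul_le_mul_of_nonneg_left (Real.exp_le_exp.2 (neg_le_neg ?_)) hF0
    have : Δ ^ 2 ≤ (x - ν) ^ 2 := pow_le_pow_left₀ hΔ.le (by linarith) 2
    nlinarith [sq_nonneg σ, sq_nonneg (σ * Δ)]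
  -- The adjoint can be resonant at `x = -ν`, so growth in `ν` is allowed. The estimate rests on `(x
  -- + ν)² + ν² = x²/2 + (x + 2ν)²/2`.
  have j2 : ‖(1 - ketbra ψ) * (jumpOperator H B σ ν)ᴴ * ketbra ψ‖ ≤
      F * (Real.exp (σ ^ 2 * ν ^ 2) * q) * b := by
    rw [conjTranspose_jumpOperator hH hσ, hb, ← l2_opNorm_conjTranspose B]
    refine norm_offDiagonal_jumpOperator_le hH hσ hΔ hψ hE hgap fun x hx => ?_
    rw [hq, ← Real.exp_add]
    refine mul_le_mul_of_nonneg_left (Real.exp_le_exp.2 ?_) hF0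
    have h1 : Δ ^ 2 ≤ x ^ 2 := pow_le_pow_left₀ hΔ.le hx 2
    have h2 : 0 ≤ (x + 2 * ν) ^ 2 := sq_nonneg _
    have h3 : Δ ^ 2 / 2 ≤ (x - -ν) ^ 2 + ν ^ 2 := by nlinarith
    nlinarith [mul_le_mul_of_nonneg_left h3 (sq_nonneg σ)]
  have j3 := norm_diagonal_jumpOperator_le (B := B) (ν := ν) hH hσ hψ hE
  have j4 := norm_jumpOperator_le (B := B) (ν := ν) hH hσ
  have d1 := traceNorm_dissipator_ketbra_le hψ (jumpOperator H B σ ν)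
  have m1 := mul_le_mul j4 j1 (norm_nonneg _) (mul_nonneg hF0 hb0)
  have m2 := mul_le_mul j3 j2 (norm_nonneg _)
    (mul_nonneg (mul_nonneg hF0 (Real.exp_nonneg _)) hb0)
  -- The growth in `ν` is cancelled exactly by the decay of the diagonal element of the jump
  -- operator.
  have m3 : F * Real.exp (-(σ ^ 2 * ν ^ 2)) * b * (F * (Real.exp (σ ^ 2 * ν ^ 2) * q) * b) =
      F ^ 2 * q * b ^ 2 := by
    have : Real.exp (-(σ ^ 2 * ν ^ 2)) * Real.exp (σ ^ 2 * ν ^ 2) = 1 := by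
      rw [← Real.exp_add]; simp
    linear_combination F ^ 2 * q * b ^ 2 * this
  have hFs := mul_le_mul_of_nonneg_right (filterMass_sq_le hσ) (mul_nonneg hq0 (sq_nonneg b))
  rw [pointwiseDefect]
  rw [m3] at m2
  have m4 : F * b * (F * q * b) = F ^ 2 * q * b ^ 2 := by ring
  rw [m4] at m1
  have m5 : F ^ 2 / 2 * q * b ^ 2 = F ^ 2 * q * b ^ 2 / 2 := by ring
  rw [m5] at g1 g2
  -- In units of `F² q b²`, each commutator contributes 1 and the dissipator 4 + 1; with `F² ≤ 6σ`
  -- this gives `7 * 6 = 42`.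
  linarith

end LambShift

/-! ### Continuity of the defect in the frequency -/

section Measurability

open scoped Matrix.Norms.L2Operator
open Matrix Filter Topology MeasureTheory

variable {d : ℕ} {H B : Matrix (Fin d) (Fin d) ℂ} {σ : ℝ}

theorem continuous_filteredOperator_frequency (t : ℝ) :
    Continuous fun ν => filteredOperator H B σ ν t := by
  have h : Continuous fun ν : ℝ =>
      (gaussianFilter σ t : ℂ) * Complex.exp (-Complex.I * ν * t) := by fun_prop
  exact h.smul continuous_const

theorem continuous_setIntegral_filteredOperator (hH : H.IsHermitian) (hσ : 0 < σ) (S : Set ℝ) :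
    Continuous fun ν => ∫ t in S, filteredOperator H B σ ν t :=
  continuous_of_dominated
    (fun _ => continuous_filteredOperator.aestronglyMeasurable)
    (fun _ => Eventually.of_forall (norm_filteredOperator_le hH hσ))
    ((integrable_gaussianFilter hσ).mul_const ‖B‖).integrableOn
    (Eventually.of_forall continuous_filteredOperator_frequency)

theorem continuous_jumpOperator (hH : H.IsHermitian) (hσ : 0 < σ) :
    Continuous fun ν => jumpOperator H B σ ν := by
  simp_rw [jumpOperator_eq_integral hH hσ]
  simpa using continuous_setIntegral_filteredOperator (B := B) hH hσ Set.univ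

theorem continuous_lambShiftOperator (hH : H.IsHermitian) (hσ : 0 < σ) :
    Continuous fun ν => lambShiftOperator H B σ ν := by
  have h : Continuous fun ν => (lambShiftOperator H B σ ν)ᴴ := by
    simp_rw [conjTranspose_lambShiftOperator hH hσ]
    have hf := (integrable_gaussianFilter hσ).mul_const ‖B‖
    have h0 : ∀ t, 0 ≤ gaussianFilter σ t * ‖B‖ := fun t =>
      mul_nonneg (gaussianFilter_nonneg hσ t) (norm_nonneg B)
    refine continuous_of_dominated
      (bound := fun s => gaussianFilter σ s * ‖B‖ * ∫ t, gaussianFilter σ t * ‖B‖)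
      (fun ν => ?_) (fun ν => Eventually.of_forall fun s => ?_) (hf.mul_const _)
      (Eventually.of_forall fun s => ?_)
    · exact (continuous_filteredOperator.star.mul (continuous_integral_Iic
        continuous_filteredOperator (integrable_filteredOperator hH hσ))).aestronglyMeasurable
    · refine (norm_mul_le _ _).trans ?_
      rw [l2_opNorm_conjTranspose]
      exact mul_le_mul (norm_filteredOperator_le hH hσ s)
        ((norm_setIntegral_le hf (norm_filteredOperator_le hH hσ) _).trans
          (setIntegral_le_integral_of_nonneg hf h0 _)) (norm_nonneg _) (h0 s)
    · exact (continuous_filteredOperator_frequency s).star.mul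
        (continuous_setIntegral_filteredOperator hH hσ _)
  have h2 : Continuous fun ν => (lambShiftOperator H B σ ν)ᴴᴴ := h.star
  simpa only [conjTranspose_conjTranspose] using h2

theorem continuous_pointwiseDefect (hH : H.IsHermitian) (hσ : 0 < σ)
    (ρ : Matrix (Fin d) (Fin d) ℂ) : Continuous fun ν => pointwiseDefect H B σ ν ρ := by
  have hG := continuous_lambShiftOperator (B := B) hH hσ
  have hV := continuous_jumpOperator (B := B) hH hσ
  have hGs : Continuous fun ν => (lambShiftOperator H B σ ν)ᴴ := hG.star
  have hVs : Continuous fun ν => (jumpOperator H B σ ν)ᴴ := hV.star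
  have hc : ∀ {G : ℝ → Matrix (Fin d) (Fin d) ℂ}, Continuous G →
      Continuous fun ν => commutator ρ (G ν) := fun h =>
    (continuous_const.mul h).sub (h.mul continuous_const)
  have hS : Continuous fun ν => (jumpOperator H B σ ν)ᴴ * jumpOperator H B σ ν * ρ +
      ρ * ((jumpOperator H B σ ν)ᴴ * jumpOperator H B σ ν) :=
    ((hVs.mul hV).mul continuous_const).add (continuous_const.mul (hVs.mul hV))
  have hS2 : Continuous fun ν => (1 / 2 : ℂ) • ((jumpOperator H B σ ν)ᴴ * jumpOperator H B σ ν * ρ +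
      ρ * ((jumpOperator H B σ ν)ᴴ * jumpOperator H B σ ν)) :=
    hS.const_smul (1 / 2 : ℂ)
  have hD : Continuous fun ν => dissipator (jumpOperator H B σ ν) ρ :=
    ((hV.mul continuous_const).mul hVs).sub hS2
  exact ((continuous_traceNorm.comp (hc hG)).add (continuous_traceNorm.comp (hc hGs))).add
    (continuous_traceNorm.comp hD)

theorem pointwiseDefect_nonneg (ν : ℝ) (ρ : Matrix (Fin d) (Fin d) ℂ) :
    0 ≤ pointwiseDefect H B σ ν ρ :=
  add_nonneg (add_nonneg (traceNorm_nonneg _) (traceNorm_nonneg _)) (traceNorm_nonneg _)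

end Measurability

/-! ### The transition weight and folding of frequencies -/

section Weights

open MeasureTheory Filter

variable {g : ℝ → ℝ}

theorem transitionWeight_eq_indicator :
    transitionWeight g = Set.indicator (Set.Iio 0) (fun ω => g ω + g (-ω)) := by
  funext ω
  simp [transitionWeight, Set.indicator]

theorem transitionWeight_nonneg (hg : IsProbabilityDensity g) (ω : ℝ) :
    0 ≤ transitionWeight g ω := by
  unfold transitionWeight
  split_ifs
  · exact add_nonneg (hg.nonneg _) (hg.nonneg _)
  · exact le_rfl

theorem integrable_transitionWeight (hg : IsProbabilityDensity g) :
    Integrable (transitionWeight g) := by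
  rw [transitionWeight_eq_indicator]
  exact (hg.integrable.add hg.integrable.comp_neg).indicator measurableSet_Iio

/-- Folding the frequencies onto the negative half-line. -/
theorem integral_transitionWeight_mul {D : ℝ → ℝ}
    (h1 : IntegrableOn (fun ω => g ω * D ω) (Set.Iio 0))
    (h2 : IntegrableOn (fun ω => g ω * D (-ω)) (Set.Ioi 0)) :
    ∫ ω, transitionWeight g ω * D ω =
      (∫ ω in Set.Iio 0, g ω * D ω) + ∫ ω in Set.Ioi 0, g ω * D (-ω) := by
  have h3 : IntegrableOn (fun ω => g (-ω) * D ω) (Set.Iio 0) := by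
    have h := (neg_zero (G := ℝ) ▸ h2 : IntegrableOn (fun ω => g ω * D (-ω)) (Set.Ioi (-0))).comp_neg_Iio
    simpa only [neg_neg] using h
  have h4 : ∫ ω in Set.Iio 0, g (-ω) * D ω = ∫ ω in Set.Ioi 0, g ω * D (-ω) := by
    have h := integral_comp_neg_Iic 0 fun ω => g ω * D (-ω)
    simpa only [neg_neg, neg_zero, integral_Iic_eq_integral_Iio] using h
  have h5 : (fun ω => transitionWeight g ω * D ω) =
      Set.indicator (Set.Iio 0) fun ω => g ω * D ω + g (-ω) * D ω := by
    rw [transitionWeight_eq_indicator]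
    funext ω
    by_cases hω : ω ∈ Set.Iio (0 : ℝ)
    · simp only [Set.indicator_of_mem hω, add_mul]
    · simp only [Set.indicator_of_notMem hω, zero_mul]
  rw [h5, integral_indicator measurableSet_Iio, integral_add h1 h3, h4]

theorem integral_eq_add_integral_Ioi {E : Type*} [NormedAddCommGroup E] [NormedSpace ℝ E]
    {F : ℝ → E} (hF : Integrable F) :
    ∫ ω, F ω = (∫ ω in Set.Iio 0, F ω) + ∫ ω in Set.Ioi 0, F ω := by
  rw [← integral_Iic_eq_integral_Iio, ← Set.compl_Iic,
    integral_add_compl measurableSet_Iic hF]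

theorem integral_transitionWeight (hg : IsProbabilityDensity g) :
    ∫ ω, transitionWeight g ω = 1 := by
  have h := integral_transitionWeight_mul (g := g) (D := fun _ => 1)
    (by simpa using hg.integrable.integrableOn) (by simpa using hg.integrable.integrableOn)
  simp only [mul_one] at h
  rw [h, ← integral_eq_add_integral_Ioi hg.integrable, hg.integral_eq_one]

end Weights

/-! ### The averaged channel: linearity and contractivity -/

section Channel

open scoped Matrix.Norms.L2Operator
open Matrix Filter Topology MeasureTheory

variable {d : ℕ} {H A : Matrix (Fin d) (Fin d) ℂ} {𝒜 : Finset (Matrix (Fin d) (Fin d) ℂ)}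
  {g : ℝ → ℝ} {σ T α : ℝ}

/-- The one-step map for frequency `ω ≠ 0`; unlike `singleStep` it is piecewise continuous. -/
noncomputable def signStep (H A : Matrix (Fin d) (Fin d) ℂ) (σ T α ω : ℝ)
    (ρ : Matrix (Fin d) (Fin d) ℂ) : Matrix (Fin d) (Fin d) ℂ :=
  basisStep H A σ T α ω (if 0 < ω then 0 else 1) ρ

/-- The mixed ancilla at `ω = 0` occurs on a null set only and never affects the average. -/
theorem singleStep_ae_eq (ρ : Matrix (Fin d) (Fin d) ℂ) :
    ∀ᵐ ω : ℝ, singleStep H A σ T α ω ρ = signStep H A σ T α ω ρ := by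
  filter_upwards [Measure.ae_ne volume (0 : ℝ)] with ω hω
  rcases lt_or_gt_of_ne hω with h | h
  · rw [singleStep_of_neg h, signStep, if_neg h.not_gt]
  · rw [singleStep_of_pos h, signStep, if_pos h]

theorem stronglyMeasurable_signStep (hσ : 0 < σ) (ρ : Matrix (Fin d) (Fin d) ℂ) :
    StronglyMeasurable fun ω => signStep H A σ T α ω ρ := by
  have h : (fun ω => signStep H A σ T α ω ρ) = fun ω => if ω ∈ Set.Ioi (0 : ℝ) then
      basisStep H A σ T α ω 0 ρ else basisStep H A σ T α ω 1 ρ := by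
    funext ω
    simp only [signStep, Set.mem_Ioi]
    split_ifs <;> rfl
  rw [h]
  exact StronglyMeasurable.ite measurableSet_Ioi (continuous_basisStep hσ 0 ρ).stronglyMeasurable
    (continuous_basisStep hσ 1 ρ).stronglyMeasurable

theorem norm_basisStep_le (hH : H.IsHermitian) (hσ : 0 < σ) (ω : ℝ) (c : Fin 2)
    (ρ : Matrix (Fin d) (Fin d) ℂ) : ‖basisStep H A σ T α ω c ρ‖ ≤ 2 * ‖ρ‖ := by
  have hk := kraus_of_conjTranspose_mul_self
    (conjTranspose_evolution_mul_self (A := A) (T := T) (α := α) (ω := ω) hH hσ) c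
  have h0 := norm_le_one_of_kraus hk
  have h1 := norm_le_one_of_kraus ((add_comm _ _).trans hk)
  have h2 : ∀ K : Matrix (Fin d) (Fin d) ℂ, ‖K‖ ≤ 1 → ‖K * ρ * Kᴴ‖ ≤ ‖ρ‖ := fun K hK => by
    refine (norm_mul_le _ _).trans ?_
    rw [l2_opNorm_conjTranspose]
    refine mul_le_of_le_one_right (norm_nonneg _) hK |>.trans ?_
    exact (norm_mul_le _ _).trans (mul_le_of_le_one_left (norm_nonneg _) hK)
  rw [basisStep, two_mul]
  exact (norm_add_le _ _).trans (add_le_add (h2 _ h0) (h2 _ h1))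

theorem integrable_smul_signStep (hH : H.IsHermitian) (hσ : 0 < σ) (hg : IsProbabilityDensity g)
    (ρ : Matrix (Fin d) (Fin d) ℂ) :
    Integrable fun ω => (g ω : ℂ) • signStep H A σ T α ω ρ := by
  refine (hg.integrable.mul_const (2 * ‖ρ‖)).mono'
    ((Complex.continuous_ofReal.comp_aestronglyMeasurable hg.integrable.aestronglyMeasurable).smul
      (stronglyMeasurable_signStep hσ ρ).aestronglyMeasurable)
    (Eventually.of_forall fun ω => ?_)
  rw [norm_smul, Complex.norm_real, Real.norm_of_nonneg (hg.nonneg ω)]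
  exact mul_le_mul_of_nonneg_left (norm_basisStep_le hH hσ ω _ ρ) (hg.nonneg ω)

theorem channel_eq (hH : H.IsHermitian) (hσ : 0 < σ) (hg : IsProbabilityDensity g)
    (ρ : Matrix (Fin d) (Fin d) ℂ) : channel H 𝒜 g σ T α ρ =
      (𝒜.card : ℂ)⁻¹ • ∑ A ∈ 𝒜, ∫ ω, (g ω : ℂ) • signStep H A σ T α ω ρ := by
  ext i j
  rw [channel, of_apply, Matrix.smul_apply, Matrix.sum_apply, smul_eq_mul, div_eq_inv_mul]
  congr 1
  refine Finset.sum_congr rfl fun A _ => ?_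
  rw [integral_apply_apply (integrable_smul_signStep hH hσ hg ρ)]
  refine integral_congr_ae ?_
  filter_upwards [singleStep_ae_eq (H := H) (A := A) (σ := σ) (T := T) (α := α) ρ] with ω hω
  rw [hω]
  rfl

theorem signStep_add (ω : ℝ) (ρ ρ' : Matrix (Fin d) (Fin d) ℂ) :
    signStep H A σ T α ω (ρ + ρ') = signStep H A σ T α ω ρ + signStep H A σ T α ω ρ' := by
  simp only [signStep, basisStep, Matrix.mul_add, Matrix.add_mul]
  abel

theorem signStep_smul (ω : ℝ) (z : ℂ) (ρ : Matrix (Fin d) (Fin d) ℂ) :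
    signStep H A σ T α ω (z • ρ) = z • signStep H A σ T α ω ρ := by
  simp only [signStep, basisStep, Matrix.mul_smul, Matrix.smul_mul, smul_add]

/-- The channel as a linear map. -/
noncomputable def channelLinear (𝒜 : Finset (Matrix (Fin d) (Fin d) ℂ)) (T α : ℝ)
    (hH : H.IsHermitian) (hσ : 0 < σ) (hg : IsProbabilityDensity g) :
    Matrix (Fin d) (Fin d) ℂ →ₗ[ℂ] Matrix (Fin d) (Fin d) ℂ where
  toFun := channel H 𝒜 g σ T α
  map_add' ρ ρ' := by
    simp only [channel_eq hH hσ hg, signStep_add, smul_add]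
    simp only [integral_add (integrable_smul_signStep hH hσ hg ρ)
      (integrable_smul_signStep hH hσ hg ρ'), Finset.sum_add_distrib, smul_add]
  map_smul' z ρ := by
    simp only [channel_eq hH hσ hg, signStep_smul, RingHom.id_apply]
    rw [smul_comm z (𝒜.card : ℂ)⁻¹]
    congr 1
    rw [Finset.smul_sum]
    refine Finset.sum_congr rfl fun A _ => ?_
    rw [← integral_smul]
    refine integral_congr_ae (Eventually.of_forall fun ω => ?_)
    exact smul_comm _ _ _

/-- Pairing with a fixed contraction is a continuous linear functional, so duality moves the
estimate inside the integral. -/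
theorem traceNorm_integral_le {F : ℝ → Matrix (Fin d) (Fin d) ℂ} {b : ℝ → ℝ} (hF : Integrable F)
    (hb : Integrable b) (h : ∀ ω, traceNorm (F ω) ≤ b ω) : traceNorm (∫ ω, F ω) ≤ ∫ ω, b ω := by
  refine traceNorm_le_of_forall fun X hX => ?_
  have hL : (X * ∫ ω, F ω).trace = ∫ ω, (X * F ω).trace := by
    let L : Matrix (Fin d) (Fin d) ℂ →L[ℝ] ℂ := LinearMap.toContinuousLinearMap
      ((Matrix.traceLinearMap (Fin d) ℝ ℂ).comp (LinearMap.mulLeft ℝ X))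
    exact (L.integral_comp_comm hF).symm
  rw [hL]
  exact norm_integral_le_of_norm_le hb
    (Eventually.of_forall fun ω => (norm_trace_mul_le_of_le_one hX _).trans (h ω))

theorem traceNorm_inv_card_smul_sum_le (F : Matrix (Fin d) (Fin d) ℂ → Matrix (Fin d) (Fin d) ℂ)
    (b : Matrix (Fin d) (Fin d) ℂ → ℝ) (h : ∀ A ∈ 𝒜, traceNorm (F A) ≤ b A) :
    traceNorm ((𝒜.card : ℂ)⁻¹ • ∑ A ∈ 𝒜, F A) ≤ couplingMean 𝒜 b := by
  refine (traceNorm_smul_le _ _).trans ?_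
  rw [norm_inv, Complex.norm_natCast, couplingMean, div_eq_inv_mul]
  refine mul_le_mul_of_nonneg_left ?_ (by positivity)
  exact (Finset.le_sum_of_subadditive _ traceNorm_zero.le traceNorm_add_le _ _).trans
    (Finset.sum_le_sum h)

theorem couplingMean_const (h𝒜 : 𝒜.Nonempty) (x : ℝ) : couplingMean 𝒜 (fun _ => x) = x := by
  have : (𝒜.card : ℝ) ≠ 0 := by exact_mod_cast h𝒜.card_pos.ne'
  rw [couplingMean, Finset.sum_const, nsmul_eq_mul, mul_div_cancel_left₀ _ this]

theorem traceNorm_channel_le (hH : H.IsHermitian) (hσ : 0 < σ) (hg : IsProbabilityDensity g)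
    (h𝒜 : 𝒜.Nonempty) (ρ : Matrix (Fin d) (Fin d) ℂ) :
    traceNorm (channel H 𝒜 g σ T α ρ) ≤ traceNorm ρ := by
  rw [channel_eq hH hσ hg]
  refine (traceNorm_inv_card_smul_sum_le _ (fun _ => traceNorm ρ) fun A _ => ?_).trans
    (couplingMean_const h𝒜 _).le
  have h : traceNorm ρ = ∫ ω, g ω * traceNorm ρ := by
    rw [integral_mul_const, hg.integral_eq_one, one_mul]
  rw [h]
  refine traceNorm_integral_le (integrable_smul_signStep hH hσ hg ρ)
    (hg.integrable.mul_const _) fun ω => (traceNorm_smul_le _ _).trans ?_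
  rw [Complex.norm_real, Real.norm_of_nonneg (hg.nonneg ω)]
  exact mul_le_mul_of_nonneg_left (traceNorm_basisStep_le hH hσ _ ρ) (hg.nonneg ω)

end Channel

/-! ### Error of one channel application on the ground state -/

section StepError

open scoped Matrix.Norms.L2Operator
open Matrix Filter Topology MeasureTheory

variable {d : ℕ} {H A B : Matrix (Fin d) (Fin d) ℂ} {𝒜 : Finset (Matrix (Fin d) (Fin d) ℂ)}
  {ψ : Fin d → ℂ} {g : ℝ → ℝ} {Δ σ T α : ℝ}

/-- This is where closure under adjoints enters: negative frequencies produce the defect of `Aᴴ`,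
which has the same average as that of `A`. -/
theorem sum_conjTranspose_eq (h𝒜 : IsCouplingSet 𝒜) (F : Matrix (Fin d) (Fin d) ℂ → ℝ) :
    ∑ A ∈ 𝒜, F Aᴴ = ∑ A ∈ 𝒜, F A :=
  Finset.sum_nbij' (fun A => Aᴴ) (fun A => Aᴴ) h𝒜.conjTranspose_mem h𝒜.conjTranspose_mem
    (fun A _ => conjTranspose_conjTranspose A) (fun A _ => conjTranspose_conjTranspose A)
    (fun _ _ => rfl)

theorem integrableOn_density_mul (hg : IsProbabilityDensity g) {S : Set ℝ} (hS : MeasurableSet S)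
    {D : ℝ → ℝ} (hD : Continuous D) (hD0 : ∀ ω, 0 ≤ D ω) {b : ℝ} (hb : ∀ ω ∈ S, D ω ≤ b) :
    IntegrableOn (fun ω => g ω * D ω) S := by
  refine (hg.integrable.mul_const b).integrableOn.mono'
    (hg.integrable.aestronglyMeasurable.mul hD.aestronglyMeasurable).restrict ?_
  filter_upwards [ae_restrict_mem hS] with ω hω
  rw [Real.norm_of_nonneg (mul_nonneg (hg.nonneg ω) (hD0 ω))]
  exact mul_le_mul_of_nonneg_left (hb ω hω) (hg.nonneg ω)

theorem integrableOn_density_mul_pointwiseDefect (hH : H.IsHermitian) (hσ : 0 < σ) (hΔ : 0 < Δ)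
    (hψ : IsGappedGroundState H ψ Δ) (hg : IsProbabilityDensity g) :
    IntegrableOn (fun ω => g ω * pointwiseDefect H B σ ω (ketbra ψ)) (Set.Iio 0) :=
  integrableOn_density_mul hg measurableSet_Iio (continuous_pointwiseDefect hH hσ _)
    (fun _ => pointwiseDefect_nonneg _ _)
    fun _ hω => pointwiseDefect_ketbra_le hH hσ hΔ hψ (le_of_lt hω)

theorem integrableOn_density_mul_pointwiseDefect_neg (hH : H.IsHermitian) (hσ : 0 < σ)
    (hΔ : 0 < Δ) (hψ : IsGappedGroundState H ψ Δ) (hg : IsProbabilityDensity g) :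
    IntegrableOn (fun ω => g ω * pointwiseDefect H B σ (-ω) (ketbra ψ)) (Set.Ioi 0) :=
  integrableOn_density_mul hg measurableSet_Ioi
    ((continuous_pointwiseDefect hH hσ _).comp continuous_neg)
    (fun _ => pointwiseDefect_nonneg _ _)
    fun _ hω => pointwiseDefect_ketbra_le hH hσ hΔ hψ (neg_nonpos.2 (le_of_lt hω))

/-- The folded weight is unfolded into the two half-lines on which the channel's ancilla states
differ. Integrability on each half-line comes from the uniform defect bound at nonpositive
frequencies. -/
theorem generatorDefect_eq (hH : H.IsHermitian) (hσ : 0 < σ) (hΔ : 0 < Δ)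
    (hψ : IsGappedGroundState H ψ Δ) (hg : IsProbabilityDensity g) :
    generatorDefect H 𝒜 g σ (ketbra ψ) = couplingMean 𝒜 fun A =>
      (∫ ω in Set.Iio 0, g ω * pointwiseDefect H A σ ω (ketbra ψ)) +
        ∫ ω in Set.Ioi 0, g ω * pointwiseDefect H A σ (-ω) (ketbra ψ) := by
  refine congrArg (couplingMean 𝒜) (funext fun A => ?_)
  exact integral_transitionWeight_mul
    (integrableOn_density_mul_pointwiseDefect hH hσ hΔ hψ hg)
    (integrableOn_density_mul_pointwiseDefect_neg hH hσ hΔ hψ hg)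

theorem couplingMean_mono {F G : Matrix (Fin d) (Fin d) ℂ → ℝ} (h : ∀ A ∈ 𝒜, F A ≤ G A) :
    couplingMean 𝒜 F ≤ couplingMean 𝒜 G :=
  div_le_div_of_nonneg_right (Finset.sum_le_sum h) (by positivity)

theorem couplingMean_mul_left (x : ℝ) (F : Matrix (Fin d) (Fin d) ℂ → ℝ) :
    couplingMean 𝒜 (fun A => x * F A) = x * couplingMean 𝒜 F := by
  rw [couplingMean, ← Finset.mul_sum, mul_div_assoc, couplingMean]

theorem couplingMean_add (F G : Matrix (Fin d) (Fin d) ℂ → ℝ) :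
    couplingMean 𝒜 (fun A => F A + G A) = couplingMean 𝒜 F + couplingMean 𝒜 G := by
  rw [couplingMean, Finset.sum_add_distrib, add_div, couplingMean, couplingMean]

/-- The generator almost annihilates the ground state. -/
theorem generatorDefect_ketbra_le (hH : H.IsHermitian) (hσ : 0 < σ) (hΔ : 0 < Δ)
    (hψ : IsGappedGroundState H ψ Δ) (hg : IsProbabilityDensity g) :
    generatorDefect H 𝒜 g σ (ketbra ψ) ≤
      42 * (σ * Real.exp (-(σ ^ 2 * Δ ^ 2 / 2)) * couplingMean 𝒜 fun A => opNorm A ^ 2) := by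
  rw [← couplingMean_mul_left, ← couplingMean_mul_left]
  refine couplingMean_mono fun A _ => ?_
  have hint := (integrable_transitionWeight hg).mul_const
    (42 * (σ * Real.exp (-(σ ^ 2 * Δ ^ 2 / 2)) * ‖A‖ ^ 2))
  refine (integral_mono_of_nonneg (Eventually.of_forall fun ω =>
    mul_nonneg (transitionWeight_nonneg hg ω) (pointwiseDefect_nonneg ω (ketbra ψ))) hint
    (Eventually.of_forall fun ω => ?_)).trans_eq ?_
  · by_cases hω : ω < 0
    · exact mul_le_mul_of_nonneg_left (pointwiseDefect_ketbra_le hH hσ hΔ hψ hω.le)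
        (transitionWeight_nonneg hg ω)
    · simp [transitionWeight, hω]
  · rw [integral_mul_const, integral_transitionWeight hg, one_mul, opNorm_eq_norm]

theorem channel_sub_eq (hH : H.IsHermitian) (hσ : 0 < σ) (hg : IsProbabilityDensity g)
    (h𝒜 : 𝒜.Nonempty) (ρ : Matrix (Fin d) (Fin d) ℂ) : channel H 𝒜 g σ T α ρ - ρ =
      (𝒜.card : ℂ)⁻¹ • ∑ A ∈ 𝒜, ∫ ω, (g ω : ℂ) • (signStep H A σ T α ω ρ - ρ) := by
  have hgc : Integrable fun ω => (g ω : ℂ) • ρ := hg.integrable.ofReal.smul_const ρ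
  have h1 : ∫ ω, (g ω : ℂ) • ρ = ρ := by
    rw [integral_smul_const, integral_complex_ofReal, hg.integral_eq_one, Complex.ofReal_one, one_smul]
  have hc : (𝒜.card : ℂ) ≠ 0 := by exact_mod_cast h𝒜.card_pos.ne'
  simp only [smul_sub]
  simp only [integral_sub (integrable_smul_signStep hH hσ hg ρ) hgc, h1, Finset.sum_sub_distrib,
    Finset.sum_const, smul_sub]
  rw [channel_eq hH hσ hg, ← Nat.cast_smul_eq_nsmul ℂ, smul_smul, inv_mul_cancel₀ hc, one_smul]

/-- The trace-norm error of one application of the channel to the ground state. -/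
theorem traceNorm_channel_ketbra_sub_le (hH : H.IsHermitian) (hσ : 0 < σ) (hT : 0 < T)
    (hα : 0 < α) (hΔ : 0 < Δ) (hψ : IsGappedGroundState H ψ Δ) (hg : IsProbabilityDensity g)
    (h𝒜 : IsCouplingSet 𝒜) :
    traceNorm (channel H 𝒜 g σ T α (ketbra ψ) - ketbra ψ) ≤
      α ^ 2 * (generatorDefect H 𝒜 g σ (ketbra ψ) +
        80 * (σ * Real.exp (-T ^ 2 / (4 * σ ^ 2)) * couplingMean 𝒜 (fun A => opNorm A ^ 2) +
          α ^ 2 * T ^ 4 * σ⁻¹ ^ 2 * couplingMean 𝒜 (fun A => opNorm A ^ 4))) := by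
  obtain ⟨E₀, hE, -⟩ := hψ.2
  set P := ketbra ψ with hPdef
  have hPP : Pᴴ = P := conjTranspose_ketbra
  have hP : H * P = (E₀ : ℂ) • P := mul_ketbra_of_eigen hE
  have hP1 : traceNorm P ≤ 1 := traceNorm_ketbra_le hψ.1
  let J : Matrix (Fin d) (Fin d) ℂ → ℝ := fun A =>
    ∫ ω in Set.Iio 0, g ω * pointwiseDefect H A σ ω P
  let J' : Matrix (Fin d) (Fin d) ℂ → ℝ := fun A =>
    ∫ ω in Set.Ioi 0, g ω * pointwiseDefect H A σ (-ω) P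
  let err : Matrix (Fin d) (Fin d) ℂ → ℝ := fun A =>
    80 * (σ * Real.exp (-T ^ 2 / (4 * σ ^ 2)) * ‖A‖ ^ 2 + α ^ 2 * T ^ 4 * σ⁻¹ ^ 2 * ‖A‖ ^ 4)
  have hstep : ∀ A ∈ 𝒜, traceNorm (∫ ω, (g ω : ℂ) • (signStep H A σ T α ω P - P)) ≤
      α ^ 2 * ((J Aᴴ + J' A) + err A) := fun A _ => by
    -- The two signs of `ω` are glued into one integrand: at positive frequencies the defect of `A`
    -- at `-ω`, otherwise that of `Aᴴ` at `ω`.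
    let q : ℝ → ℝ := fun ω => if ω ∈ Set.Ioi (0 : ℝ) then g ω * pointwiseDefect H A σ (-ω) P
      else g ω * pointwiseDefect H Aᴴ σ ω P
    have hq1 : Set.EqOn q (fun ω => g ω * pointwiseDefect H Aᴴ σ ω P) (Set.Iio 0) := fun ω hω =>
      if_neg (Set.notMem_Ioi.2 (le_of_lt hω))
    have hq2 : Set.EqOn q (fun ω => g ω * pointwiseDefect H A σ (-ω) P) (Set.Ioi 0) :=
      fun ω hω => if_pos hω
    have hi1 : IntegrableOn q (Set.Iio 0) :=
      (integrableOn_density_mul_pointwiseDefect hH hσ hΔ hψ hg).congr_fun hq1.symm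
        measurableSet_Iio
    have hi2 : IntegrableOn q (Set.Ioi 0) :=
      (integrableOn_density_mul_pointwiseDefect_neg hH hσ hΔ hψ hg).congr_fun hq2.symm
        measurableSet_Ioi
    have hq : Integrable q := by
      rw [← integrableOn_univ, ← Set.Iic_union_Ioi (a := (0 : ℝ))]
      exact (Iff.mpr integrableOn_Iic_iff_integrableOn_Iio hi1).union hi2
    have hqi : ∫ ω, q ω = J Aᴴ + J' A := by
      rw [integral_eq_add_integral_Ioi hq, setIntegral_congr_fun measurableSet_Iio hq1,
        setIntegral_congr_fun measurableSet_Ioi hq2]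
    have hb : Integrable fun ω => α ^ 2 * (q ω + g ω * err A) :=
      (hq.add (hg.integrable.mul_const _)).const_mul _
    have hbi : ∫ ω, α ^ 2 * (q ω + g ω * err A) = α ^ 2 * ((J Aᴴ + J' A) + err A) := by
      rw [integral_const_mul, integral_add hq (hg.integrable.mul_const _), hqi,
        integral_mul_const, hg.integral_eq_one, one_mul]
    rw [← hbi]
    have hgc : Integrable fun ω => (g ω : ℂ) • P := hg.integrable.ofReal.smul_const P
    refine traceNorm_integral_le ?_ hb fun ω => ?_
    · simp only [smul_sub]
      exact (integrable_smul_signStep hH hσ hg P).sub hgc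
    · refine (traceNorm_smul_le _ _).trans ?_
      rw [Complex.norm_real, Real.norm_of_nonneg (hg.nonneg ω)]
      by_cases hω : 0 < ω
      · have h := traceNorm_basisStep_zero_sub_le (A := A) (ω := ω) hH hσ hT hα hPP hP hP1
        have hs : signStep H A σ T α ω P = basisStep H A σ T α ω 0 P := by
          rw [signStep, if_pos hω]
        have hqω : q ω = g ω * pointwiseDefect H A σ (-ω) P := if_pos hω
        rw [hs, hqω]
        refine (mul_le_mul_of_nonneg_left h (hg.nonneg ω)).trans_eq ?_
        simp only [err]; ring
      · have h := traceNorm_basisStep_one_sub_le (A := A) (ω := ω) hH hσ hT hα hPP hP hP1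
        have hs : signStep H A σ T α ω P = basisStep H A σ T α ω 1 P := by
          rw [signStep, if_neg hω]
        have hqω : q ω = g ω * pointwiseDefect H Aᴴ σ ω P := if_neg hω
        rw [hs, hqω]
        refine (mul_le_mul_of_nonneg_left h (hg.nonneg ω)).trans_eq ?_
        simp only [err]; ring
  have hJ : couplingMean 𝒜 (fun A => J Aᴴ) = couplingMean 𝒜 J := by
    rw [couplingMean, sum_conjTranspose_eq h𝒜 J, couplingMean]
  rw [channel_sub_eq hH hσ hg h𝒜.nonempty]
  refine (traceNorm_inv_card_smul_sum_le _ _ hstep).trans_eq ?_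
  rw [couplingMean_mul_left, couplingMean_add, couplingMean_add, hJ,
    generatorDefect_eq hH hσ hΔ hψ hg, couplingMean_add, couplingMean_mul_left, couplingMean_add,
    couplingMean_mul_left, couplingMean_mul_left]
  rfl

end StepError

/-! ### From almost-fixed to close to the fixed point -/

section FixedPoint

open Matrix

variable {d : ℕ} {F : Matrix (Fin d) (Fin d) ℂ →ₗ[ℂ] Matrix (Fin d) (Fin d) ℂ}
  {P ρ : Matrix (Fin d) (Fin d) ℂ} {ε : ℝ} {τ : ℕ}

/-- Telescoping: each further step adds one single-step error, and contractivity keeps the earlier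
ones from growing. -/
theorem traceNorm_iterate_sub_le (hF : ∀ X, traceNorm (F X) ≤ traceNorm X)
    (P : Matrix (Fin d) (Fin d) ℂ) (n : ℕ) :
    traceNorm (F^[n] P - P) ≤ n * traceNorm (F P - P) := by
  induction n with
  | zero => simp [traceNorm_zero]
  | succ n ih =>
    have h : F^[n + 1] P - P = F (F^[n] P - P) + (F P - P) := by
      rw [Function.iterate_succ_apply', map_sub]; abel
    rw [h, Nat.cast_succ, add_mul, one_mul]
    exact (traceNorm_add_le _ _).trans (add_le_add ((hF _).trans ih) le_rfl)

theorem traceNorm_sub_le_of_isMixingTime (hF : ∀ X, traceNorm (F X) ≤ traceNorm X)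
    (hP : IsDensityMatrix P) (hτ : IsMixingTime F ρ ε τ) :
    traceNorm (ρ - P) ≤ τ * traceNorm (F P - P) + ε := by
  have h : ρ - P = (F^[τ] P - P) - (F^[τ] P - ρ) := by abel
  rw [h]
  exact (traceNorm_sub_le _ _).trans (add_le_add (traceNorm_iterate_sub_le hF P τ) (hτ.1 P hP))

/-- In `ρ - P = F^τ(ρ - P) + (F^τ P - P)` the first term is at most `ε` times the left side, because
`ρ - P` is traceless Hermitian. Absorbing it replaces the additive loss `ε` by a factor `1 - ε`. -/
theorem one_sub_mul_traceNorm_sub_le_of_isMixingTime (hF : ∀ X, traceNorm (F X) ≤ traceNorm X)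
    (hP : IsDensityMatrix P) (hρ : IsDensityMatrix ρ) (hfix : F ρ = ρ) (hε : 0 ≤ ε)
    (hτ : IsMixingTime F ρ ε τ) :
    (1 - ε) * traceNorm (ρ - P) ≤ τ * traceNorm (F P - P) := by
  have h1 := traceNorm_map_le_of_isHermitian_of_trace_eq_zero (F ^ τ) ρ (ε := ε)
    (fun X hX => by rw [Module.End.pow_apply]; exact hτ.1 X hX) (X := ρ - P)
    (hρ.1.isHermitian.sub hP.1.isHermitian) (by rw [trace_sub, hρ.2, hP.2, sub_self]) hε
  have h2 : ρ - P = (F ^ τ) (ρ - P) + (F^[τ] P - P) := by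
    rw [map_sub, Module.End.pow_apply, Module.End.pow_apply, Function.iterate_fixed hfix]
    abel
  have h3 := traceNorm_add_le ((F ^ τ) (ρ - P)) (F^[τ] P - P)
  rw [← h2] at h3
  have h4 := traceNorm_iterate_sub_le hF P τ
  linarith

theorem IsDensityMatrix.eq_of_dim_one {P ρ : Matrix (Fin 1) (Fin 1) ℂ} (hP : IsDensityMatrix P)
    (hρ : IsDensityMatrix ρ) : ρ = P := by
  have h1 := hP.2
  have h2 := hρ.2
  rw [trace_fin_one] at h1 h2
  ext i j
  rw [Subsingleton.elim i 0, Subsingleton.elim j 0, h1, h2]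

end FixedPoint

/-! ### Making the error terms small -/

section Parameters

open Real

/-- The square of the logarithm leaves room for `x² / 4 ≥ log(2 + y) + 1000/δ`: the first summand
removes `y`, and the second supplies the small factor. -/
theorem mul_exp_neg_sq_le_of_log_le {δ x y : ℝ} (hδ : 0 < δ) (hδ1 : δ ≤ 1) (hy : 0 ≤ y)
    (hx : 1000 / δ * log (2 + y) ≤ x) : y * exp (-(x ^ 2 / 4)) ≤ δ / 1000 := by
  set L := log (2 + y) with hL
  have hK : 1000 ≤ 1000 / δ := by rw [le_div_iff₀ hδ]; nlinarith
  have hL2 : 1 / 2 ≤ L := by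
    have := log_le_log (by norm_num) (show (2 : ℝ) ≤ 2 + y by linarith)
    linarith [log_two_gt_d9]
  have hx2 : L + 1000 / δ ≤ x ^ 2 / 4 := by
    have h1 : (1000 / δ * L) ^ 2 ≤ x ^ 2 :=
      pow_le_pow_left₀ (by positivity) hx 2
    have h2 : 1000 * (1000 / δ) ≤ (1000 / δ) ^ 2 := by nlinarith
    have h3 : 1 / 2 * L ≤ L ^ 2 := by nlinarith
    have h4 : 1000 * (1000 / δ) * (1 / 2 * L) ≤ (1000 / δ) ^ 2 * L ^ 2 :=
      mul_le_mul h2 h3 (by positivity) (by positivity)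
    rw [mul_pow] at h1
    nlinarith
  have h5 : exp (-(x ^ 2 / 4)) ≤ (2 + y)⁻¹ * (δ / 1000) := by
    calc exp (-(x ^ 2 / 4)) ≤ exp (-L + -(1000 / δ)) := exp_le_exp.2 (by linarith)
      _ = (2 + y)⁻¹ * (exp (1000 / δ))⁻¹ := by
        rw [exp_add, exp_neg, exp_neg, hL, exp_log (by linarith)]
      _ ≤ (2 + y)⁻¹ * (1000 / δ)⁻¹ := by
        have := add_one_le_exp (1000 / δ)
        refine mul_le_mul_of_nonneg_left (inv_anti₀ (by positivity) (by linarith)) (by positivity)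
      _ = _ := by rw [inv_div]
  calc y * exp (-(x ^ 2 / 4)) ≤ y * ((2 + y)⁻¹ * (δ / 1000)) := mul_le_mul_of_nonneg_left h5 hy
    _ = y / (2 + y) * (δ / 1000) := by ring
    _ ≤ 1 * (δ / 1000) := mul_le_mul_of_nonneg_right
      ((div_le_one (by linarith)).2 (by linarith)) (by positivity)
    _ = _ := one_mul _

theorem error_lt_of_parameters {δ h Δ σ T α ε t : ℝ} (hδ : 0 < δ) (hδ1 : δ ≤ 1) (hΔ : 0 < Δ)
    (hh : Δ ≤ 2 * h) (hσ : 0 < σ) (hα : 0 < α) (hε : 0 < ε) (ht : 0 ≤ t)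
    (h1 : 1000 / δ * Δ⁻¹ * log (2 + h * t / (Δ ^ 2 * ε)) ≤ σ)
    (h2 : 1000 / δ * σ * log (2 + σ * t / ε) ≤ T)
    (h3 : 1000 / δ * (α * T ^ 2 * t ^ (1 / 2 : ℝ)) ≤ σ * ε ^ (1 / 2 : ℝ)) :
    (42 * (σ * exp (-(σ ^ 2 * Δ ^ 2 / 2))) + 80 * (σ * exp (-T ^ 2 / (4 * σ ^ 2)) +
      α ^ 2 * T ^ 4 * σ⁻¹ ^ 2)) * t < δ * ε := by
  have hh0 : 0 < h := by linarith
  set y := h * t / (Δ ^ 2 * ε) with hy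
  have hy0 : 0 ≤ y := by positivity
  set z := σ * t / ε with hz
  have hz0 : 0 ≤ z := by positivity
  have hK : 1000 ≤ 1000 / δ := by rw [le_div_iff₀ hδ]; nlinarith
  have hzt : σ * t = z * ε := by rw [hz]; field_simp
  have e1 : 42 * (σ * exp (-(σ ^ 2 * Δ ^ 2 / 2))) * t ≤ δ * ε / 4 := by
    have hx : 1000 / δ * log (2 + y) ≤ σ * Δ := by
      have := mul_le_mul_of_nonneg_right h1 hΔ.le
      rwa [mul_right_comm, mul_assoc (1000 / δ), inv_mul_cancel₀ hΔ.ne', mul_one] at this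
    have hm := mul_exp_neg_sq_le_of_log_le hδ hδ1 hy0 hx
    -- The logarithm in the hypothesis involves `‖H‖ t / (Δ² ε)`, whereas the error involves `σ t /
    -- ε`. The comparison uses `Δ ≤ 2h` and costs a factor `σΔ`.
    have hzy : z ≤ 2 * (σ * Δ) * y := by
      have : z * h = σ * Δ * y * Δ := by rw [hz, hy]; field_simp
      have h5 : σ * Δ * y * Δ ≤ σ * Δ * y * (2 * h) :=
        mul_le_mul_of_nonneg_left hh (by positivity)
      refine le_of_mul_le_mul_right ?_ hh0
      linarith
    -- Half of the Gaussian exponent pays for the extra factor `σΔ`.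
    have hxe : σ * Δ * exp (-(σ ^ 2 * Δ ^ 2 / 2)) ≤ exp (-((σ * Δ) ^ 2 / 4)) := by
      have h6 : σ * Δ ≤ exp ((σ * Δ) ^ 2 / 4) := by
        have := add_one_le_exp ((σ * Δ) ^ 2 / 4)
        nlinarith [sq_nonneg (σ * Δ / 2 - 1)]
      calc _ ≤ exp ((σ * Δ) ^ 2 / 4) * exp (-(σ ^ 2 * Δ ^ 2 / 2)) :=
            mul_le_mul_of_nonneg_right h6 (exp_pos _).le
        _ = _ := by rw [← exp_add]; congr 1; ring
    calc _ = 42 * (z * ε) * exp (-(σ ^ 2 * Δ ^ 2 / 2)) := by rw [← hzt]; ring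
      _ ≤ 42 * (2 * (σ * Δ) * y * ε) * exp (-(σ ^ 2 * Δ ^ 2 / 2)) := by gcongr
      _ = 84 * ε * (y * (σ * Δ * exp (-(σ ^ 2 * Δ ^ 2 / 2)))) := by ring
      _ ≤ 84 * ε * (y * exp (-((σ * Δ) ^ 2 / 4))) := by gcongr
      _ ≤ 84 * ε * (δ / 1000) := by gcongr
      _ ≤ _ := by nlinarith [mul_pos hδ hε]
  have e2 : 80 * (σ * exp (-T ^ 2 / (4 * σ ^ 2))) * t ≤ δ * ε / 4 := by
    have hx : 1000 / δ * log (2 + z) ≤ T / σ := by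
      rw [le_div_iff₀ hσ]
      linarith
    have hm := mul_exp_neg_sq_le_of_log_le hδ hδ1 hz0 hx
    calc _ = 80 * ε * (z * exp (-((T / σ) ^ 2 / 4))) := by
          rw [show -((T / σ) ^ 2 / 4) = -T ^ 2 / (4 * σ ^ 2) by field_simp]
          linear_combination 80 * exp (-T ^ 2 / (4 * σ ^ 2)) * hzt
      _ ≤ 80 * ε * (δ / 1000) := by gcongr
      _ ≤ _ := by nlinarith [mul_pos hδ hε]
  have e3 : 80 * (α ^ 2 * T ^ 4 * σ⁻¹ ^ 2) * t ≤ δ * ε / 4 := by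
    rw [← sqrt_eq_rpow, ← sqrt_eq_rpow] at h3
    -- Squaring the hypothesis on `α` produces the combination `α² T⁴ t` of the fourth-order error.
    have h4 := pow_le_pow_left₀ (by positivity) h3 2
    rw [mul_pow, mul_pow, mul_pow, mul_pow, sq_sqrt ht, sq_sqrt hε.le] at h4
    have h5 : 1000 * (1 / δ) ≤ (1000 / δ) ^ 2 := by
      have : 1 ≤ 1 / δ := by rw [le_div_iff₀ hδ]; linarith
      rw [show 1000 / δ = 1000 * (1 / δ) by ring]
      nlinarith
    have h6 : 1000 * (1 / δ) * (α ^ 2 * (T ^ 2) ^ 2 * t) ≤ σ ^ 2 * ε :=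
      (mul_le_mul_of_nonneg_right h5 (by positivity)).trans h4
    have h7 : 1000 * (α ^ 2 * T ^ 4 * t) ≤ δ * (σ ^ 2 * ε) := by
      have := mul_le_mul_of_nonneg_left h6 hδ.le
      refine le_trans (le_of_eq ?_) this
      field_simp
    have h8 : 80 * (α ^ 2 * T ^ 4 * σ⁻¹ ^ 2) * t = 80 * (α ^ 2 * T ^ 4 * t) / σ ^ 2 := by
      field_simp
    rw [h8, div_le_iff₀ (by positivity)]
    have : 0 ≤ α ^ 2 * T ^ 4 * t := by positivity
    nlinarith
  -- Three errors of at most a quarter of `δε` each leave the inequality strict.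
  nlinarith [mul_pos hδ hε]

end Parameters

/-! ### Coupling moments and the stated prefactor -/

section Bounds

open scoped Matrix.Norms.L2Operator
open Matrix

variable {d : ℕ} {H : Matrix (Fin d) (Fin d) ℂ} {𝒜 : Finset (Matrix (Fin d) (Fin d) ℂ)}

theorem opNorm_nonneg (A : Matrix (Fin d) (Fin d) ℂ) : 0 ≤ opNorm A := norm_nonneg _

theorem couplingMean_opNorm_pow_nonneg (n : ℕ) : 0 ≤ couplingMean 𝒜 fun A => opNorm A ^ n :=
  div_nonneg (Finset.sum_nonneg fun A _ => pow_nonneg (opNorm_nonneg A) n) (Nat.cast_nonneg _)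

theorem couplingMean_opNorm_pow_le_one (h𝒜 : IsCouplingSet 𝒜) (n : ℕ) :
    couplingMean 𝒜 (fun A => opNorm A ^ n) ≤ 1 :=
  (couplingMean_mono fun A hA => pow_le_one₀ (opNorm_nonneg A) (h𝒜.opNorm_le A hA)).trans
    (couplingMean_const h𝒜.nonempty 1).le

/-- The defect estimate has prefactor `σ`; multiplying by `(σh/c)^(1/2) ≥ 1` turns it into the
weaker form with `h^(1/2) σ^(3/2)`. -/
theorem filterWidth_le {c h σ : ℝ} (hc : 0 < c) (hσ : 0 < σ) (hh : 0 ≤ h) (hch : c ≤ σ * h) :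
    σ ≤ (c ^ (1 / 2 : ℝ))⁻¹ * (h ^ (1 / 2 : ℝ) * σ ^ (3 / 2 : ℝ)) := by
  have h1 : c ^ (1 / 2 : ℝ) ≤ σ ^ (1 / 2 : ℝ) * h ^ (1 / 2 : ℝ) := by
    rw [← Real.mul_rpow hσ.le hh]
    exact Real.rpow_le_rpow hc.le hch (by norm_num)
  have h2 : σ ^ (3 / 2 : ℝ) = σ * σ ^ (1 / 2 : ℝ) := by
    rw [show (3 / 2 : ℝ) = 1 + 1 / 2 by norm_num, Real.rpow_add hσ, Real.rpow_one]
  rw [inv_mul_eq_div, le_div_iff₀ (Real.rpow_pos_of_pos hc _), h2]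
  nlinarith

end Bounds

end SystemBath

/-! ### Main theorem -/

theorem mainTheorem3 :
    -- quantitative fixed point bound
    (∀ c : ℝ, 0 < c → ∃ C : ℝ, 0 < C ∧
      ∀ (d : ℕ) (H : Matrix (Fin d) (Fin d) ℂ) (ψ₀ : Fin d → ℂ) (Δ : ℝ)
        (𝒜 : Finset (Matrix (Fin d) (Fin d) ℂ)) (g : ℝ → ℝ) (σ T α ε : ℝ)
        (ρfix : Matrix (Fin d) (Fin d) ℂ) (τ : ℕ),
        H.IsHermitian → 0 < Δ → IsGappedGroundState H ψ₀ Δ →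
        IsCouplingSet 𝒜 → IsProbabilityDensity g →
        0 < σ → 0 < T → 0 < α → 0 < ε →
        IsUniqueFixedState (channel H 𝒜 g σ T α) ρfix →
        IsMixingTime (channel H 𝒜 g σ T α) ρfix ε τ →
        traceNorm (ρfix - ketbra ψ₀) ≤
            (generatorDefect H 𝒜 g σ (ketbra ψ₀) +
              C * (σ * Real.exp (-T ^ 2 / (4 * σ ^ 2)) * couplingMean 𝒜 (fun A => opNorm A ^ 2) +
                α ^ 2 * T ^ 4 * σ⁻¹ ^ 2 * couplingMean 𝒜 (fun A => opNorm A ^ 4))) *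
              (α ^ 2 * τ) + ε ∧
        (c ≤ σ * opNorm H →
          generatorDefect H 𝒜 g σ (ketbra ψ₀) ≤
              C * (opNorm H ^ (1 / 2 : ℝ) * σ ^ (3 / 2 : ℝ) *
                Real.exp (-(σ ^ 2 * Δ ^ 2 / 32)) * couplingMean 𝒜 (fun A => opNorm A ^ 2)) ∧
          traceNorm (ρfix - ketbra ψ₀) ≤
            C * ((opNorm H ^ (1 / 2 : ℝ) * σ ^ (3 / 2 : ℝ) *
                  Real.exp (-(σ ^ 2 * Δ ^ 2 / 32)) * couplingMean 𝒜 (fun A => opNorm A ^ 2) +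
                σ * Real.exp (-T ^ 2 / (4 * σ ^ 2)) * couplingMean 𝒜 (fun A => opNorm A ^ 2) +
                α ^ 2 * T ^ 4 * σ⁻¹ ^ 2 * couplingMean 𝒜 (fun A => opNorm A ^ 4)) *
              (α ^ 2 * τ) + ε))) ∧
    -- sufficient choice of the parameters
    (∀ ε₀ : ℝ, 0 < ε₀ → ε₀ < 1 → ∃ K : ℝ, 0 < K ∧
      ∀ (d : ℕ) (H : Matrix (Fin d) (Fin d) ℂ) (ψ₀ : Fin d → ℂ) (Δ : ℝ)
        (𝒜 : Finset (Matrix (Fin d) (Fin d) ℂ)) (g : ℝ → ℝ) (σ T α ε : ℝ)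
        (ρfix : Matrix (Fin d) (Fin d) ℂ) (τ : ℕ) (tmix : ℝ),
        H.IsHermitian → 0 < Δ → IsGappedGroundState H ψ₀ Δ →
        IsCouplingSet 𝒜 → IsProbabilityDensity g →
        0 < σ → 0 < T → 0 < α → 0 < ε → ε ≤ ε₀ →
        IsUniqueFixedState (channel H 𝒜 g σ T α) ρfix →
        IsMixingTime (channel H 𝒜 g σ T α) ρfix ε τ →
        tmix = α ^ 2 * τ →
        K * Δ⁻¹ * Real.log (2 + opNorm H * tmix / (Δ ^ 2 * ε)) ≤ σ →
        K * σ * Real.log (2 + σ * tmix / ε) ≤ T →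
        K * (α * T ^ 2 * tmix ^ (1 / 2 : ℝ)) ≤ σ * ε ^ (1 / 2 : ℝ) →
        traceNorm (ρfix - ketbra ψ₀) < ε) := by
  constructor
  · intro c hc
    have hs : 0 < c ^ (1 / 2 : ℝ) := Real.rpow_pos_of_pos hc _
    -- 81 dominates the 80 of the one-step error and the coefficient 1 of `ε`; 42 is the defect
    -- constant, with `c^(-1/2)` from the change of prefactor.
    refine ⟨81 + 42 * (c ^ (1 / 2 : ℝ))⁻¹, by positivity, ?_⟩
    intro d H ψ₀ Δ 𝒜 g σ T α ε ρfix τ hH hΔ hψ h𝒜 hg hσ hT hα hε hfix hmix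
    set C := 81 + 42 * (c ^ (1 / 2 : ℝ))⁻¹ with hC
    have hC1 : 81 ≤ C := by rw [hC]; linarith [inv_pos.2 hs]
    have hP : IsDensityMatrix (ketbra ψ₀) := isDensityMatrix_ketbra hψ.1
    have hm2 := couplingMean_opNorm_pow_nonneg (𝒜 := 𝒜) 2
    have hm4 := couplingMean_opNorm_pow_nonneg (𝒜 := 𝒜) 4
    have hD := generatorDefect_ketbra_le (𝒜 := 𝒜) hH hσ hΔ hψ hg
    have hdist := traceNorm_sub_le_of_isMixingTime (F := channelLinear 𝒜 T α hH hσ hg)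
      (traceNorm_channel_le hH hσ hg h𝒜.nonempty) hP hmix
    have hstep := traceNorm_channel_ketbra_sub_le hH hσ hT hα hΔ hψ hg h𝒜
    set m2 := couplingMean 𝒜 fun A => opNorm A ^ 2
    set m4 := couplingMean 𝒜 fun A => opNorm A ^ 4
    set D := generatorDefect H 𝒜 g σ (ketbra ψ₀)
    set e2 := σ * Real.exp (-T ^ 2 / (4 * σ ^ 2)) * m2 with he2
    set e4 := α ^ 2 * T ^ 4 * σ⁻¹ ^ 2 * m4 with he4
    have he20 : 0 ≤ e2 := by positivity
    have he40 : 0 ≤ e4 := by positivity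
    have ht : 0 ≤ α ^ 2 * (τ : ℝ) := by positivity
    have hbase : traceNorm (ρfix - ketbra ψ₀) ≤ (D + 80 * (e2 + e4)) * (α ^ 2 * τ) + ε := by
      refine hdist.trans (add_le_add ?_ le_rfl)
      refine (mul_le_mul_of_nonneg_left hstep (Nat.cast_nonneg τ)).trans_eq ?_
      ring
    refine ⟨hbase.trans ?_, fun hch => ?_⟩
    · refine add_le_add (mul_le_mul_of_nonneg_right ?_ ht) le_rfl
      nlinarith
    have hw := filterWidth_le hc hσ (opNorm_nonneg H) hch
    set w := opNorm H ^ (1 / 2 : ℝ) * σ ^ (3 / 2 : ℝ) with hwdef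
    have hw0 : 0 ≤ w := mul_nonneg (Real.rpow_nonneg (opNorm_nonneg H) _) (Real.rpow_nonneg hσ.le _)
    -- The decay obtained, with 1/2 in the exponent, is stronger than the 1/32 required.
    have hexp : Real.exp (-(σ ^ 2 * Δ ^ 2 / 2)) ≤ Real.exp (-(σ ^ 2 * Δ ^ 2 / 32)) :=
      Real.exp_le_exp.2 (by nlinarith [mul_nonneg (sq_nonneg σ) (sq_nonneg Δ)])
    set e1 := w * Real.exp (-(σ ^ 2 * Δ ^ 2 / 32)) * m2 with he1
    have he10 : 0 ≤ e1 := by positivity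
    have hD1 : D ≤ C * e1 := by
      calc D ≤ 42 * (σ * Real.exp (-(σ ^ 2 * Δ ^ 2 / 2)) * m2) := hD
        _ ≤ 42 * ((c ^ (1 / 2 : ℝ))⁻¹ * w * Real.exp (-(σ ^ 2 * Δ ^ 2 / 32)) * m2) := by
          gcongr
        _ = 42 * (c ^ (1 / 2 : ℝ))⁻¹ * e1 := by rw [he1]; ring
        _ ≤ C * e1 := mul_le_mul_of_nonneg_right (by rw [hC]; linarith) he10
    refine ⟨hD1, hbase.trans ?_⟩
    have h1 : D + 80 * (e2 + e4) ≤ C * (e1 + e2 + e4) := by nlinarith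
    have h2 := mul_le_mul_of_nonneg_right h1 ht
    nlinarith
  · intro ε₀ hε₀ hε₁
    -- The error budget is `δ = 1 - ε₀`, the smallest value of the factor `1 - ε` lost to mixing.
    refine ⟨1000 / (1 - ε₀), div_pos (by norm_num) (by linarith), ?_⟩
    intro d H ψ₀ Δ 𝒜 g σ T α ε ρfix τ tmix hH hΔ hψ h𝒜 hg hσ hT hα hε hεε hfix hmix htmix
      h1 h2 h3
    have hP : IsDensityMatrix (ketbra ψ₀) := isDensityMatrix_ketbra hψ.1
    -- In dimension one the gap condition is vacuous and `Δ` is not controlled by `‖H‖`, but there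
    -- is only one state.
    by_cases hd : d = 1
    · subst hd
      rw [hP.eq_of_dim_one hfix.1, sub_self, traceNorm_zero]
      exact hε
    have hgap : Δ ≤ 2 * opNorm H := gap_le_two_mul_norm hH hΔ hψ hd
    have ht : 0 ≤ tmix := by rw [htmix]; positivity
    have hlt := error_lt_of_parameters (δ := 1 - ε₀) (by linarith) (by linarith) hΔ hgap hσ hα hε
      ht h1 h2 h3
    have hm2 := couplingMean_opNorm_pow_le_one h𝒜 2
    have hm4 := couplingMean_opNorm_pow_le_one h𝒜 4
    have hD := generatorDefect_ketbra_le (𝒜 := 𝒜) hH hσ hΔ hψ hg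
    have hdist := one_sub_mul_traceNorm_sub_le_of_isMixingTime
      (F := channelLinear 𝒜 T α hH hσ hg) (traceNorm_channel_le hH hσ hg h𝒜.nonempty) hP hfix.1
      hfix.2.1 hε.le hmix
    have hstep := traceNorm_channel_ketbra_sub_le hH hσ hT hα hΔ hψ hg h𝒜
    set m2 := couplingMean 𝒜 fun A => opNorm A ^ 2
    set m4 := couplingMean 𝒜 fun A => opNorm A ^ 4
    have k1 : σ * Real.exp (-(σ ^ 2 * Δ ^ 2 / 2)) * m2 ≤ σ * Real.exp (-(σ ^ 2 * Δ ^ 2 / 2)) :=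
      mul_le_of_le_one_right (by positivity) hm2
    have k2 : σ * Real.exp (-T ^ 2 / (4 * σ ^ 2)) * m2 ≤ σ * Real.exp (-T ^ 2 / (4 * σ ^ 2)) :=
      mul_le_of_le_one_right (by positivity) hm2
    have k3 : α ^ 2 * T ^ 4 * σ⁻¹ ^ 2 * m4 ≤ α ^ 2 * T ^ 4 * σ⁻¹ ^ 2 :=
      mul_le_of_le_one_right (by positivity) hm4
    -- The strict gain is kept here: if the distance were at least `ε`, the left side would be at
    -- least `(1 - ε) ε ≥ (1 - ε₀) ε`.
    have hlt' : (1 - ε) * traceNorm (ρfix - ketbra ψ₀) < (1 - ε₀) * ε := by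
      refine (hdist.trans ((mul_le_mul_of_nonneg_left hstep (Nat.cast_nonneg τ)).trans ?_)).trans_lt
        hlt
      rw [← mul_assoc, mul_comm (τ : ℝ), ← htmix, mul_comm tmix]
      exact mul_le_mul_of_nonneg_right (by linarith) ht
    by_contra! hge
    have h5 : (1 - ε₀) * ε ≤ (1 - ε) * ε := mul_le_mul_of_nonneg_right (by linarith) hε.le
    have h6 := mul_le_mul_of_nonneg_left hge (show 0 ≤ 1 - ε by linarith)
    linarith
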